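/- **Theorem (Determinant formula).** Let $X=(VX,EX)$ be a countable simple graph of bounded degree, let $\Gamma$ be a countable group of automorphisms of $X$ such that no $\gamma\neq 1$ in $\Gamma$ fixes a vertex, and assume that $VX/\Gamma$ is finite. Let $F\subset VX$ be a set of representatives of the $\Gamma$-orbits of vertices. Put $d=\sup_{v}\deg(v)$ and $\alpha=\frac{d+\sqrt{d^2+4d}}{2}$. *Zeta function.* A closed path of length $m\ge 1$ is $C=(v_0,\dots,v_m=v_0)$ with $v_i\sim v_{i+1}$. It is *reduced* if $v_{i-1}\ne v_{i+1}$ for $1\le i\le m-1$ (no backtracking) and there is no $k\in\{1,\dots,\lfloor m/2\rfloor-1\}$ with $v_j=v_{m-j}$ for $j=1,\dots,k$ (no tail); it is *primitive* if it is not obtained by going $n\ge2$ times around some closed path. A *cycle* is a class of closed paths modulo shifts of the origin, and a *prime cycle* is the class of a primitive reduced closed path. For a cycle $C$ let $|C|$ be its length and $\Gamma_C$ its stabilizer in $\Gamma$. Then $$Z_{X,\Gamma}(u)=\prod_{[C]_\Gamma}\bigl(1-u^{|C|}\bigr)^{-1/|\Gamma_C|},$$ where the product is over the $\Gamma$-orbits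 of prime cycles and the power is the principal one. *Determinant.* Let $\mathcal N(X,\Gamma)$ be the von Neumann algebra of bounded operators on $\ell^2(VX)$ that commute with the translations $(\lambda(\gamma)f)(x)=f(\gamma^{-1}x)$, $\gamma\in\Gamma$, and let $\mathrm{Tr}_\Gamma(T)=\sum_{x\in F}T(x,x)$. If $T\in\mathcal N(X,\Gamma)$ and $0$ is not in the convex hull of the spectrum $\sigma(T)$, put $$\det\nolimits_\Gamma(T)=\exp\Bigl(\mathrm{Tr}_\Gamma\Bigl(\frac1{2\pi i}\oint_{\mathcal C}\log z\,(z-T)^{-1}\,dz\Bigr)\Bigr),$$ where $\mathcal C$ is the boundary of a disc that contains the convex hull of $\sigma(T)$ and on whose closure a branch $\log$ of the logarithm is defined. Let $A$ be the adjacency operator of $X$ on $\ell^2(VX)$, let $Q$ be the diagonal operator with entries $\deg(v)-1$, and let $\chi(B)=|V(B)|-|E(B)|$ be the Euler characteristic of $B=X/\Gamma$, where $|V(B)|$ is the number of $\Gamma$-orbits of vertices and $|E(B)|$ is half the number of $\Gamma$-orbits of oriented edges (that is, the number of $\Gamma$-orbits of geometric edges, if no edge is inverted by an element of $\Gamma$).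 Then for every $u\in\mathbb C$ with $\alpha|u|<1$ (and, if $X$ has no edges, $u^2\neq1$) the operator $I-Au+Qu^2$ lies in $\mathcal N(X,\Gamma)$, $0$ is not in the convex hull of its spectrum, the product defining $Z_{X,\Gamma}(u)$ converges (unconditionally), and, for every admissible choice of the disc and of the branch of the logarithm, $$\frac1{Z_{X,\Gamma}(u)}=(1-u^2)^{-\chi(B)}\,\det\nolimits_\Gamma(I-Au+Qu^2),$$ with the principal power of $1-u^2$. -/

import Mathlib

open scoped lp

namespace IharaZeta

noncomputable section

/-! ## Closed paths and cycles -/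

/-- A closed path `(v₀, …, vₘ = v₀)` of length `m ≥ 1` in a simple graph. It is stored as the
`m`-periodic sequence `vert : ℤ → V`, so that indices are automatically read modulo `m`. -/
@[ext]
structure ClosedPath {V : Type*} (X : SimpleGraph V) where
  length : ℕ
  vert : ℤ → V
  length_pos : 0 < length
  periodic : ∀ i, vert (i + length) = vert i
  adj : ∀ i, X.Adj (vert i) (vert (i + 1))

namespace ClosedPath

variable {V : Type*} {X : SimpleGraph V}

/-- No backtracking: `vᵢ₋₁ ≠ vᵢ₊₁` for `i ∈ {1, …, m - 1}`. -/
def IsProper (C : ClosedPath X) : Prop :=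
  ∀ i : ℤ, 1 ≤ i → i ≤ C.length - 1 → C.vert (i - 1) ≠ C.vert (i + 1)

/-- There is `k ∈ {1, …, ⌊m/2⌋ - 1}` such that `vⱼ = vₘ₋ⱼ` for `j = 1, …, k`. -/
def HasTail (C : ClosedPath X) : Prop :=
  ∃ k : ℕ, 1 ≤ k ∧ k + 1 ≤ C.length / 2 ∧
    ∀ j : ℤ, 1 ≤ j → j ≤ k → C.vert j = C.vert (C.length - j)

/-- Reduced closed paths: proper and without tail. -/
def IsReduced (C : ClosedPath X) : Prop := C.IsProper ∧ ¬ C.HasTail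

/-- `C` is not obtained by going `n ≥ 2` times around some closed path `D`. -/
def IsPrimitive (C : ClosedPath X) : Prop :=
  ¬ ∃ (n : ℕ) (D : ClosedPath X), 2 ≤ n ∧ C.length = n * D.length ∧ C.vert = D.vert

/-- `C ∼ₒ D`: same length, and `D` is `C` with the origin shifted by `k` steps. -/
def rotationSetoid (X : SimpleGraph V) : Setoid (ClosedPath X) where
  r C D := C.length = D.length ∧ ∃ k : ℤ, ∀ j, D.vert j = C.vert (j + k)
  iseqv :=
    { refl := fun C => ⟨rfl, 0, fun j => by simp⟩
      symm := fun {C D} h => by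
        obtain ⟨h, k, hk⟩ := h
        exact ⟨h.symm, -k, fun j => by simp [hk]⟩
      trans := fun {C D E} h h' => by
        obtain ⟨h, k, hk⟩ := h
        obtain ⟨h', k', hk'⟩ := h'
        exact ⟨h.trans h', k' + k, fun j => by rw [hk', hk, add_assoc]⟩ }

/-- Automorphisms of the graph act on closed paths. -/
instance : MulAction (X ≃g X) (ClosedPath X) where
  smul g C :=
    { length := C.length
      vert := fun i => g • C.vert i
      length_pos := C.length_pos
      periodic := fun i => by rw [C.periodic]
      adj := fun i => g.map_adj_iff.2 (C.adj i) }
  one_smul C := rfl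
  mul_smul g h C := rfl

end ClosedPath

/-- Cycles: closed paths up to a shift of the origin. -/
def Cycle {V : Type*} (X : SimpleGraph V) : Type _ := Quotient (ClosedPath.rotationSetoid X)

namespace Cycle

variable {V : Type*} {X : SimpleGraph V}

/-- The length `|C|`. -/
def length (c : Cycle X) : ℕ :=
  Quotient.lift (s := ClosedPath.rotationSetoid X) ClosedPath.length (fun _ _ h => h.1) c

/-- Automorphisms of the graph act on cycles. -/
instance : MulAction (X ≃g X) (Cycle X) where
  smul g := Quotient.map (sa := ClosedPath.rotationSetoid X) (sb := ClosedPath.rotationSetoid X)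
    (fun C => g • C) (fun _ _ h => ⟨h.1, h.2.imp fun _ hk j => congrArg (g • ·) (hk j)⟩)
  one_smul c := Quotient.inductionOn c fun _ => rfl
  mul_smul _ _ c := Quotient.inductionOn c fun _ => rfl

/-- Prime cycles: classes of primitive reduced closed paths. -/
def IsPrime (c : Cycle X) : Prop :=
  ∃ C : ClosedPath X, C.IsReduced ∧ C.IsPrimitive ∧
    Quotient.mk (ClosedPath.rotationSetoid X) C = c

theorem length_smul (g : X ≃g X) (c : Cycle X) : (g • c).length = c.length :=
  Quotient.inductionOn c fun _ => rfl

end Cycle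

/-! ## The zeta function -/

section Zeta

variable {V : Type*} {X : SimpleGraph V} (Γ : Subgroup (X ≃g X))

/-- `[P]_Γ`: the `Γ`-orbits of prime cycles. -/
def PrimeClass : Type _ :=
  {q : MulAction.orbitRel.Quotient Γ (Cycle X) //
    ∃ c : Cycle X, c.IsPrime ∧ Quotient.mk (MulAction.orbitRel Γ (Cycle X)) c = q}

/-- `(1 - u^|C|)^(-1/|Γ_C|)`, with the principal branch of the power, where `Γ_C` is the stabilizer
in `Γ` of the cycle `C`. -/
def cycleFactor (u : ℂ) (c : Cycle X) : ℂ :=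
  (1 - u ^ c.length) ^ (-(1 / (Nat.card (MulAction.stabilizer Γ c) : ℂ)))

theorem cycleFactor_eq_of_orbitRel (u : ℂ) {c c' : Cycle X}
    (h : MulAction.orbitRel Γ (Cycle X) c c') : cycleFactor Γ u c = cycleFactor Γ u c' := by
  have h1 : Nat.card (MulAction.stabilizer Γ c) = Nat.card (MulAction.stabilizer Γ c') :=
    Nat.card_congr (MulAction.stabilizerEquivStabilizerOfOrbitRel h).toEquiv
  have h2 : c.length = c'.length := by
    obtain ⟨γ, rfl⟩ := h
    exact Cycle.length_smul (γ : X ≃g X) c'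
  unfold cycleFactor
  rw [h1, h2]

/-- The factor of the zeta function that belongs to a `Γ`-class of prime cycles. -/
def eulerFactor (u : ℂ) (q : PrimeClass Γ) : ℂ :=
  Quotient.lift (s := MulAction.orbitRel Γ (Cycle X)) (cycleFactor Γ u)
    (fun _ _ h => cycleFactor_eq_of_orbitRel Γ u h) q.1

/-- `Z_{X,Γ}(u) = ∏ (1 - u^|C|)^(-1/|Γ_C|)` over the `Γ`-classes of prime cycles. -/
def zeta (u : ℂ) : ℂ := ∏' q : PrimeClass Γ, eulerFactor Γ u q

end Zeta

/-! ## The Euler characteristic of the quotient graph -/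

section Euler

variable {V : Type*} {X : SimpleGraph V}

/-- Automorphisms act on oriented edges. -/
instance : MulAction (X ≃g X) X.Dart where
  smul g e := ⟨(g • e.fst, g • e.snd), g.map_adj_iff.2 e.adj⟩
  one_smul _ := rfl
  mul_smul _ _ _ := rfl

/-- Automorphisms act on geometric edges. -/
instance : MulAction (X ≃g X) X.edgeSet where
  smul g e := ⟨Sym2.map (g • ·) e.1, by
    obtain ⟨e, he⟩ := e
    induction e using Sym2.ind with
    | _ a b => exact g.map_adj_iff.2 he⟩
  one_smul e := Subtype.ext (by
    change Sym2.map (fun x => x) e.1 = e.1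
    exact congrFun Sym2.map_id e.1)
  mul_smul g h e := Subtype.ext (by
    change Sym2.map (fun x => g • h • x) e.1 = Sym2.map (g • ·) (Sym2.map (h • ·) e.1)
    rw [Sym2.map_map]; rfl)

/-- `χ(B) = |V(B)| - |E(B)|` for `B = X/Γ`, where `|E(B)|` is half the number of oriented edges
of `B` (that is, of `Γ`-orbits of oriented edges of `X`). If no edge of `X` is inverted by an
element of `Γ`, then `|E(B)|` is the number of `Γ`-orbits of geometric edges, see
`quotientEulerChar_eq`; an orbit of inverted edges counts `1/2`. -/
def quotientEulerChar (Γ : Subgroup (X ≃g X)) : ℝ :=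
  Nat.card (MulAction.orbitRel.Quotient Γ V) -
    (Nat.card (MulAction.orbitRel.Quotient Γ X.Dart) : ℝ) / 2

theorem quotientEulerChar_eq (Γ : Subgroup (X ≃g X))
    (hinv : ∀ γ ∈ Γ, ∀ v w : V, X.Adj v w → γ • v = w → γ • w ≠ v) :
    quotientEulerChar Γ = Nat.card (MulAction.orbitRel.Quotient Γ V) -
      Nat.card (MulAction.orbitRel.Quotient Γ X.edgeSet) := by
  have hex : ∀ q : MulAction.orbitRel.Quotient Γ X.edgeSet, ∃ e : X.Dart,
      Quotient.mk (MulAction.orbitRel Γ X.edgeSet) ⟨e.edge, e.edge_mem⟩ = q := by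
    intro q
    induction q using Quotient.inductionOn with
    | _ e =>
      obtain ⟨e, he⟩ := e
      induction e using Sym2.ind with
      | _ a b => exact ⟨⟨(a, b), he⟩, rfl⟩
  choose e he using hex
  let φ : MulAction.orbitRel.Quotient Γ X.edgeSet × Bool → MulAction.orbitRel.Quotient Γ X.Dart :=
    fun p => Quotient.mk (MulAction.orbitRel Γ X.Dart) (if p.2 then e p.1 else (e p.1).symm)
  have hedge : ∀ p : MulAction.orbitRel.Quotient Γ X.edgeSet × Bool,
      (if p.2 then e p.1 else (e p.1).symm).edge = (e p.1).edge := by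
    rintro ⟨q, _ | _⟩ <;> simp
  have hφ : Function.Bijective φ := by
    constructor
    · rintro ⟨q, b⟩ ⟨q', b'⟩ h
      obtain ⟨γ, hγ⟩ := Quotient.exact h
      have hq : q = q' := by
        rw [← he q, ← he q']
        refine Quotient.sound ⟨γ, Subtype.ext ?_⟩
        have := congrArg SimpleGraph.Dart.edge hγ
        rw [hedge (q, b)] at this
        exact Eq.trans (congrArg (Sym2.map fun v => (γ : X ≃g X) • v) (hedge (q', b')).symm) this
      subst hq
      have h1 := congrArg (fun x : X.Dart => x.fst) hγ
      have h2 := congrArg (fun x : X.Dart => x.snd) hγ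
      have key := hinv γ γ.2
      rcases b with _ | _ <;> rcases b' with _ | _
      · rfl
      · exact absurd h2 (key _ _ (e q).adj h1)
      · exact absurd h2 (key _ _ (e q).symm.adj h1)
      · rfl
    · intro q
      induction q using Quotient.inductionOn with
      | _ x =>
        have h := Quotient.exact (he (Quotient.mk (MulAction.orbitRel Γ X.edgeSet)
          ⟨x.edge, x.edge_mem⟩))
        set y := e (Quotient.mk (MulAction.orbitRel Γ X.edgeSet) ⟨x.edge, x.edge_mem⟩) with hy
        obtain ⟨γ, hγ⟩ := h
        have hxy : (γ • x).edge = y.edge := congrArg Subtype.val hγ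
        rcases SimpleGraph.dart_edge_eq_iff _ _ |>.1 hxy with h | h
        · exact ⟨(Quotient.mk (MulAction.orbitRel Γ X.edgeSet) ⟨x.edge, x.edge_mem⟩, true),
            Quotient.sound (s := MulAction.orbitRel Γ X.Dart) ⟨γ, h⟩⟩
        · exact ⟨(Quotient.mk (MulAction.orbitRel Γ X.edgeSet) ⟨x.edge, x.edge_mem⟩, false),
            Quotient.sound (s := MulAction.orbitRel Γ X.Dart) ⟨γ, h⟩⟩
  have hcard := Nat.card_eq_of_bijective φ hφ
  rw [Nat.card_prod, Nat.card_eq_fintype_card (α := Bool), Fintype.card_bool] at hcard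
  rw [quotientEulerChar, ← hcard]
  push_cast
  ring

end Euler

/-! ## Operators on `ℓ²(V)` -/

section Operators

variable {V : Type*}

/-- A linear map on functions that is bounded for the `ℓ²`-norm, as an operator on `ℓ²(V)`. -/
def boundedOperator (L : (V → ℂ) →ₗ[ℂ] (V → ℂ)) (C : ℝ) (hC : 0 ≤ C)
    (h : ∀ (f : ℓ²(V, ℂ)) (s : Finset V), ∑ v ∈ s, ‖L (⇑f) v‖ ^ 2 ≤ (C * ‖f‖) ^ 2) :
    ℓ²(V, ℂ) →L[ℂ] ℓ²(V, ℂ) :=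
  LinearMap.mkContinuous
    { toFun := fun f => ⟨L (⇑f), memℓp_gen' (C := (C * ‖f‖) ^ 2) (fun s => by simpa using h f s)⟩
      map_add' := fun f g => by
        apply lp.ext
        change L (⇑(f + g)) = L (⇑f) + L (⇑g)
        rw [lp.coeFn_add, map_add]
      map_smul' := fun c f => by
        apply lp.ext
        change L (⇑(c • f)) = c • L (⇑f)
        rw [lp.coeFn_smul, map_smul] }
    C (fun f => lp.norm_le_of_forall_sum_le (by norm_num) (by positivity)
      (fun s => by simpa using h f s))

theorem sum_sq_le (f : ℓ²(V, ℂ)) (s : Finset V) : ∑ v ∈ s, ‖f v‖ ^ 2 ≤ ‖f‖ ^ 2 := by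
  simpa using lp.sum_rpow_le_norm_rpow (p := 2) (by norm_num) f s

/-- `λ(γ)`: `(λ(γ) f)(x) = f(γ⁻¹ x)`. -/
def translation {X : SimpleGraph V} (γ : X ≃g X) : ℓ²(V, ℂ) →L[ℂ] ℓ²(V, ℂ) :=
  boundedOperator (LinearMap.funLeft ℂ ℂ fun x => γ⁻¹ • x) 1 zero_le_one (fun f s => by
    classical
    have := sum_sq_le f (s.image fun x => γ⁻¹ • x)
    rw [Finset.sum_image (fun x _ y _ hxy => MulAction.injective γ⁻¹ hxy)] at this
    simpa [LinearMap.funLeft] using this)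

theorem translation_apply {X : SimpleGraph V} (γ : X ≃g X) (f : ℓ²(V, ℂ)) (x : V) :
    translation γ f x = f (γ⁻¹ • x) := rfl

/-- `N(X, Γ)`: the von Neumann algebra of bounded operators on `ℓ²(V)` that commute with all
`λ(γ)`, `γ ∈ Γ`. See `mem_invariantAlgebra_iff`. -/
def invariantAlgebra {X : SimpleGraph V} (Γ : Subgroup (X ≃g X)) :
    VonNeumannAlgebra ℓ²(V, ℂ) where
  toStarSubalgebra := StarSubalgebra.centralizer ℂ (Set.range fun γ : Γ => translation (γ : X ≃g X))
  centralizer_centralizer' := by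
    change Set.centralizer (Set.centralizer (SetLike.coe (StarSubalgebra.centralizer ℂ
      (Set.range fun γ : Γ => translation (γ : X ≃g X))))) =
      SetLike.coe (StarSubalgebra.centralizer ℂ (Set.range fun γ : Γ => translation (γ : X ≃g X)))
    simp only [StarSubalgebra.coe_centralizer, Set.centralizer_centralizer_centralizer]

theorem star_translation {X : SimpleGraph V} (γ : X ≃g X) :
    star (translation γ) = translation γ⁻¹ := by
  rw [ContinuousLinearMap.star_eq_adjoint, eq_comm, ContinuousLinearMap.eq_adjoint_iff]
  intro f g
  rw [lp.inner_eq_tsum, lp.inner_eq_tsum, ← Equiv.tsum_eq (MulAction.toPerm γ⁻¹)]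
  refine tsum_congr fun x => ?_
  rw [translation_apply, translation_apply]
  simp

theorem mem_invariantAlgebra_iff {X : SimpleGraph V} (Γ : Subgroup (X ≃g X))
    (T : ℓ²(V, ℂ) →L[ℂ] ℓ²(V, ℂ)) :
    T ∈ invariantAlgebra Γ ↔ ∀ γ ∈ Γ, translation γ * T = T * translation γ := by
  change T ∈ StarSubalgebra.centralizer ℂ (Set.range fun γ : Γ => translation (γ : X ≃g X)) ↔ _
  rw [StarSubalgebra.mem_centralizer_iff]
  constructor
  · intro h γ hγ
    exact (h _ ⟨⟨γ, hγ⟩, rfl⟩).1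
  · rintro h _ ⟨γ, rfl⟩
    refine ⟨h γ γ.2, ?_⟩
    rw [star_translation]
    exact h _ (Γ.inv_mem γ.2)

/-- The matrix entry `T(x, y)` of an operator on `ℓ²(V)`. -/
def entry (T : ℓ²(V, ℂ) →L[ℂ] ℓ²(V, ℂ)) (x y : V) : ℂ :=
  open Classical in T (lp.single 2 y 1) x

/-- `Tr_Γ(T) = ∑_{x ∈ F} T(x, x)`, for a set `F` of representatives of the `Γ`-orbits in `V`. -/
def trace (F : Finset V) (T : ℓ²(V, ℂ) →L[ℂ] ℓ²(V, ℂ)) : ℂ := ∑ x ∈ F, entry T x x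

variable (X : SimpleGraph V) [X.LocallyFinite]

/-- `d`, the supremum of the degrees (for a graph of bounded degree). -/
def supDegree : ℕ := ⨆ v, X.degree v

/-- `α = (d + √(d² + 4d)) / 2`. -/
def alpha : ℝ := ((supDegree X : ℝ) + √((supDegree X : ℝ) ^ 2 + 4 * supDegree X)) / 2

variable {X}

theorem degree_le_supDegree (hd : BddAbove (Set.range fun v => X.degree v)) (v : V) :
    X.degree v ≤ supDegree X := le_ciSup hd v

variable (X)

/-- The adjacency matrix as a linear map on functions. -/
def adjLinear : (V → ℂ) →ₗ[ℂ] (V → ℂ) where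
  toFun f v := ∑ w ∈ X.neighborFinset v, f w
  map_add' f g := by ext v; simp [Finset.sum_add_distrib]
  map_smul' c f := by ext v; simp [Finset.mul_sum]

/-- The diagonal matrix `Q` with entries `deg(v) - 1`, as a linear map on functions. -/
def degLinear : (V → ℂ) →ₗ[ℂ] (V → ℂ) where
  toFun f v := ((X.degree v : ℂ) - 1) * f v
  map_add' f g := by ext v; simp [mul_add]
  map_smul' c f := by ext v; simp [mul_left_comm]

variable {X}

theorem adjLinear_bound (hd : BddAbove (Set.range fun v => X.degree v)) (f : ℓ²(V, ℂ))
    (s : Finset V) :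
    ∑ v ∈ s, ‖adjLinear X (⇑f) v‖ ^ 2 ≤ ((supDegree X : ℝ) * ‖f‖) ^ 2 := by
  classical
  set d : ℝ := (supDegree X : ℝ) with hd'
  have hdeg : ∀ v, (X.degree v : ℝ) ≤ d := fun v =>
    Nat.cast_le.2 (degree_le_supDegree hd v)
  have hd0 : 0 ≤ d := by positivity
  have h1 : ∀ v, ‖adjLinear X (⇑f) v‖ ^ 2 ≤ d * ∑ w ∈ X.neighborFinset v, ‖f w‖ ^ 2 := by
    intro v
    calc ‖adjLinear X (⇑f) v‖ ^ 2 ≤ (∑ w ∈ X.neighborFinset v, ‖f w‖) ^ 2 := by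
          gcongr
          exact norm_sum_le _ _
      _ ≤ (X.neighborFinset v).card * ∑ w ∈ X.neighborFinset v, ‖f w‖ ^ 2 :=
          sq_sum_le_card_mul_sum_sq
      _ ≤ d * ∑ w ∈ X.neighborFinset v, ‖f w‖ ^ 2 := by
          gcongr
          exact hdeg v
  calc ∑ v ∈ s, ‖adjLinear X (⇑f) v‖ ^ 2
      ≤ ∑ v ∈ s, d * ∑ w ∈ X.neighborFinset v, ‖f w‖ ^ 2 := Finset.sum_le_sum fun v _ => h1 v
    _ = d * ∑ w ∈ s.biUnion (fun v => X.neighborFinset v), ∑ v ∈ s.filter (fun v => X.Adj w v), ‖f w‖ ^ 2 := by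
        rw [← Finset.mul_sum]
        congr 1
        apply Finset.sum_comm'
        intro v w
        simp only [SimpleGraph.mem_neighborFinset, Finset.mem_filter, Finset.mem_biUnion]
        constructor
        · rintro ⟨hv, h⟩
          exact ⟨⟨hv, h.symm⟩, v, hv, h⟩
        · rintro ⟨⟨hv, h⟩, -⟩
          exact ⟨hv, h.symm⟩
    _ ≤ d * ∑ w ∈ s.biUnion (fun v => X.neighborFinset v), d * ‖f w‖ ^ 2 := by
        gcongr with w _
        rw [Finset.sum_const, nsmul_eq_mul]
        gcongr
        refine le_trans ?_ (hdeg w)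
        rw [← SimpleGraph.card_neighborFinset_eq_degree]
        have hsub : s.filter (fun v => X.Adj w v) ⊆ X.neighborFinset w := fun v hv => by
          simpa using (Finset.mem_filter.1 hv).2
        exact_mod_cast Finset.card_le_card hsub
    _ = d ^ 2 * ∑ w ∈ s.biUnion (fun v => X.neighborFinset v), ‖f w‖ ^ 2 := by
        rw [← Finset.mul_sum]; ring
    _ ≤ d ^ 2 * ‖f‖ ^ 2 := by
        gcongr
        exact sum_sq_le f _
    _ = (d * ‖f‖) ^ 2 := by ring

theorem degLinear_bound (hd : BddAbove (Set.range fun v => X.degree v)) (f : ℓ²(V, ℂ))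
    (s : Finset V) :
    ∑ v ∈ s, ‖degLinear X (⇑f) v‖ ^ 2 ≤ (((supDegree X : ℝ) + 1) * ‖f‖) ^ 2 := by
  calc ∑ v ∈ s, ‖degLinear X (⇑f) v‖ ^ 2
      ≤ ∑ v ∈ s, ((supDegree X : ℝ) + 1) ^ 2 * ‖f v‖ ^ 2 := by
        refine Finset.sum_le_sum fun v _ => ?_
        change ‖((X.degree v : ℂ) - 1) * f v‖ ^ 2 ≤ _
        rw [norm_mul, mul_pow]
        gcongr
        refine (norm_sub_le _ _).trans ?_
        rw [norm_one, Complex.norm_natCast]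
        gcongr
        exact degree_le_supDegree hd v
    _ ≤ (((supDegree X : ℝ) + 1) * ‖f‖) ^ 2 := by
        rw [← Finset.mul_sum, mul_pow]
        gcongr
        exact sum_sq_le f s

/-- The adjacency operator `A` on `ℓ²(V)`: `(A f)(v) = ∑_{w ∼ v} f(w)`. -/
def adjOperator (hd : BddAbove (Set.range fun v => X.degree v)) : ℓ²(V, ℂ) →L[ℂ] ℓ²(V, ℂ) :=
  boundedOperator (adjLinear X) (supDegree X) (by positivity) (adjLinear_bound hd)

/-- The operator `Q` on `ℓ²(V)`: `(Q f)(v) = (deg(v) - 1) f(v)`. -/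
def degOperator (hd : BddAbove (Set.range fun v => X.degree v)) : ℓ²(V, ℂ) →L[ℂ] ℓ²(V, ℂ) :=
  boundedOperator (degLinear X) ((supDegree X : ℝ) + 1) (by positivity) (degLinear_bound hd)

/-- `Δ(u) = I - A u + Q u²`. -/
def deformedLaplacian (hd : BddAbove (Set.range fun v => X.degree v)) (u : ℂ) :
    ℓ²(V, ℂ) →L[ℂ] ℓ²(V, ℂ) :=
  1 - u • adjOperator hd + u ^ 2 • degOperator hd

end Operators

/-! ## The analytic determinant -/

section Determinant

/-- The data in the definition of `log T` by the holomorphic functional calculus: a region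
containing the convex hull of the spectrum of `T`, and a branch of the logarithm on it. The region
is taken to be a disc, with its boundary circle as contour; such discs exist whenever the convex
hull of the spectrum does not contain `0`, see `nonempty_logContour_iff`. -/
structure LogContour {E : Type*} [NormedAddCommGroup E] [NormedSpace ℂ E] (T : E →L[ℂ] E) where
  center : ℂ
  radius : ℝ
  branch : ℂ → ℂ
  radius_pos : 0 < radius
  convexHull_subset : convexHull ℝ (spectrum ℂ T) ⊆ Metric.ball center radius
  continuousOn_branch : ContinuousOn branch (Metric.closedBall center radius)
  exp_branch : ∀ z ∈ Metric.closedBall center radius, Complex.exp (branch z) = z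

/-- `log T = (2πi)⁻¹ ∮ log(z) (z - T)⁻¹ dz`. -/
def LogContour.log {E : Type*} [NormedAddCommGroup E] [NormedSpace ℂ E] {T : E →L[ℂ] E}
    (K : LogContour T) : E →L[ℂ] E :=
  (2 * Real.pi * Complex.I : ℂ)⁻¹ •
    ∮ z in C(K.center, K.radius), K.branch z • resolvent T z

theorem isCompact_convexHull_complex {S : Set ℂ} (hS : IsCompact S) :
    IsCompact (convexHull ℝ S) := by
  have himg : convexHull ℝ S = (fun p : (Fin 3 → ℝ) × (Fin 3 → ℂ) => ∑ i, p.1 i • p.2 i) ''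
      (stdSimplex ℝ (Fin 3) ×ˢ Set.univ.pi fun _ => S) := by
    ext x
    constructor
    · intro hx
      obtain ⟨ι, _, z, w, hz, hind, hw, hw1, hx⟩ := eq_pos_convex_span_of_mem_convexHull hx
      have hcard : Fintype.card ι ≤ Fintype.card (Fin 3) := by
        have h1 := hind.card_le_finrank_succ
        have h2 := Submodule.finrank_le (vectorSpan ℝ (Set.range z))
        rw [Complex.finrank_real_complex] at h2
        simpa using h1.trans (Nat.succ_le_succ h2)
      obtain ⟨e⟩ := Function.Embedding.nonempty_of_card_le hcard
      have hι : Nonempty ι := by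
        by_contra hne
        rw [not_nonempty_iff] at hne
        simp at hw1
      obtain ⟨i₀⟩ := hι
      refine ⟨(Function.extend e w 0, Function.extend e z fun _ => z i₀),
        ⟨⟨fun j => ?_, ?_⟩, ?_⟩, ?_⟩
      · by_cases hj : ∃ i, e i = j
        · obtain ⟨i, rfl⟩ := hj
          dsimp only
          rw [e.injective.extend_apply]
          exact (hw i).le
        · dsimp only
          rw [Function.extend_apply' _ _ _ hj]; rfl
      · rw [← hw1]
        refine (Fintype.sum_of_injective e e.injective _ _ (fun j hj => ?_) fun i => ?_).symm
        · exact Function.extend_apply' _ _ _ (by simpa using hj)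
        · exact (e.injective.extend_apply _ _ _).symm
      · intro j _
        by_cases hj : ∃ i, e i = j
        · obtain ⟨i, rfl⟩ := hj
          dsimp only
          rw [e.injective.extend_apply]
          exact hz ⟨i, rfl⟩
        · dsimp only
          rw [Function.extend_apply' _ _ _ hj]
          exact hz ⟨i₀, rfl⟩
      · rw [← hx]
        refine (Fintype.sum_of_injective e e.injective _ _ (fun j hj => ?_) fun i => ?_).symm
        · simp only
          rw [Function.extend_apply' _ _ _ (by simpa using hj), Pi.zero_apply, zero_smul]
        · simp only [e.injective.extend_apply]
    · rintro ⟨⟨w, z⟩, ⟨⟨hw, hw1⟩, hz⟩, rfl⟩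
      exact (convex_convexHull ℝ S).sum_mem (fun i _ => hw i) hw1
        fun i _ => subset_convexHull ℝ S (hz i trivial)
  rw [himg]
  refine ((isCompact_stdSimplex ℝ (Fin 3)).prod (isCompact_univ_pi fun _ => hS)).image ?_
  fun_prop

theorem nonempty_logContour_iff {E : Type*} [NormedAddCommGroup E] [NormedSpace ℂ E]
    [CompleteSpace E] (T : E →L[ℂ] E) :
    Nonempty (LogContour T) ↔ (0 : ℂ) ∉ convexHull ℝ (spectrum ℂ T) := by
  constructor
  · rintro ⟨K⟩ h
    exact Complex.exp_ne_zero _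
      (K.exp_branch 0 (Metric.ball_subset_closedBall (K.convexHull_subset h)))
  · intro h0
    have hcomp : IsCompact (convexHull ℝ (spectrum ℂ T)) := isCompact_convexHull_complex (spectrum.isCompact T)
    obtain ⟨c, r, hr, hrc, hsub⟩ : ∃ (c : ℂ) (r : ℝ), 0 < r ∧ r < ‖c‖ ∧
        convexHull ℝ (spectrum ℂ T) ⊆ Metric.ball c r := by
      rcases (convexHull ℝ (spectrum ℂ T)).eq_empty_or_nonempty with he | ⟨z₀, hz₀⟩
      · exact ⟨1, 1 / 2, by norm_num, by norm_num, by simp [he]⟩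
      obtain ⟨f, s, hs, hf⟩ := geometric_hahn_banach_point_closed (convex_convexHull ℝ _)
        hcomp.isClosed h0
      rw [map_zero] at hs
      obtain ⟨M, hM⟩ := hcomp.isBounded.exists_norm_le
      set a : ℂ := (InnerProductSpace.toDual ℝ ℂ).symm f with ha
      have hfa : ∀ z, f z = inner ℝ a z := fun z => by simp [ha]
      set R : ℝ := (M ^ 2 + 1) / s with hR
      have hRpos : 0 < R := by positivity
      have hRs : R * s = M ^ 2 + 1 := by rw [hR]; field_simp
      have key : ∀ z ∈ convexHull ℝ (spectrum ℂ T),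
          ‖z - R • a‖ ^ 2 < ‖R • a‖ ^ 2 - 1 := by
        intro z hz
        have h1 := hf z hz
        rw [hfa] at h1
        have h2 := hM z hz
        have h3 : ‖z‖ ^ 2 ≤ M ^ 2 := by gcongr
        have h4 : M ^ 2 + 1 ≤ R * inner ℝ a z := by rw [← hRs]; gcongr
        rw [norm_sub_sq_real, inner_smul_right, real_inner_comm]
        nlinarith [sq_nonneg M]
      have hpos : 0 < ‖R • a‖ ^ 2 - 1 := (sq_nonneg _).trans_lt (key z₀ hz₀)
      refine ⟨R • a, √(‖R • a‖ ^ 2 - 1), Real.sqrt_pos.2 hpos, ?_, fun z hz => ?_⟩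
      · rw [Real.sqrt_lt' (by nlinarith [norm_nonneg (R • a)])]
        linarith
      · rw [mem_ball_iff_norm]
        exact Real.lt_sqrt_of_sq_lt (key z hz)
    have hc : c ≠ 0 := by
      rintro rfl
      rw [norm_zero] at hrc
      linarith
    have hslit : ∀ z ∈ Metric.closedBall c r, z / c ∈ Complex.slitPlane := by
      intro z hz
      rw [mem_closedBall_iff_norm] at hz
      apply Complex.mem_slitPlane_of_norm_lt_one (z := z / c - 1) ?_ |> fun h => by simpa using h
      rw [div_sub_one hc, norm_div, div_lt_one (norm_pos_iff.2 hc)]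
      linarith
    refine ⟨⟨c, r, fun z => Complex.log c + Complex.log (z / c), hr, hsub, ?_, fun z hz => ?_⟩⟩
    · exact continuousOn_const.add ((continuousOn_id.div_const c).clog hslit)
    · rw [Complex.exp_add, Complex.exp_log hc,
        Complex.exp_log (Complex.slitPlane_ne_zero (hslit z hz)), mul_div_cancel₀ _ hc]

/-- `det_Γ(T) = exp(Tr_Γ(log T))`. -/
def analyticDet {V : Type*} (F : Finset V) {T : ℓ²(V, ℂ) →L[ℂ] ℓ²(V, ℂ)} (K : LogContour T) : ℂ :=
  Complex.exp (trace F K.log)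

end Determinant

end

end IharaZeta

namespace IharaZeta

/-! ## Closed paths: reduction, rotation, primitive roots -/

namespace ClosedPath

variable {V : Type*} {X : SimpleGraph V}

/-! Logarithms turn the Euler product into a sum over paths. The factor of a class `[P]` expands
into terms `u^(n|P|) / (n |Γ_P|)`. Since `Γ` acts freely on vertices, exactly `|P| / |Γ_P|`
primitive closed paths of the class start in `F` (`card_fiber_mul_card_stabilizer`), and each
reduced closed path is a multiple of a unique primitive one. Hence `log Z = ∑ N_m u^m / m`, where
`N_m` counts the reduced closed paths of length `m` that start in `F` (`hasProd_eulerFactor`,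
`hasSum_reducedPath`).

The number `N_m` is the trace of `T^m` over the edges leaving `F`. Here `T = P S - J` is the
transfer operator of walks without backtracking: `S` sums over outgoing edges, `P` pulls back along
end points, and `J` reverses edges. Expanding two factors `T` moves the trace to vertices: `N_(k+3)
= Tr A_(k+3) - Tr (Q A_(k+1)) + N_(k+1)`, where `A_k` counts walks of length `k` without
backtracking, tails allowed. The `A_k` obey a two-step recurrence, so that `W = 1 + ∑ A_k u^k`
satisfies `Δ(u) W(u) = 1 - u²` (`deformedLaplacian_mul_nbSeries`). The traces run over `F` only. The
cyclicity that is needed rests on one fact: an invariant function of edges has the same sum over the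
edges leaving `F` as over those entering it (`sum_edges_flip`).

Put `B = A u - Q u²`, so `Δ = 1 - B`. Although `B` and `B'` need not commute, cyclicity gives
Jacobi's formula: the derivative of `-Tr log (1 - B)` is `Tr (Δ⁻¹ B')`. The recurrence for `N_m`
together with `W = (1 - u²) Δ⁻¹` shows that `∑ N_m u^m / m` and `-Tr log Δ + χ log (1 - u²)` have
equal derivatives; both vanish at `0` (`closedWalks_tsum_eq`). The constant `χ` appears as `|F| - ½
∑ deg`.

The contour logarithm is related to the power series as follows. In a disc with centre `c` it is a
scalar minus the Mercator series of `1 - T / c`, and moving the base point changes that series by a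
scalar (`mercator_sub_mercator`). The scalar is known up to `2πi ℤ` and its trace is multiplied by
the integer `|F|`, so neither disc nor branch affects the determinant (`LogContour.exists_log_eq`,
`analyticDet_eq`).

The number `α` is the nonnegative root of `x² = d x + d`. If `d ≥ 1`, this equation gives both
`‖A_k‖ ≤ α^k` and `‖B(u)‖ < 1` for `α |u| < 1`. A graph without edges has `α = 0` and is treated
directly. -/

theorem periodic_vert (C : ClosedPath X) : Function.Periodic C.vert C.length := C.periodic

theorem vert_add_mul (C : ClosedPath X) (i n : ℤ) : C.vert (i + n * C.length) = C.vert i :=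
  C.periodic_vert.int_mul n i

theorem vert_emod (C : ClosedPath X) (i : ℤ) : C.vert (i % C.length) = C.vert i := by
  conv_rhs => rw [← Int.emod_add_mul_ediv i C.length, mul_comm, C.vert_add_mul]

/-- A closed path is reduced if and only if it is nowhere backtracking, the origin included. -/
theorem isReduced_iff (C : ClosedPath X) : C.IsReduced ↔ ∀ i, C.vert i ≠ C.vert (i + 2) := by
  have hpos := C.length_pos
  constructor
  · rintro ⟨hp, ht⟩ i hi
    set m := C.length with hm
    set j := (i + 1) % (m : ℤ) with hj
    have hj0 : 0 ≤ j := Int.emod_nonneg _ (by omega)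
    have hjm : j < m := Int.emod_lt_of_pos _ (by omega)
    have hji : i + 1 = j + (i + 1) / m * m := by
      rw [hj, mul_comm]; exact (Int.emod_add_mul_ediv _ _).symm
    have h1 : C.vert (j - 1) = C.vert i := by
      rw [← C.vert_add_mul (j - 1) ((i + 1) / m), ← hm]; congr 1; omega
    have h2 : C.vert (j + 1) = C.vert (i + 2) := by
      rw [← C.vert_add_mul (j + 1) ((i + 1) / m), ← hm]; congr 1; omega
    have h3 : C.vert (j - 1) = C.vert (j + 1) := by rw [h1, h2, hi]
    -- Backtracking at `j = 0` happens across the origin, where only the absence of a tail can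
    -- exclude it.
    rcases hj0.eq_or_lt with h0 | h0
    · rw [← h0] at h3
      have h4 : C.vert (m - 1) = C.vert 1 := by
        rw [← C.vert_add_mul (0 - 1) 1] at h3
        rw [show ((m : ℤ) - 1) = 0 - 1 + 1 * C.length by omega, h3]; rfl
      -- Tails exist only from length 4 on. Lengths 1 and 3 would produce a loop of the graph, and
      -- in length 2 there is backtracking at the index 1.
      rcases Nat.lt_or_ge m 4 with h5 | h5
      · have : m = 1 ∨ m = 2 ∨ m = 3 := by omega
        rcases this with h | h | h
        · have h6 := C.adj 0
          have h7 := C.periodic 0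
          rw [← hm, h] at h7
          rw [show (0 : ℤ) + 1 = 0 + ((1 : ℕ) : ℤ) by norm_num, h7] at h6
          exact X.loopless.irrefl _ h6
        · refine hp 1 le_rfl (by omega) ?_
          have h7 := C.periodic 0
          rw [← hm, h] at h7
          exact h7.symm
        · rw [h] at h4
          have h6 := C.adj 1
          have h8 : C.vert (1 + 1) = C.vert 1 := h4
          rw [h8] at h6
          exact X.loopless.irrefl _ h6
      · refine ht ⟨1, le_rfl, by omega, fun k hk hk' => ?_⟩
        obtain rfl : k = 1 := by push_cast at hk'; omega
        exact h4.symm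
    · exact hp j (by omega) (by omega) h3
  · intro h
    refine ⟨fun i _ _ hi => h (i - 1) ?_, ?_⟩
    · rw [hi]; congr 1; ring
    · rintro ⟨k, hk, -, h1⟩
      have h2 := h1 1 le_rfl (by exact_mod_cast hk)
      refine h (-1) ?_
      rw [show (-1 : ℤ) + 2 = 1 by norm_num, h2, ← C.vert_add_mul (-1) 1]
      congr 1; ring

/-- The closed path obtained by moving the origin by `k` steps. -/
def rotate (C : ClosedPath X) (k : ℤ) : ClosedPath X where
  length := C.length
  vert i := C.vert (i + k)
  length_pos := C.length_pos
  periodic i := by rw [add_right_comm, C.periodic]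
  adj i := by rw [add_right_comm]; exact C.adj _

/-- The closed path that goes `n` times around. -/
def multiple (C : ClosedPath X) (n : ℕ) (hn : 0 < n) : ClosedPath X where
  length := n * C.length
  vert := C.vert
  length_pos := Nat.mul_pos hn C.length_pos
  periodic i := by push_cast; exact C.vert_add_mul i n
  adj := C.adj

/-- By Bézout the gcd of two periods is a period. If it were smaller than the length, the path would
go several times around a shorter one. -/
theorem IsPrimitive.dvd_of_periodic {C : ClosedPath X} (hC : C.IsPrimitive) {p : ℤ}
    (hp : Function.Periodic C.vert p) : (C.length : ℤ) ∣ p := by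
  set g := Int.gcd C.length p with hg
  have hg0 : 0 < g := Int.gcd_pos_of_ne_zero_left _ (by exact_mod_cast C.length_pos.ne')
  have hgd : g ∣ C.length := by exact_mod_cast Int.gcd_dvd_left (C.length : ℤ) p
  have hgp : Function.Periodic C.vert g := by
    rw [hg, Int.gcd_eq_gcd_ab, mul_comm (C.length : ℤ), mul_comm p]
    exact (C.periodic_vert.int_mul _).add_period (hp.int_mul _)
  obtain ⟨n, hn⟩ := hgd
  have hn1 : n = 1 := by
    by_contra h1
    refine hC ⟨n, ⟨g, C.vert, hg0, hgp, C.adj⟩, ?_, by rw [hn, mul_comm], rfl⟩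
    rcases n with _ | _ | n
    · have := C.length_pos; omega
    · omega
    · omega
  rw [hn1, mul_one] at hn
  rw [hn]
  exact Int.gcd_dvd_right _ _

theorem exists_primitive_root (C : ClosedPath X) :
    ∃ (D : ClosedPath X) (n : ℕ) (hn : 0 < n), D.IsPrimitive ∧ C = D.multiple n hn := by
  induction h : C.length using Nat.strong_induction_on generalizing C with
  | _ m ih =>
    by_cases hC : C.IsPrimitive
    · exact ⟨C, 1, one_pos, hC, ClosedPath.ext (one_mul _).symm rfl⟩
    · obtain ⟨n, D, hn, hl, hv⟩ := not_not.1 hC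
      have := D.length_pos
      obtain ⟨D', n', hn', hD', rfl⟩ := ih D.length (by nlinarith) D rfl
      exact ⟨D', n * n', Nat.mul_pos (by omega) hn', hD',
        ClosedPath.ext (hl.trans (mul_assoc _ _ _).symm) hv⟩

/-- Both roots share one vertex sequence, so each length is a period of the other root, and
primitivity makes the lengths divide each other. -/
theorem IsPrimitive.multiple_inj {C D : ClosedPath X} (hC : C.IsPrimitive) (hD : D.IsPrimitive)
    {n m : ℕ} {hn : 0 < n} {hm : 0 < m} (h : C.multiple n hn = D.multiple m hm) :
    C = D ∧ n = m := by
  have hv : C.vert = D.vert := (ClosedPath.ext_iff.1 h).2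
  have hl : n * C.length = m * D.length := (ClosedPath.ext_iff.1 h).1
  have h1 := hC.dvd_of_periodic (hv ▸ D.periodic_vert)
  have h2 := hD.dvd_of_periodic (hv ▸ C.periodic_vert)
  have h3 : C.length = D.length :=
    Nat.dvd_antisymm (by exact_mod_cast h1) (by exact_mod_cast h2)
  refine ⟨ClosedPath.ext h3 hv, ?_⟩
  rw [h3] at hl
  exact Nat.eq_of_mul_eq_mul_right D.length_pos hl

theorem IsReduced.multiple {C : ClosedPath X} (hC : C.IsReduced) (n : ℕ) (hn : 0 < n) :
    (C.multiple n hn).IsReduced :=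
  (isReduced_iff _).2 ((isReduced_iff C).1 hC)

theorem IsReduced.of_multiple {C : ClosedPath X} {n : ℕ} {hn : 0 < n}
    (hC : (C.multiple n hn).IsReduced) : C.IsReduced :=
  (isReduced_iff _).2 ((isReduced_iff (C.multiple n hn)).1 hC)

theorem IsReduced.rotate {C : ClosedPath X} (hC : C.IsReduced) (k : ℤ) :
    (C.rotate k).IsReduced := by
  rw [isReduced_iff] at hC ⊢
  intro i
  have := hC (i + k)
  rwa [add_right_comm] at this

theorem IsPrimitive.rotate {C : ClosedPath X} (hC : C.IsPrimitive) (k : ℤ) :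
    (C.rotate k).IsPrimitive := by
  rintro ⟨n, D, hn, hl, hv⟩
  refine hC ⟨n, D.rotate (-k), hn, hl, funext fun i => ?_⟩
  change C.vert i = D.vert (i + -k)
  rw [← hv]
  change _ = C.vert _
  congr 1; ring

theorem IsReduced.smul {C : ClosedPath X} (hC : C.IsReduced) (g : X ≃g X) :
    (g • C).IsReduced := by
  rw [isReduced_iff] at hC ⊢
  exact fun i h => hC i (MulAction.injective g h)

theorem IsPrimitive.smul {C : ClosedPath X} (hC : C.IsPrimitive) (g : X ≃g X) :
    (g • C).IsPrimitive := by
  rintro ⟨n, D, hn, hl, hv⟩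
  refine hC ⟨n, g⁻¹ • D, hn, hl, funext fun i => ?_⟩
  change C.vert i = g⁻¹ • D.vert i
  rw [← hv]
  exact (inv_smul_smul g _).symm

/-- The cycle of a closed path. -/
def cycle (C : ClosedPath X) : Cycle X := Quotient.mk (rotationSetoid X) C

theorem cycle_eq_iff {C D : ClosedPath X} : C.cycle = D.cycle ↔ ∃ k, D = C.rotate k := by
  constructor
  · intro h
    obtain ⟨h1, k, hk⟩ := Quotient.exact h
    exact ⟨k, ClosedPath.ext h1.symm (funext hk)⟩
  · rintro ⟨k, rfl⟩
    exact Quotient.sound (s := rotationSetoid X) ⟨rfl, k, fun _ => rfl⟩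

theorem rotate_emod (C : ClosedPath X) (k : ℤ) : C.rotate (k % C.length) = C.rotate k := by
  refine ClosedPath.ext rfl (funext fun i => ?_)
  change C.vert _ = C.vert _
  rw [← C.vert_add_mul (i + k % C.length) (k / C.length), add_assoc, mul_comm,
    Int.emod_add_mul_ediv]

/-- Two shifts that give the same path differ by a period, hence by a multiple of the length; so the
shifts `0, …, |C| - 1` are distinct and exhaust the cycle. -/
theorem IsPrimitive.card_cycle {C : ClosedPath X} (hC : C.IsPrimitive) :
    Nat.card {D : ClosedPath X // D.cycle = C.cycle} = C.length := by
  have hpos := C.length_pos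
  let f : Fin C.length → {D : ClosedPath X // D.cycle = C.cycle} := fun k =>
    ⟨C.rotate k, (cycle_eq_iff.2 ⟨k, rfl⟩).symm⟩
  have hf : Function.Bijective f := by
    constructor
    · intro k k' h
      have h1 : ∀ i, C.vert (i + k) = C.vert (i + k') := fun i =>
        congrFun (congrArg ClosedPath.vert (congrArg Subtype.val h)) i
      have h2 : Function.Periodic C.vert ((k : ℤ) - k') := fun i => by
        have := h1 (i - k')
        rw [sub_add_cancel] at this
        rw [← this]; congr 1; ring
      have h3 := hC.dvd_of_periodic h2
      have h4 := Int.eq_zero_of_abs_lt_dvd h3 (by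
        have := k.2; have := k'.2
        rw [abs_lt]; omega)
      exact Fin.ext (by omega)
    · rintro ⟨D, hD⟩
      obtain ⟨k, rfl⟩ := cycle_eq_iff.1 hD.symm
      have h0 : 0 ≤ k % (C.length : ℤ) := Int.emod_nonneg _ (by omega)
      have h1 : k % (C.length : ℤ) < C.length := Int.emod_lt_of_pos _ (by omega)
      refine ⟨⟨(k % (C.length : ℤ)).toNat, by omega⟩, Subtype.ext ?_⟩
      change C.rotate (((k % (C.length : ℤ)).toNat : ℕ) : ℤ) = C.rotate k
      rw [Int.toNat_of_nonneg h0, rotate_emod]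
  rw [← Nat.card_eq_of_bijective f hf, Nat.card_eq_fintype_card, Fintype.card_fin]

end ClosedPath

/-! ## The zeta function as the exponential of a sum over reduced closed paths -/

section ZetaSum

variable {V : Type*} {X : SimpleGraph V}

/-- Reduced closed paths that start in `F`. -/
abbrev ReducedPath (X : SimpleGraph V) (F : Finset V) : Type _ :=
  {C : ClosedPath X // C.IsReduced ∧ C.vert 0 ∈ F}

/-- Primitive reduced closed paths that start in `F`. -/
abbrev PrimePath (X : SimpleGraph V) (F : Finset V) : Type _ :=
  {C : ClosedPath X // (C.IsReduced ∧ C.IsPrimitive) ∧ C.vert 0 ∈ F}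

/-- This reindexes the double sum over primitive paths and the exponents of the logarithm series.
The shift `p.2 + 1` makes the multiplicity positive. -/
theorem bijective_multiple (F : Finset V) :
    Function.Bijective (fun p : PrimePath X F × ℕ =>
      (⟨p.1.1.multiple (p.2 + 1) p.2.succ_pos, p.1.2.1.1.multiple _ _, p.1.2.2⟩ :
        ReducedPath X F)) := by
  constructor
  · rintro ⟨⟨C, hC⟩, n⟩ ⟨⟨D, hD⟩, m⟩ h
    obtain ⟨h1, h2⟩ := hC.1.2.multiple_inj hD.1.2
      (hn := n.succ_pos) (hm := m.succ_pos) (congrArg Subtype.val h)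
    subst h1
    obtain rfl : n = m := by simpa using h2
    rfl
  · rintro ⟨C, hC, hF⟩
    obtain ⟨D, n, hn, hD, rfl⟩ := C.exists_primitive_root
    refine ⟨(⟨D, ⟨hC.of_multiple, hD⟩, hF⟩, n - 1), Subtype.ext ?_⟩
    have : n - 1 + 1 = n := by omega
    simp only [this]

variable (Γ : Subgroup (X ≃g X))

/-- The class of a primitive reduced closed path. -/
def PrimePath.primeClass {F : Finset V} (D : PrimePath X F) : PrimeClass Γ :=
  ⟨Quotient.mk (MulAction.orbitRel Γ (Cycle X)) D.1.cycle, D.1.cycle,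
    ⟨D.1, D.2.1.1, D.2.1.2, rfl⟩, rfl⟩

variable {Γ}

/-- The origin alone decides: `F` meets its orbit once and vertex stabilizers are trivial. -/
theorem ClosedPath.eq_of_smul_mem {F : Finset V} (hfree : ∀ γ ∈ Γ, ∀ v : V, γ • v = v → γ = 1)
    (hF : ∀ v : V, ∃! x, x ∈ F ∧ x ∈ MulAction.orbit Γ v) {C D : ClosedPath X} {γ : Γ}
    (h : γ • C = D) (hC : C.vert 0 ∈ F) (hD : D.vert 0 ∈ F) : C = D ∧ γ = 1 := by
  subst h
  have h1 : γ • C.vert 0 = C.vert 0 := (hF (C.vert 0)).unique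
    ⟨hD, ⟨γ, rfl⟩⟩ ⟨hC, MulAction.mem_orbit_self _⟩
  have h2 : γ = 1 := Subtype.ext (hfree γ γ.2 _ h1)
  exact ⟨by rw [h2, one_smul], h2⟩

/-- This is the source of the exponent `1 / |Γ_C|`. For each path `D` of the class fix `τ D ∈ Γ`
that carries its cycle to that of `C`. Every one of the `|C|` rotations of `C` is then `g • τ D • D`
for a unique `g` in the stabilizer and a unique `D` starting in `F`. As `|C| > 0`, the formula also
shows that both factors are finite. -/
theorem card_fiber_mul_card_stabilizer {F : Finset V}
    (hfree : ∀ γ ∈ Γ, ∀ v : V, γ • v = v → γ = 1)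
    (hF : ∀ v : V, ∃! x, x ∈ F ∧ x ∈ MulAction.orbit Γ v) {C : ClosedPath X}
    (hC : C.IsReduced) (hC' : C.IsPrimitive) {q : PrimeClass Γ}
    (hq : Quotient.mk (MulAction.orbitRel Γ (Cycle X)) C.cycle = q.1) :
    Nat.card (MulAction.stabilizer Γ C.cycle) *
      Nat.card {D : PrimePath X F // D.primeClass Γ = q} = C.length := by
  have hex : ∀ D : {D : PrimePath X F // D.primeClass Γ = q},
      ∃ γ : Γ, (γ • D.1.1).cycle = C.cycle := by
    rintro ⟨D, rfl⟩
    exact Quotient.exact hq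
  choose τ hτ using hex
  let f : MulAction.stabilizer Γ C.cycle × {D : PrimePath X F // D.primeClass Γ = q} →
      {D : ClosedPath X // D.cycle = C.cycle} := fun p =>
    ⟨(p.1 : Γ) • τ p.2 • p.2.1.1, by
      have h1 := p.1.2
      rw [MulAction.mem_stabilizer_iff] at h1
      refine Eq.trans ?_ h1
      exact congrArg (fun c => (p.1 : Γ) • c) (hτ p.2)⟩
  have hf : Function.Bijective f := by
    constructor
    · rintro ⟨g, D⟩ ⟨g', D'⟩ h
      have h1 : (g : Γ) • τ D • D.1.1 = (g' : Γ) • τ D' • D'.1.1 := congrArg Subtype.val h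
      have h2 : (((g' : Γ) * τ D')⁻¹ * (g * τ D)) • D.1.1 = D'.1.1 := by
        rw [mul_smul, inv_smul_eq_iff, mul_smul, mul_smul, h1]
      obtain ⟨h3, h4⟩ := ClosedPath.eq_of_smul_mem hfree hF h2 D.1.2.2 D'.1.2.2
      have h5 : D = D' := Subtype.ext (Subtype.ext h3)
      subst h5
      rw [inv_mul_eq_one, mul_left_inj] at h4
      rw [Subtype.ext h4]
    · rintro ⟨B, hB⟩
      -- The required `D` is the translate of `B` whose origin lies in `F`; the stabilizer element
      -- is then forced to be `(τ D * γ)⁻¹`.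
      obtain ⟨x, ⟨hx, γ, hγ⟩, -⟩ := hF (B.vert 0)
      obtain ⟨k, hk⟩ := ClosedPath.cycle_eq_iff.1 hB.symm
      have hBr : B.IsReduced := hk ▸ hC.rotate k
      have hBp : B.IsPrimitive := hk ▸ hC'.rotate k
      let D : PrimePath X F := ⟨γ • B, ⟨hBr.smul _, hBp.smul _⟩, by
        have : (γ • B).vert 0 = x := hγ
        rwa [this]⟩
      have hD : D.primeClass Γ = q := by
        refine Subtype.ext (Eq.trans ?_ hq)
        refine Quotient.sound (s := MulAction.orbitRel Γ (Cycle X)) ⟨γ, ?_⟩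
        change γ • C.cycle = (γ • B).cycle
        rw [← hB]; rfl
      set D' : {D : PrimePath X F // D.primeClass Γ = q} := ⟨D, hD⟩ with hD'
      have h1 : (τ D' • γ • B).cycle = C.cycle := hτ D'
      refine ⟨(⟨(τ D' * γ)⁻¹, ?_⟩, D'), Subtype.ext ?_⟩
      · rw [MulAction.mem_stabilizer_iff, inv_smul_eq_iff, ← h1, mul_smul]
        change (τ D' • γ • B).cycle = τ D' • γ • (τ D' • γ • B).cycle
        rw [h1, ← hB]; exact (h1.trans hB.symm).symm
      · change (τ D' * γ)⁻¹ • τ D' • γ • B = B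
        rw [inv_smul_eq_iff, mul_smul]
  rw [← Nat.card_prod, Nat.card_eq_of_bijective f hf, hC'.card_cycle]

/-- The principal logarithm of each factor is a finite sum over the paths of its class, and absolute
convergence allows any regrouping. Exponentiating a convergent sum then yields an unconditionally
convergent product. -/
theorem hasProd_eulerFactor {F : Finset V}
    (hfree : ∀ γ ∈ Γ, ∀ v : V, γ • v = v → γ = 1)
    (hF : ∀ v : V, ∃! x, x ∈ F ∧ x ∈ MulAction.orbit Γ v) {u : ℂ} (hu : ‖u‖ < 1)
    (hs : Summable fun C : ReducedPath X F => u ^ C.1.length / (C.1.length : ℂ)) :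
    HasProd (eulerFactor Γ u)
      (Complex.exp (∑' C : ReducedPath X F, u ^ C.1.length / (C.1.length : ℂ))) := by
  have hpow : ∀ C : ClosedPath X, ‖u ^ C.length‖ < 1 := fun C => by
    rw [norm_pow]
    exact pow_lt_one₀ (norm_nonneg _) hu C.length_pos.ne'
  set e := Equiv.ofBijective _ (bijective_multiple (X := X) F) with he
  have h1 := (e.hasSum_iff (a := ∑' C : ReducedPath X F, u ^ C.1.length / (C.1.length : ℂ))).2
    hs.hasSum
  have h2 : ∀ D : PrimePath X F, HasSum (fun n : ℕ =>
      ((fun C : ReducedPath X F => u ^ C.1.length / (C.1.length : ℂ)) ∘ e) (D, n))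
      (-(Complex.log (1 - u ^ D.1.length) / D.1.length)) := fun D => by
    have h3 := (Complex.hasSum_taylorSeries_neg_log' (hpow D.1)).div_const (D.1.length : ℂ)
    rw [neg_div] at h3
    refine h3.congr_fun fun n => ?_
    change u ^ ((n + 1) * D.1.length) / (((n + 1) * D.1.length : ℕ) : ℂ) = _
    rw [mul_comm (n + 1), pow_mul, mul_comm D.1.length, div_div]
    push_cast
    rfl
  -- The sum over multiplicities comes first and produces logarithms; the remaining sum over
  -- primitive paths is then grouped by classes.
  have h3 := h1.prod_fiberwise h2
  have h4 := (Equiv.sigmaFiberEquiv (PrimePath.primeClass (F := F) Γ)).hasSum_iff.2 h3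
  have h5 : ∀ q : PrimeClass Γ, ∃ l : ℂ, eulerFactor Γ u q = Complex.exp l ∧
      HasSum (fun D : {D : PrimePath X F // D.primeClass Γ = q} =>
        -(Complex.log (1 - u ^ D.1.1.length) / D.1.1.length)) l := by
    intro q
    obtain ⟨c, ⟨C, hC, hC', rfl⟩, hq⟩ := q.2
    have hcard := card_fiber_mul_card_stabilizer (F := F) hfree hF hC hC' hq
    have hlen : ∀ D : {D : PrimePath X F // D.primeClass Γ = q}, D.1.1.length = C.length := by
      rintro ⟨D, rfl⟩
      obtain ⟨γ, hγ⟩ := Quotient.exact hq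
      have := congrArg Cycle.length hγ
      exact (Cycle.length_smul (γ : X ≃g X) D.1.cycle).symm.trans this
    have hpos := C.length_pos
    -- `Nat.card` is `0` on infinite types, so nonvanishing means finiteness here.
    have hs0 : Nat.card (MulAction.stabilizer Γ C.cycle) ≠ 0 := by
      intro h; rw [h, zero_mul] at hcard; omega
    have hfin0 : Nat.card {D : PrimePath X F // D.primeClass Γ = q} ≠ 0 := by
      intro h; rw [h, mul_zero] at hcard; omega
    have : Finite {D : PrimePath X F // D.primeClass Γ = q} := Nat.finite_of_card_ne_zero hfin0
    have := Fintype.ofFinite {D : PrimePath X F // D.primeClass Γ = q}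
    refine ⟨_, ?_, hasSum_fintype _⟩
    have hq1 : eulerFactor Γ u q = cycleFactor Γ u C.cycle := by
      rw [eulerFactor, ← hq]; rfl
    have hne : 1 - u ^ C.length ≠ 0 := fun h => by
      have := hpow C
      rw [← sub_eq_zero.1 h, norm_one] at this
      exact lt_irrefl _ this
    have hl : C.cycle.length = C.length := rfl
    rw [hq1, cycleFactor, hl, Complex.cpow_def_of_ne_zero hne]
    congr 1
    simp only [hlen]
    rw [Finset.sum_const, Finset.card_univ, ← Nat.card_eq_fintype_card, nsmul_eq_mul, ← hcard]
    have : (Nat.card (MulAction.stabilizer Γ C.cycle) : ℂ) ≠ 0 := by exact_mod_cast hs0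
    have : (Nat.card {D : PrimePath X F // D.primeClass Γ = q} : ℂ) ≠ 0 := by exact_mod_cast hfin0
    push_cast
    field_simp
  choose l hl hl' using h5
  have h6 : HasSum l _ := h4.sigma hl'
  have h7 := h6.cexp
  refine h7.congr_fun fun q => ?_
  exact hl q

end ZetaSum

/-! ## Walks without backtracking -/

section Walks

variable {V : Type*} (X : SimpleGraph V) [X.LocallyFinite]

/-- The pull-back of functions on vertices along the end point of an edge. -/
def headPullback : (V → ℂ) →ₗ[ℂ] (V → V → ℂ) where
  toFun f _ y := f y
  map_add' _ _ := rfl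
  map_smul' _ _ := rfl

/-- The sum of a function on edges over the edges that leave a vertex. -/
def tailSum : (V → V → ℂ) →ₗ[ℂ] (V → ℂ) where
  toFun g x := ∑ y ∈ X.neighborFinset x, g x y
  map_add' f g := by ext v; simp [Finset.sum_add_distrib]
  map_smul' c f := by ext v; simp [Finset.mul_sum]

/-- The reversal of edges. -/
def edgeFlip : Module.End ℂ (V → V → ℂ) where
  toFun g x y := g y x
  map_add' _ _ := rfl
  map_smul' _ _ := rfl

/-- The transfer operator of walks without backtracking. -/
def nbTransfer : Module.End ℂ (V → V → ℂ) :=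
  headPullback ∘ₗ tailSum X - edgeFlip

theorem nbTransfer_apply (g : V → V → ℂ) (x y : V) :
    nbTransfer X g x y = ∑ z ∈ X.neighborFinset y, g y z - g y x := rfl

/-- Prepend an element to a sequence. -/
def consSeq (x : V) (p : ℕ → V) : ℕ → V
  | 0 => x
  | i + 1 => p i

theorem consSeq_injective (x : V) : Function.Injective (consSeq x) := fun _ _ h =>
  funext fun i => congrFun h (i + 1)

open Classical in
/-- The walks `x, y, …` with `m + 1` steps that do not backtrack, as sequences that are constant
from the index `m + 1` on. -/
noncomputable def nbWalks : ℕ → V → V → Finset (ℕ → V)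
  | 0, x, y => {consSeq x fun _ => y}
  | m + 1, x, y =>
    ((X.neighborFinset y).erase x).biUnion fun z => (nbWalks m y z).image (consSeq x)

theorem mem_nbWalks {m : ℕ} {x y : V} {p : ℕ → V} :
    p ∈ nbWalks X m x y ↔ p 0 = x ∧ p 1 = y ∧
      (∀ i < m, X.Adj (p (i + 1)) (p (i + 2)) ∧ p i ≠ p (i + 2)) ∧
      ∀ i, m + 1 ≤ i → p i = p (m + 1) := by
  induction m generalizing x y p with
  | zero =>
    simp only [nbWalks, Finset.mem_singleton]
    constructor
    · rintro rfl
      refine ⟨rfl, rfl, by simp, fun i hi => ?_⟩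
      obtain ⟨i, rfl⟩ := Nat.exists_eq_add_of_le' hi
      rfl
    · rintro ⟨rfl, rfl, -, h⟩
      funext i
      rcases i with _ | i
      · rfl
      · exact h (i + 1) (by omega)
  | succ m ih =>
    simp only [nbWalks, Finset.mem_biUnion, Finset.mem_erase, SimpleGraph.mem_neighborFinset,
      Finset.mem_image]
    constructor
    · rintro ⟨z, ⟨hzx, hyz⟩, q, hq, rfl⟩
      obtain ⟨h0, h1, h2, h3⟩ := ih.1 hq
      refine ⟨rfl, h0, fun i hi => ?_, fun i hi => ?_⟩
      · rcases i with _ | i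
        · refine ⟨?_, ?_⟩
          · change X.Adj (q 0) (q 1)
            rwa [h0, h1]
          · change x ≠ q 1
            rw [h1]; exact hzx.symm
        · exact h2 i (by omega)
      · obtain ⟨i, rfl⟩ := Nat.exists_eq_add_of_le' (show 1 ≤ i by omega)
        exact h3 i (by omega)
    · rintro ⟨h0, h1, h2, h3⟩
      have h4 := h2 0 (by omega)
      refine ⟨p 2, ⟨?_, ?_⟩, fun i => p (i + 1), ih.2 ⟨h1, rfl, fun i hi => h2 (i + 1) (by omega),
        fun i hi => h3 (i + 1) (by omega)⟩, ?_⟩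
      · rw [← h0]; exact h4.2.symm
      · rw [← h1]; exact h4.1
      · funext i
        rcases i with _ | i
        · exact h0.symm
        · rfl

theorem sum_nbWalks_succ {M : Type*} [AddCommMonoid M] (m : ℕ) (x y : V) (φ : (ℕ → V) → M)
    [DecidableEq V] :
    ∑ p ∈ nbWalks X (m + 1) x y, φ p =
      ∑ z ∈ (X.neighborFinset y).erase x, ∑ p ∈ nbWalks X m y z, φ (consSeq x p) := by
  classical
  rw [nbWalks, Finset.sum_biUnion]
  · refine Finset.sum_congr (by ext; simp) fun z _ => ?_
    rw [Finset.sum_image (fun p _ q _ h => consSeq_injective x h)]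
  · intro z _ z' _ hzz'
    rw [Function.onFun, Finset.disjoint_left]
    intro p hp hp'
    obtain ⟨q, hq, rfl⟩ := Finset.mem_image.1 hp
    obtain ⟨q', hq', h⟩ := Finset.mem_image.1 hp'
    have := consSeq_injective x h
    subst this
    exact hzz' (((mem_nbWalks X).1 hq).2.1.symm.trans ((mem_nbWalks X).1 hq').2.1)

/-- Subtracting the reversed edge removes exactly the summand `z = x`, the backtracking step.
Adjacency guarantees that this summand is present: functions live on all pairs, not only on edges.
-/
theorem nbTransfer_pow_apply (m : ℕ) (g : V → V → ℂ) {x y : V} (h : X.Adj x y) :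
    (nbTransfer X ^ m) g x y = ∑ p ∈ nbWalks X m x y, g (p m) (p (m + 1)) := by
  classical
  induction m generalizing x y with
  | zero => simp [nbWalks, consSeq]
  | succ m ih =>
    rw [pow_succ', Module.End.mul_apply, nbTransfer_apply, sum_nbWalks_succ,
      ← Finset.sum_erase_add _ _ ((X.mem_neighborFinset y x).2 h.symm), add_sub_cancel_right]
    refine Finset.sum_congr rfl fun z hz => ?_
    exact ih ((X.mem_neighborFinset y z).1 (Finset.mem_of_mem_erase hz))

theorem card_nbWalks_le {d : ℕ} (hd : ∀ v, X.degree v ≤ d) (m : ℕ) (x y : V) :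
    (nbWalks X m x y).card ≤ d ^ m := by
  classical
  induction m generalizing x y with
  | zero => simp [nbWalks]
  | succ m ih =>
    rw [nbWalks, pow_succ']
    refine Finset.card_biUnion_le.trans ?_
    calc _ ≤ ∑ z ∈ (X.neighborFinset y).erase x, d ^ m :=
          Finset.sum_le_sum fun z _ => Finset.card_image_le.trans (ih y z)
      _ = ((X.neighborFinset y).erase x).card * d ^ m := by rw [Finset.sum_const, smul_eq_mul]
      _ ≤ d * d ^ m := by
          gcongr
          exact (Finset.card_le_card (Finset.erase_subset _ _)).trans (hd y)

/-! ### Closed walks and their number -/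

open Classical in
/-- The closed walks of length `m` from a vertex in `F` that backtrack nowhere. -/
noncomputable def closedWalks (F : Finset V) (m : ℕ) : Finset (ℕ → V) :=
  F.biUnion fun x => (X.neighborFinset x).biUnion fun y =>
    (nbWalks X m x y).filter fun p => p m = x ∧ p (m + 1) = y

/-- A walk carries one step beyond its closing, a repetition of the first. Thus the condition at `i
= m - 1` reads `p (m - 1) ≠ p 1` and excludes backtracking at the origin. -/
theorem mem_closedWalks {F : Finset V} {m : ℕ} {p : ℕ → V} :
    p ∈ closedWalks X F m ↔ p 0 ∈ F ∧ X.Adj (p 0) (p 1) ∧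
      (∀ i < m, X.Adj (p (i + 1)) (p (i + 2)) ∧ p i ≠ p (i + 2)) ∧
      (∀ i, m + 1 ≤ i → p i = p (m + 1)) ∧ p m = p 0 ∧ p (m + 1) = p 1 := by
  simp only [closedWalks, Finset.mem_biUnion, Finset.mem_filter, SimpleGraph.mem_neighborFinset,
    mem_nbWalks]
  constructor
  · rintro ⟨_, hx, _, hxy, ⟨rfl, rfl, h1, h2⟩, h3, h4⟩
    exact ⟨hx, hxy, h1, h2, h3, h4⟩
  · rintro ⟨hx, hxy, h1, h2, h3, h4⟩
    exact ⟨_, hx, _, hxy, ⟨rfl, rfl, h1, h2⟩, h3, h4⟩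

open Classical in
theorem card_closedWalks (F : Finset V) (m : ℕ) :
    (closedWalks X F m).card = ∑ x ∈ F, ∑ y ∈ X.neighborFinset x,
      ((nbWalks X m x y).filter fun p => p m = x ∧ p (m + 1) = y).card := by
  rw [closedWalks, Finset.card_biUnion]
  · refine Finset.sum_congr rfl fun x _ => ?_
    rw [Finset.card_biUnion]
    intro y _ y' _ hyy'
    rw [Function.onFun, Finset.disjoint_left]
    intro p hp hp'
    exact hyy' ((Finset.mem_filter.1 hp).2.2.symm.trans (Finset.mem_filter.1 hp').2.2)
  · intro x _ x' _ hxx'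
    rw [Function.onFun, Finset.disjoint_left]
    intro p hp hp'
    simp only [Finset.mem_biUnion, Finset.mem_filter] at hp hp'
    obtain ⟨_, _, _, h, _⟩ := hp
    obtain ⟨_, _, _, h', _⟩ := hp'
    exact hxx' (h.symm.trans h')

theorem card_closedWalks_le {d : ℕ} (hd : ∀ v, X.degree v ≤ d) (F : Finset V) (m : ℕ) :
    (closedWalks X F m).card ≤ F.card * d * d ^ m := by
  classical
  rw [card_closedWalks]
  calc _ ≤ ∑ x ∈ F, ∑ y ∈ X.neighborFinset x, d ^ m := by
        gcongr
        exact (Finset.card_filter_le _ _).trans (card_nbWalks_le X hd m _ _)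
    _ = ∑ x ∈ F, X.degree x * d ^ m := by simp
    _ ≤ ∑ x ∈ F, d * d ^ m := by gcongr; exact hd _
    _ = _ := by rw [Finset.sum_const, smul_eq_mul, mul_assoc]

/-- A periodic sequence is recorded by its values at `0, …, m + 1`, frozen afterwards; conversely
such a record is extended periodically. -/
theorem bijective_closedWalks (F : Finset V) {m : ℕ} (hm : 0 < m) :
    ∃ f : {C : ReducedPath X F // C.1.length = m} → closedWalks X F m, Function.Bijective f := by
  have hmem : ∀ C : {C : ReducedPath X F // C.1.length = m},
      (fun i : ℕ => C.1.1.vert (min i (m + 1) : ℕ)) ∈ closedWalks X F m := by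
    rintro ⟨⟨C, hC, h0⟩, rfl⟩
    rw [mem_closedWalks]
    have hred := C.isReduced_iff.1 hC
    have hper := C.periodic
    change _ ∧ _ ∧ (∀ i < C.length, _) ∧ _
    refine ⟨by simpa using h0, by simpa using C.adj 0, fun i hi => ⟨?_, ?_⟩, fun i hi => ?_, ?_, ?_⟩
    · simp only
      rw [min_eq_left (by omega), min_eq_left (by omega)]
      exact C.adj _
    · simp only
      rw [min_eq_left (by omega), min_eq_left (by omega)]
      exact hred _
    · simp only
      rw [min_eq_right hi, min_self]
    · simp only
      rw [min_eq_left (by omega), min_eq_left (by omega)]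
      simpa using hper 0
    · simp only
      rw [min_eq_left (by omega), min_eq_left (by omega)]
      have := hper 1
      rw [add_comm] at this
      exact_mod_cast this
  refine ⟨fun C => ⟨_, hmem C⟩, ?_, ?_⟩
  · rintro ⟨⟨C, hC, h0⟩, hl⟩ ⟨⟨C', hC', h0'⟩, hl'⟩ h
    refine Subtype.ext (Subtype.ext (ClosedPath.ext (hl.trans hl'.symm) (funext fun i => ?_)))
    have h1 : (fun i : ℕ => C.vert (min i (m + 1) : ℕ)) = fun i : ℕ => C'.vert (min i (m + 1) : ℕ) :=
      congrArg Subtype.val h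
    have h2 : 0 ≤ i % (m : ℤ) := Int.emod_nonneg _ (by omega)
    have h3 : i % (m : ℤ) < m := Int.emod_lt_of_pos _ (by omega)
    have h4 := congrFun h1 (i % (m : ℤ)).toNat
    change C.length = m at hl
    change C'.length = m at hl'
    rw [min_eq_left (by omega), Int.toNat_of_nonneg h2] at h4
    rw [← C.vert_emod, ← C'.vert_emod, hl, hl', h4]
  · rintro ⟨p, hp⟩
    obtain ⟨h0, h01, hnb, hconst, hm0, hm1⟩ := (mem_closedWalks X).1 hp
    -- Only `k = m` and `k = m + 1` wrap around, and there closedness of the walk applies. For `m =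
    -- 1` the index `m + 1` wraps to `0` instead of `1`.
    have hmod : ∀ k ≤ m + 1, p (k % m) = p k := by
      intro k hk
      rcases Nat.lt_or_ge k m with h | h
      · rw [Nat.mod_eq_of_lt h]
      · have : k = m ∨ k = m + 1 := by omega
        rcases this with rfl | rfl
        · rw [Nat.mod_self, hm0]
        · rcases Nat.lt_or_ge 1 m with h1 | h1
          · rw [Nat.add_mod_left, Nat.mod_eq_of_lt h1, hm1]
          · obtain rfl : m = 1 := by omega
            rw [Nat.mod_one, hm1, hm0]
    have hmod' : ∀ (i : ℤ) (k : ℕ), k ≤ 2 →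
        p ((i + k) % (m : ℤ)).toNat = p ((i % (m : ℤ)).toNat + k) := by
      intro i k hk
      have h2 : 0 ≤ i % (m : ℤ) := Int.emod_nonneg _ (by omega)
      have h3 : i % (m : ℤ) < m := Int.emod_lt_of_pos _ (by omega)
      rw [← hmod _ (show (i % (m : ℤ)).toNat + k ≤ m + 1 by omega)]
      congr 1
      have : (((i % (m : ℤ)).toNat + k : ℕ) : ℤ) % m = (i + k) % m := by
        push_cast
        rw [Int.toNat_of_nonneg h2, Int.emod_add_emod]
      rw [← this]
      exact_mod_cast Int.toNat_natCast _
    have hadj : ∀ j ≤ m, X.Adj (p j) (p (j + 1)) := by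
      intro j hj
      rcases j with _ | j
      · exact h01
      · exact (hnb j (by omega)).1
    let C : ClosedPath X :=
      { length := m
        vert := fun i => p (i % (m : ℤ)).toNat
        length_pos := hm
        periodic := fun i => by rw [Int.add_emod_right]
        adj := fun i => by
          have := hmod' i 1 (by omega)
          rw [Nat.cast_one] at this
          rw [this]
          refine hadj _ ?_
          have h3 : i % (m : ℤ) < m := Int.emod_lt_of_pos _ (by omega)
          omega }
    have hC : C.IsReduced := by
      rw [ClosedPath.isReduced_iff]
      intro i
      change p (i % (m : ℤ)).toNat ≠ p ((i + 2) % (m : ℤ)).toNat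
      have := hmod' i 2 le_rfl
      rw [Nat.cast_two] at this
      rw [this]
      refine (hnb _ ?_).2
      have h3 : i % (m : ℤ) < m := Int.emod_lt_of_pos _ (by omega)
      omega
    refine ⟨⟨⟨C, hC, by simpa [C] using h0⟩, rfl⟩, Subtype.ext (funext fun i => ?_)⟩
    change p ((((min i (m + 1) : ℕ) : ℤ) % (m : ℤ)).toNat) = p i
    have : (((min i (m + 1) : ℕ) : ℤ) % (m : ℤ)).toNat = min i (m + 1) % m := by
      exact_mod_cast Int.toNat_natCast _
    rw [this, hmod _ (min_le_right _ _)]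
    rcases le_total i (m + 1) with h | h
    · rw [min_eq_left h]
    · rw [min_eq_right h, hconst i h]

/-- Grouping by length; absolute convergence comes from at most `|F| d^(m+1)` closed walks of length
`m`. -/
theorem hasSum_reducedPath {d : ℕ} (hd : ∀ v, X.degree v ≤ d) (F : Finset V) {u : ℂ}
    (hu : d * ‖u‖ < 1) :
    (Summable fun C : ReducedPath X F => u ^ C.1.length / (C.1.length : ℂ)) ∧
    HasSum (fun m : ℕ => (closedWalks X F m).card * (u ^ m / (m : ℂ)))
      (∑' C : ReducedPath X F, u ^ C.1.length / (C.1.length : ℂ)) := by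
  have hfin : ∀ m : ℕ, 0 < m → Finite {C : ReducedPath X F // C.1.length = m} := fun m hm => by
    obtain ⟨f, hf⟩ := bijective_closedWalks X F hm
    exact Finite.of_injective f hf.1
  have hemp : IsEmpty {C : ReducedPath X F // C.1.length = 0} :=
    ⟨fun C => C.1.1.length_pos.ne' C.2⟩
  have hfib : ∀ (m : ℕ) (φ : ℕ → ℂ), HasSum
      (fun C : {C : ReducedPath X F // C.1.length = m} => φ C.1.1.length / (C.1.1.length : ℂ))
      ((closedWalks X F m).card * (φ m / (m : ℂ))) := by
    intro m φ
    -- `closedWalks X F 0` has one element for each edge leaving `F`, but division by `0` gives `0`,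
    -- in accordance with the absence of closed paths of length `0`.
    rcases m.eq_zero_or_pos with rfl | hm
    · simp
    · have := hfin m hm
      have := Fintype.ofFinite {C : ReducedPath X F // C.1.length = m}
      obtain ⟨f, hf⟩ := bijective_closedWalks X F hm
      have hcard : Fintype.card {C : ReducedPath X F // C.1.length = m} =
          (closedWalks X F m).card := by
        rw [Fintype.card_of_bijective hf, Fintype.card_coe]
      convert hasSum_fintype _ using 1
      rw [Finset.sum_congr rfl (fun C _ => by rw [C.2]), Finset.sum_const, Finset.card_univ, hcard,
        nsmul_eq_mul]
  set e := Equiv.sigmaFiberEquiv (fun C : ReducedPath X F => C.1.length) with he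
  have hs : Summable fun C : ReducedPath X F => u ^ C.1.length / (C.1.length : ℂ) := by
    rw [← e.summable_iff, ← summable_norm_iff, summable_sigma_of_nonneg fun _ => norm_nonneg _]
    have hfib' : ∀ m : ℕ, HasSum
        (fun C : {C : ReducedPath X F // C.1.length = m} => ‖u ^ C.1.1.length / (C.1.1.length : ℂ)‖)
        ((closedWalks X F m).card * (‖u‖ ^ m / (m : ℝ))) := by
      intro m
      have := hfib m (fun m => ((‖u‖ ^ m : ℝ) : ℂ))
      rw [← Complex.hasSum_ofReal]
      push_cast
      convert this using 1
      · funext C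
        simp
      · push_cast; rfl
    refine ⟨fun m => (hfib' m).summable, ?_⟩
    refine Summable.of_nonneg_of_le (fun m => tsum_nonneg fun _ => norm_nonneg _) (fun m => ?_)
      ((summable_geometric_of_lt_one (by positivity) hu).mul_left (F.card * d : ℝ))
    refine (hfib' m).tsum_eq.trans_le ?_
    rw [mul_pow]
    have h1 : ((closedWalks X F m).card : ℝ) ≤ F.card * d * d ^ m := by
      exact_mod_cast card_closedWalks_le X hd F m
    have h2 : ‖u‖ ^ m / (m : ℝ) ≤ ‖u‖ ^ m := by
      rcases m.eq_zero_or_pos with rfl | hm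
      · simp
      · exact div_le_self (by positivity) (by exact_mod_cast hm)
    calc _ ≤ (F.card * d * d ^ m : ℝ) * ‖u‖ ^ m := by gcongr
      _ = _ := by ring
  refine ⟨hs, ?_⟩
  have h1 := e.hasSum_iff.2 hs.hasSum
  exact h1.sigma fun m => hfib m (fun m => u ^ m)

end Walks

/-! ## Traces of the transfer operator -/

section Traces

variable {V : Type*} {X : SimpleGraph V} [X.LocallyFinite] {Γ : Subgroup (X ≃g X)}

/-- The sum of an invariant function over the edges that leave a fundamental domain agrees with
the sum over the edges that enter it. -/
theorem sum_edges_flip {F : Finset V} (hfree : ∀ γ ∈ Γ, ∀ v : V, γ • v = v → γ = 1)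
    (hF : ∀ v : V, ∃! x, x ∈ F ∧ x ∈ MulAction.orbit Γ v) {g : V → V → ℂ}
    (hg : ∀ γ ∈ Γ, ∀ x y, g (γ • x) (γ • y) = g x y) :
    ∑ x ∈ F, ∑ y ∈ X.neighborFinset x, g x y = ∑ x ∈ F, ∑ y ∈ X.neighborFinset x, g y x := by
  have hρ : ∀ v : V, ∃ γ : Γ, γ • v ∈ F := fun v => by
    obtain ⟨x, ⟨hx, γ, hγ⟩, -⟩ := hF v
    exact ⟨γ, by change γ • v = x at hγ; rwa [hγ]⟩
  choose ρ hρ using hρ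
  have huniq : ∀ {v : V} {γ γ' : Γ}, γ • v ∈ F → γ' • v ∈ F → γ = γ' := by
    intro v γ γ' h h'
    have h1 : γ • v = γ' • v := (hF v).unique ⟨h, ⟨γ, rfl⟩⟩ ⟨h', ⟨γ', rfl⟩⟩
    have h2 : (γ'⁻¹ * γ) • v = v := by rw [mul_smul, h1, inv_smul_smul]
    have h3 : γ'⁻¹ * γ = 1 := Subtype.ext (hfree _ (γ'⁻¹ * γ).2 v h2)
    exact (inv_mul_eq_one.1 h3).symm
  rw [Finset.sum_sigma', Finset.sum_sigma']
  -- Reverse the edge and translate it back so that it starts in `F` again. By freeness the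
  -- translating element is unique, so this is an involution of the edges leaving `F`.
  have hmaps : ∀ p : (_ : V) × V, p ∈ F.sigma (fun x => X.neighborFinset x) →
      (⟨ρ p.2 • p.2, ρ p.2 • p.1⟩ : (_ : V) × V) ∈ F.sigma (fun x => X.neighborFinset x) := by
    rintro ⟨x, y⟩ h
    rw [Finset.mem_sigma, SimpleGraph.mem_neighborFinset] at h ⊢
    exact ⟨hρ y, ((ρ y : X ≃g X).map_adj_iff).2 h.2.symm⟩
  have hinv : ∀ p : (_ : V) × V, p ∈ F.sigma (fun x => X.neighborFinset x) →
      (⟨ρ (ρ p.2 • p.1) • ρ p.2 • p.1, ρ (ρ p.2 • p.1) • ρ p.2 • p.2⟩ : (_ : V) × V) = p := by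
    rintro ⟨x, y⟩ h
    rw [Finset.mem_sigma] at h
    have h1 : ρ (ρ y • x) * ρ y = 1 := huniq (v := x)
      (by rw [mul_smul]; exact hρ _) (by rw [one_smul]; exact h.1)
    simp only [← mul_smul, h1, one_smul]
  refine Finset.sum_nbij' (fun p => ⟨ρ p.2 • p.2, ρ p.2 • p.1⟩)
    (fun p => ⟨ρ p.2 • p.2, ρ p.2 • p.1⟩) hmaps hmaps hinv hinv ?_
  rintro ⟨x, y⟩ -
  exact (hg _ (ρ y).2 _ _).symm

/-! ### Traces on edges and on vertices -/

variable (X) in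
open Classical in
/-- The trace, over the edges that leave `F`, of an operator on functions of edges. -/
noncomputable def edgeTrace (F : Finset V) : Module.End ℂ (V → V → ℂ) →ₗ[ℂ] ℂ where
  toFun R := ∑ x ∈ F, ∑ y ∈ X.neighborFinset x, R (Pi.single x (Pi.single y 1)) x y
  map_add' R R' := by simp [Finset.sum_add_distrib]
  map_smul' c R := by simp [Finset.mul_sum]

open Classical in
/-- The trace, over `F`, of an operator on functions of vertices. -/
noncomputable def vertexTrace (F : Finset V) : Module.End ℂ (V → ℂ) →ₗ[ℂ] ℂ where
  toFun R := ∑ x ∈ F, R (Pi.single x 1) x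
  map_add' R R' := by simp [Finset.sum_add_distrib]
  map_smul' c R := by simp [Finset.mul_sum]

/-- Summing the indicator of the edge `(x, y)` over outgoing edges gives the indicator of `x`, so
the sum over `y` becomes an application of `tailSum`. No invariance enters, since both traces are
organised by the origin `x ∈ F`. -/
theorem edgeTrace_mul_pullback (F : Finset V) (R : Module.End ℂ (V → V → ℂ)) :
    edgeTrace X F (R * (headPullback ∘ₗ tailSum X)) =
      vertexTrace F (tailSum X ∘ₗ R ∘ₗ headPullback) := by
  classical
  refine Finset.sum_congr rfl fun x _ => Finset.sum_congr rfl fun y hy => ?_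
  have : tailSum X (Pi.single x (Pi.single y 1)) = Pi.single x 1 := by
    funext a
    change ∑ b ∈ X.neighborFinset a, (Pi.single x (Pi.single y (1 : ℂ)) : V → V → ℂ) a b = _
    rcases eq_or_ne a x with rfl | h
    · simp only [Pi.single_eq_same]
      simp only [Pi.single_apply]
      rw [Finset.sum_ite_eq', if_pos hy]
    · simp [h]
  change R (headPullback (tailSum X _)) x y = _
  rw [Pi.single, Pi.single] at this
  rw [Pi.single, Pi.single, this]
  rfl

variable (Γ) in
/-- Operators on functions of edges that commute with the group. -/
def IsEquivariant (R : Module.End ℂ (V → V → ℂ)) : Prop :=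
  ∀ γ ∈ Γ, ∀ g : V → V → ℂ,
    R (fun x y => g (γ • x) (γ • y)) = fun x y => R g (γ • x) (γ • y)

omit [X.LocallyFinite] in
theorem IsEquivariant.mul {R S : Module.End ℂ (V → V → ℂ)} (hR : IsEquivariant Γ R)
    (hS : IsEquivariant Γ S) : IsEquivariant Γ (R * S) := fun γ hγ g => by
  rw [Module.End.mul_apply, Module.End.mul_apply, hS γ hγ, hR γ hγ]

omit [X.LocallyFinite] in
theorem IsEquivariant.pow {R : Module.End ℂ (V → V → ℂ)} (hR : IsEquivariant Γ R) (n : ℕ) :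
    IsEquivariant Γ (R ^ n) := by
  induction n with
  | zero => exact fun _ _ _ => rfl
  | succ n ih => rw [pow_succ]; exact ih.mul hR

theorem sum_neighborFinset_smul (γ : X ≃g X) (x : V) (f : V → ℂ) :
    ∑ y ∈ X.neighborFinset x, f (γ • y) = ∑ y ∈ X.neighborFinset (γ • x), f y := by
  refine Finset.sum_nbij' (fun y => γ • y) (fun y => γ⁻¹ • y) ?_ ?_ ?_ ?_ ?_
  · intro y hy
    rw [SimpleGraph.mem_neighborFinset] at hy ⊢
    exact γ.map_adj_iff.2 hy
  · intro y hy
    rw [SimpleGraph.mem_neighborFinset] at hy ⊢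
    have := (γ⁻¹ : X ≃g X).map_adj_iff.2 hy
    change X.Adj (γ⁻¹ • γ • x) (γ⁻¹ • y) at this
    rwa [inv_smul_smul] at this
  · intro y _; exact inv_smul_smul γ y
  · intro y _; exact smul_inv_smul γ y
  · intro y _; rfl

theorem isEquivariant_pullback : IsEquivariant Γ (headPullback ∘ₗ tailSum X) :=
  fun γ _ g => funext fun _ => funext fun y => sum_neighborFinset_smul γ y (g (γ • y))

theorem isEquivariant_nbTransfer : IsEquivariant Γ (nbTransfer X) := fun γ hγ g => by
  have := isEquivariant_pullback (X := X) γ hγ g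
  rw [nbTransfer, LinearMap.sub_apply, this]
  rfl

/-- The two diagonals are values of one function of edges, taken on the edges leaving `F` and on
their reversals. Equivariance of `R` makes this function invariant, and `sum_edges_flip` applies. -/
theorem edgeTrace_mul_flip {F : Finset V} (hfree : ∀ γ ∈ Γ, ∀ v : V, γ • v = v → γ = 1)
    (hF : ∀ v : V, ∃! x, x ∈ F ∧ x ∈ MulAction.orbit Γ v) {R : Module.End ℂ (V → V → ℂ)}
    (hR : IsEquivariant Γ R) :
    edgeTrace X F (R * edgeFlip) = edgeTrace X F (edgeFlip * R) := by
  classical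
  have hflip : ∀ x y : V, edgeFlip (Pi.single x (Pi.single y (1 : ℂ)) : V → V → ℂ) =
      Pi.single y (Pi.single x 1) := by
    intro x y
    funext a b
    change (Pi.single x (Pi.single y (1 : ℂ)) : V → V → ℂ) b a = _
    simp only [Pi.single_apply, Pi.zero_apply, ite_apply]
    split_ifs <;> rfl
  have hinv : ∀ γ ∈ Γ, ∀ x y : V,
      R (Pi.single (γ • x) (Pi.single (γ • y) 1)) (γ • y) (γ • x) =
        R (Pi.single x (Pi.single y 1)) y x := by
    intro γ hγ x y
    have h1 := congrFun (congrFun (hR γ hγ (Pi.single (γ • x) (Pi.single (γ • y) 1))) y) x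
    rw [← h1]
    refine congrArg (fun g => R g y x) (funext fun a => funext fun b => ?_)
    have hinj := MulAction.injective (β := V) γ
    simp only [Pi.single_apply, Pi.zero_apply, ite_apply, hinj.eq_iff]
  have := sum_edges_flip hfree hF (g := fun x y => R (Pi.single x (Pi.single y 1)) y x) hinv
  refine Eq.trans ?_ (this.symm.trans ?_)
  · refine Finset.sum_congr rfl fun x _ => Finset.sum_congr rfl fun y _ => ?_
    change R (edgeFlip _) x y = _
    convert rfl using 4
    convert (hflip x y).symm
  · refine Finset.sum_congr rfl fun x _ => Finset.sum_congr rfl fun y _ => ?_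
    change _ = R _ y x
    congr

/-! ### Numbers of walks without backtracking -/

theorem tailSum_headPullback (f : V → ℂ) : tailSum X (headPullback f) = adjLinear X f := rfl

theorem tailSum_flip_headPullback (f : V → ℂ) :
    tailSum X (edgeFlip (headPullback f)) = degLinear X f + f := by
  funext x
  change ∑ y ∈ X.neighborFinset x, f x = ((X.degree x : ℂ) - 1) * f x + f x
  rw [Finset.sum_const, SimpleGraph.card_neighborFinset_eq_degree, nsmul_eq_mul]
  ring

theorem edgeFlip_edgeFlip (g : V → V → ℂ) : edgeFlip (edgeFlip g) = g := rfl

theorem nbTransfer_eq (g : V → V → ℂ) :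
    nbTransfer X g = headPullback (tailSum X g) - edgeFlip g := rfl

variable (X) in
/-- The matrix that counts walks of length `k + 1` without backtracking. -/
def nbMatrix (k : ℕ) : Module.End ℂ (V → ℂ) := tailSum X ∘ₗ (nbTransfer X ^ k) ∘ₗ headPullback

/-- With `T = P S - J`, `J² = 1` and `S J P = Q + 1` one gets `S J T = (Q + 1) S - S = Q S`. -/
theorem tailSum_flip_nbTransfer_pow (k : ℕ) :
    tailSum X ∘ₗ (edgeFlip * nbTransfer X ^ (k + 1)) ∘ₗ headPullback =
      degLinear X * nbMatrix X k := by
  refine LinearMap.ext fun f => ?_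
  rw [pow_succ']
  change tailSum X (edgeFlip (nbTransfer X ((nbTransfer X ^ k) (headPullback f)))) =
    degLinear X (tailSum X ((nbTransfer X ^ k) (headPullback f)))
  rw [nbTransfer_eq, map_sub, map_sub, tailSum_flip_headPullback, edgeFlip_edgeFlip,
    add_sub_cancel_right]

theorem nbMatrix_one : nbMatrix X 1 = adjLinear X * adjLinear X - (degLinear X + 1) := by
  refine LinearMap.ext fun f => ?_
  rw [nbMatrix, pow_one]
  change tailSum X (nbTransfer X (headPullback f)) = _
  rw [nbTransfer_eq, map_sub, tailSum_headPullback, tailSum_headPullback,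
    tailSum_flip_headPullback]
  rfl

/-- From `S T = A S - S J` and `S J T = Q S`. At the start of the recurrence `S J P = Q + 1` occurs
in place of `Q`; this discrepancy produces the factor `1 - u²` in the end. -/
theorem nbMatrix_add_two (k : ℕ) :
    nbMatrix X (k + 2) = adjLinear X * nbMatrix X (k + 1) - degLinear X * nbMatrix X k := by
  rw [← tailSum_flip_nbTransfer_pow]
  refine LinearMap.ext fun f => ?_
  rw [nbMatrix, pow_succ']
  change tailSum X (nbTransfer X ((nbTransfer X ^ (k + 1)) (headPullback f))) = _
  rw [nbTransfer_eq, map_sub, tailSum_headPullback]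
  rfl

section

variable {F : Finset V} (hfree : ∀ γ ∈ Γ, ∀ v : V, γ • v = v → γ = 1)
    (hF : ∀ v : V, ∃! x, x ∈ F ∧ x ∈ MulAction.orbit Γ v)

theorem edgeTrace_nbTransfer_pow_succ (k : ℕ) :
    edgeTrace X F (nbTransfer X ^ (k + 1)) =
      vertexTrace F (nbMatrix X k) - edgeTrace X F (nbTransfer X ^ k * edgeFlip) := by
  rw [pow_succ]
  conv_lhs => rw [nbTransfer]
  rw [mul_sub, map_sub, ← nbTransfer, edgeTrace_mul_pullback]
  rfl

include hfree hF in
-- A further factor `T = P S - J` is expanded; `J² = 1` brings back a power of `T` two steps lower,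
-- which is what closes the recurrence for the edge traces.
theorem edgeTrace_nbTransfer_pow_mul_flip (k : ℕ) :
    edgeTrace X F (nbTransfer X ^ (k + 1) * edgeFlip) =
      vertexTrace F (tailSum X ∘ₗ (edgeFlip * nbTransfer X ^ k) ∘ₗ headPullback) -
        edgeTrace X F (nbTransfer X ^ k) := by
  have h1 : nbTransfer X ^ (k + 1) * edgeFlip =
      (nbTransfer X ^ k * (headPullback ∘ₗ tailSum X)) * edgeFlip - nbTransfer X ^ k := by
    rw [pow_succ]
    conv_lhs => enter [1, 2]; rw [nbTransfer]
    rw [mul_sub, sub_mul, mul_assoc _ edgeFlip edgeFlip]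
    rfl
  rw [h1, map_sub, edgeTrace_mul_flip hfree hF
    ((isEquivariant_nbTransfer.pow k).mul isEquivariant_pullback), ← mul_assoc,
    edgeTrace_mul_pullback]

theorem edgeTrace_flip : edgeTrace X F edgeFlip = 0 := by
  classical
  refine Finset.sum_eq_zero fun x _ => Finset.sum_eq_zero fun y hy => ?_
  have := ((X.mem_neighborFinset x y).1 hy).ne
  change (Pi.single x (Pi.single y (1 : ℂ)) : V → V → ℂ) y x = 0
  rw [Pi.single_eq_of_ne this.symm]
  rfl

theorem edgeTrace_one : edgeTrace X F 1 = ∑ x ∈ F, (X.degree x : ℂ) := by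
  classical
  refine Finset.sum_congr rfl fun x _ => ?_
  rw [← SimpleGraph.card_neighborFinset_eq_degree, Finset.card_eq_sum_ones, Nat.cast_sum]
  refine Finset.sum_congr rfl fun y _ => ?_
  change (Pi.single x (Pi.single y (1 : ℂ)) : V → V → ℂ) x y = _
  simp

theorem vertexTrace_degree :
    vertexTrace F (tailSum X ∘ₗ edgeFlip ∘ₗ headPullback) = ∑ x ∈ F, (X.degree x : ℂ) := by
  classical
  refine Finset.sum_congr rfl fun x _ => ?_
  change tailSum X (edgeFlip (headPullback _)) x = _
  rw [tailSum_flip_headPullback]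
  change ((X.degree x : ℂ) - 1) * (Pi.single x (1 : ℂ) : V → ℂ) x +
    (Pi.single x (1 : ℂ) : V → ℂ) x = _
  simp

theorem edgeTrace_nbTransfer_one :
    edgeTrace X F (nbTransfer X ^ 1) = vertexTrace F (nbMatrix X 0) := by
  rw [edgeTrace_nbTransfer_pow_succ, pow_zero, one_mul, edgeTrace_flip, sub_zero]

include hfree hF in
theorem edgeTrace_nbTransfer_two :
    edgeTrace X F (nbTransfer X ^ 2) = vertexTrace F (nbMatrix X 1) := by
  rw [edgeTrace_nbTransfer_pow_succ, edgeTrace_nbTransfer_pow_mul_flip hfree hF, pow_zero, mul_one,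
    vertexTrace_degree, edgeTrace_one, sub_self, sub_zero]

include hfree hF in
-- The first trace counts closed walks with tails allowed. Prolonging a closed walk of length `k +
-- 1` by a tail edge is possible in `deg - 1` ways if it already has a tail, and in `deg - 2` ways
-- if not, whence the correction by `Q` and by the shorter reduced walks.
theorem edgeTrace_nbTransfer_add_three (k : ℕ) :
    edgeTrace X F (nbTransfer X ^ (k + 3)) = vertexTrace F (nbMatrix X (k + 2)) -
      vertexTrace F (degLinear X * nbMatrix X k) + edgeTrace X F (nbTransfer X ^ (k + 1)) := by
  rw [edgeTrace_nbTransfer_pow_succ, edgeTrace_nbTransfer_pow_mul_flip hfree hF,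
    tailSum_flip_nbTransfer_pow]
  ring

end

theorem edgeTrace_nbTransfer_pow (F : Finset V) (m : ℕ) :
    edgeTrace X F (nbTransfer X ^ m) = (closedWalks X F m).card := by
  classical
  rw [card_closedWalks]
  push_cast
  refine Finset.sum_congr rfl fun x _ => Finset.sum_congr rfl fun y hy => ?_
  rw [nbTransfer_pow_apply _ _ _ ((X.mem_neighborFinset x y).1 hy), Finset.card_filter]
  push_cast
  refine Finset.sum_congr rfl fun p _ => ?_
  simp only [Pi.single_apply, ite_apply, Pi.zero_apply, ite_and]

end Traces

/-! ## The logarithm defined by a contour -/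

section FunctionalCalculus

open Filter Topology Asymptotics

/-- The series `∑ xⁿ / n = -log (1 - x)`. -/
noncomputable def mercator {A : Type*} [NormedRing A] [NormedAlgebra ℂ A] (x : A) : A :=
  ∑' n : ℕ, (n : ℂ)⁻¹ • x ^ n

/-- The term of index `0` vanishes because `(0 : ℂ)⁻¹ = 0`; the series effectively starts at `n =
1`. -/
theorem mercator_zero {A : Type*} [NormedRing A] [NormedAlgebra ℂ A] : mercator (0 : A) = 0 := by
  rw [mercator]
  convert tsum_zero with n
  rcases n with _ | n <;> simp

variable {A : Type*} [NormedRing A] [NormedAlgebra ℂ A] [CompleteSpace A]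

/-- Gelfand's formula. Control of powers by the spectrum, rather than by the norm, is what admits
every disc containing the spectrum. -/
theorem exists_norm_pow_le {a : A} {r : ℝ} (hr : 0 < r) (h : ∀ z ∈ spectrum ℂ a, ‖z‖ < r) :
    ∃ C q : ℝ, 0 < q ∧ q < r ∧ ∀ n, ‖a ^ n‖ ≤ C * q ^ n := by
  have hlt : spectralRadius ℂ a < ENNReal.ofReal r := by
    rcases (spectrum ℂ a).eq_empty_or_nonempty with he | hne
    · simp [spectralRadius, he, hr]
    · exact spectrum.spectralRadius_lt_of_forall_lt_of_nonempty hne (r := r.toNNReal)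
        fun k hk => by
          rw [← NNReal.coe_lt_coe, Real.coe_toNNReal _ hr.le]
          exact h k hk
  obtain ⟨q, h1, h2⟩ := ENNReal.lt_iff_exists_nnreal_btwn.1 hlt
  have hq0 : (0 : ℝ) < q := by
    have : (0 : ENNReal) < q := (zero_le).trans_lt h1
    exact_mod_cast this
  have hqr : (q : ℝ) < r := by
    rw [ENNReal.ofReal, ENNReal.coe_lt_coe, ← NNReal.coe_lt_coe, Real.coe_toNNReal _ hr.le] at h2
    exact h2
  have hev := (spectrum.pow_norm_pow_one_div_tendsto_nhds_spectralRadius a).eventually_lt_const h1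
  have hO : (fun n : ℕ => a ^ n) =O[atTop] (fun n : ℕ => (q : ℝ) ^ n) := by
    refine IsBigO.of_bound 1 ?_
    filter_upwards [hev, eventually_gt_atTop 0] with n hn hn0
    have h3 : ‖a ^ n‖ ^ (1 / n : ℝ) < q := by
      rw [← ENNReal.ofReal_coe_nnreal] at hn
      exact (ENNReal.ofReal_lt_ofReal_iff hq0).1 hn
    have h4 : ‖a ^ n‖ = (‖a ^ n‖ ^ (1 / n : ℝ)) ^ n := by
      rw [one_div, Real.rpow_inv_natCast_pow (norm_nonneg _) hn0.ne']
    rw [one_mul, Real.norm_of_nonneg (by positivity), h4]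
    gcongr
  -- The finitely many exceptional exponents are absorbed into the constant.
  obtain ⟨C, -, hC⟩ := bound_of_isBigO_nat_atTop hO
  refine ⟨C, q, hq0, hqr, fun n => ?_⟩
  have := hC (x := n) (by positivity)
  rwa [Real.norm_of_nonneg (by positivity)] at this

omit [CompleteSpace A] in
theorem summable_norm_inv_smul_pow {x : A} {C q : ℝ} (hq0 : 0 ≤ q) (hq1 : q < 1)
    (h : ∀ n, ‖x ^ n‖ ≤ C * q ^ n) : Summable fun n : ℕ => ‖(n : ℂ)⁻¹ • x ^ n‖ := by
  refine Summable.of_nonneg_of_le (fun _ => norm_nonneg _) (fun n => ?_)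
    ((summable_geometric_of_lt_one hq0 hq1).mul_left C)
  rw [norm_smul, norm_inv, Complex.norm_natCast]
  rcases n.eq_zero_or_pos with rfl | hn
  · simpa using (norm_nonneg _).trans (h 0)
  · refine (mul_le_of_le_one_left (norm_nonneg _) (inv_le_one_of_one_le₀ ?_)).trans (h n)
    exact_mod_cast hn

theorem hasSum_mercator {x : A} {C q : ℝ} (hq0 : 0 ≤ q) (hq1 : q < 1)
    (h : ∀ n, ‖x ^ n‖ ≤ C * q ^ n) : HasSum (fun n : ℕ => (n : ℂ)⁻¹ • x ^ n) (mercator x) :=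
  (summable_norm_inv_smul_pow hq0 hq1 h).of_norm.hasSum

/-- Neumann series around `c`. It converges as soon as `‖z - c‖` exceeds the growth rate of the
powers of `T - c`, even if the norm of `T - c` is larger. -/
theorem hasSum_resolvent {T : A} {c z : ℂ} {C q : ℝ} (hq0 : 0 ≤ q) (hq : q < ‖z - c‖)
    (h : ∀ n, ‖(T - algebraMap ℂ A c) ^ n‖ ≤ C * q ^ n) :
    HasSum (fun n : ℕ => ((z - c)⁻¹ ^ n * (z - c)⁻¹) • (T - algebraMap ℂ A c) ^ n)
      (resolvent T z) := by
  set a := T - algebraMap ℂ A c with ha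
  have hz0 : 0 < ‖z - c‖ := hq0.trans_lt hq
  have hz : z - c ≠ 0 := norm_pos_iff.1 hz0
  set x := (z - c)⁻¹ • a with hx
  have hxn : ∀ n, x ^ n = (z - c)⁻¹ ^ n • a ^ n := fun n => by rw [hx, smul_pow]
  have hsum : Summable fun n => x ^ n := by
    refine Summable.of_norm_bounded ((summable_geometric_of_lt_one (r := q / ‖z - c‖)
      (by positivity) ((div_lt_one hz0).2 hq)).mul_left C) fun n => ?_
    rw [hxn, norm_smul, norm_pow, norm_inv, div_pow, inv_pow, ← mul_div_assoc, div_eq_inv_mul]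
    gcongr
    exact h n
  have h1 := hsum.tsum_pow_mul_one_sub
  have h2 := hsum.one_sub_mul_tsum_pow
  have h3 : algebraMap ℂ A z - T = (z - c) • (1 - x) := by
    rw [hx, smul_sub, smul_smul, mul_inv_cancel₀ hz, one_smul, ha, Algebra.algebraMap_eq_smul_one,
      Algebra.algebraMap_eq_smul_one, sub_smul]
    abel
  have h4 : resolvent T z = (z - c)⁻¹ • ∑' n, x ^ n := by
    have hu : Ring.inverse (algebraMap ℂ A z - T) = (z - c)⁻¹ • ∑' n, x ^ n := by
      have := Ring.inverse_unit (⟨algebraMap ℂ A z - T, (z - c)⁻¹ • ∑' n, x ^ n, by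
        rw [h3, smul_mul_smul_comm, mul_inv_cancel₀ hz, h2, one_smul], by
        rw [h3, smul_mul_smul_comm, inv_mul_cancel₀ hz, h1, one_smul]⟩ : Aˣ)
      exact this
    exact hu
  rw [h4]
  refine (hsum.hasSum.const_smul (z - c)⁻¹).congr_fun ?_ |> fun h => h
  intro n
  rw [hxn, smul_smul, mul_comm]

/-! ### The contour logarithm as a Mercator series at the centre -/

variable {E : Type*} [NormedAddCommGroup E] [NormedSpace ℂ E]

/-- A disc that carries a branch of the logarithm omits `0`, as `exp` has no zeros. -/
theorem LogContour.radius_lt {T : E →L[ℂ] E} (K : LogContour T) : K.radius < ‖K.center‖ := by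
  by_contra! h
  exact Complex.exp_ne_zero _ (K.exp_branch 0 (by simpa using h))

theorem LogContour.center_ne_zero {T : E →L[ℂ] E} (K : LogContour T) : K.center ≠ 0 := by
  have := K.radius_pos.trans K.radius_lt
  exact norm_pos_iff.1 this

theorem div_mem_slitPlane {c z : ℂ} (h : ‖z - c‖ < ‖c‖) : z / c ∈ Complex.slitPlane := by
  have hc : c ≠ 0 := norm_pos_iff.1 ((norm_nonneg _).trans_lt h)
  apply Complex.mem_slitPlane_of_norm_lt_one (z := z / c - 1) ?_ |> fun h => by simpa using h
  rwa [div_sub_one hc, norm_div, div_lt_one (norm_pos_iff.2 hc)]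

/-- On the disc `z / c` stays within distance `1` of `1`, so the principal logarithm of `z / c` is
continuous. The difference from the given branch is continuous on a connected set with values in a
translate of `2πi ℤ`, hence constant. -/
theorem LogContour.branch_eq {T : E →L[ℂ] E} (K : LogContour T) {z : ℂ}
    (hz : z ∈ Metric.closedBall K.center K.radius) :
    K.branch z = K.branch K.center + Complex.log (z / K.center) := by
  have hslit : ∀ z ∈ Metric.closedBall K.center K.radius, z / K.center ∈ Complex.slitPlane := by
    intro z hz
    rw [mem_closedBall_iff_norm] at hz
    exact div_mem_slitPlane (hz.trans_lt K.radius_lt)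
  set f : ℂ → ℂ := fun z => K.branch z - Complex.log (z / K.center) with hf
  have hcont : ContinuousOn f (Metric.closedBall K.center K.radius) :=
    K.continuousOn_branch.sub ((continuousOn_id.div_const _).clog hslit)
  have hval : ∀ z ∈ Metric.closedBall K.center K.radius,
      f z ∈ Set.range fun n : ℤ => Complex.log K.center + n * (2 * Real.pi * Complex.I) := by
    intro z hz
    have : Complex.exp (f z) = Complex.exp (Complex.log K.center) := by
      rw [hf]
      simp only
      rw [Complex.exp_sub, K.exp_branch z hz, Complex.exp_log (Complex.slitPlane_ne_zero (hslit z hz)),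
        Complex.exp_log K.center_ne_zero]
      have := Complex.slitPlane_ne_zero (hslit z hz)
      have hz0 : z ≠ 0 := by rintro rfl; simp at this
      have := K.center_ne_zero
      field_simp
    obtain ⟨n, hn⟩ := Complex.exp_eq_exp_iff_exists_int.1 this
    exact ⟨n, hn.symm⟩
  have hpre : IsPreconnected (f '' Metric.closedBall K.center K.radius) :=
    (convex_closedBall _ _).isPreconnected.image f hcont
  have hsub := (Set.countable_range _).isTotallyDisconnected _
    (Set.image_subset_iff.2 hval) hpre
  have hc : K.center ∈ Metric.closedBall K.center K.radius :=
    Metric.mem_closedBall_self K.radius_pos.le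
  have := hsub (Set.mem_image_of_mem f hz) (Set.mem_image_of_mem f hc)
  simp only [hf] at this
  rw [div_self K.center_ne_zero, Complex.log_one, sub_zero] at this
  rw [← this]; ring

/-- Taylor coefficients of the branch of the logarithm at the centre. -/
theorem LogContour.cauchyPowerSeries_coeff {T : E →L[ℂ] E} (K : LogContour T) (n : ℕ) :
    (2 * Real.pi * Complex.I : ℂ)⁻¹ • (∮ z in C(K.center, K.radius),
      (z - K.center)⁻¹ ^ n • (z - K.center)⁻¹ • K.branch z) =
    (if n = 0 then K.branch K.center else 0) - (n : ℂ)⁻¹ * (-K.center⁻¹) ^ n := by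
  set c := K.center with hc
  have hc0 : c ≠ 0 := K.center_ne_zero
  set b : ℕ → ℂ := fun n => (if n = 0 then K.branch c else 0) - (n : ℂ)⁻¹ * (-c⁻¹) ^ n with hb
  have hlog : ∀ w : ℂ, w ∈ Metric.ball 0 K.radius →
      HasSum (fun n => w ^ n • b n) (K.branch (c + w)) := by
    intro w hw
    rw [mem_ball_zero_iff] at hw
    rw [K.branch_eq (z := c + w) (by simpa [← hc] using hw.le), ← hc]
    have h1 := Complex.hasSum_taylorSeries_neg_log (z := -(w / c)) (by
      rw [norm_neg, norm_div, div_lt_one (norm_pos_iff.2 hc0)]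
      exact hw.trans K.radius_lt)
    have h2 := (hasSum_ite_eq 0 (K.branch c)).sub h1
    rw [sub_neg_eq_add, sub_neg_eq_add] at h2
    have h3 : 1 + w / c = (c + w) / c := by field_simp
    rw [h3] at h2
    refine h2.congr_fun fun n => ?_
    simp only [hb]
    rcases n.eq_zero_or_pos with rfl | hn
    · simp
    · rw [if_neg hn.ne', smul_eq_mul, zero_sub, zero_sub, ← neg_div, neg_pow, neg_pow (w / c), div_pow,
        inv_pow]
      have : (n : ℂ) ≠ 0 := by exact_mod_cast hn.ne'
      field_simp
  have hp1 : HasFPowerSeriesAt K.branch (FormalMultilinearSeries.ofScalars ℂ b) c := by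
    rw [hasFPowerSeriesAt_iff]
    filter_upwards [Metric.ball_mem_nhds 0 K.radius_pos] with w hw
    have h1 : ∀ n, (FormalMultilinearSeries.ofScalars ℂ b).coeff n = b n := fun n => by
      rw [FormalMultilinearSeries.coeff_ofScalars]
    simpa only [h1] using hlog w hw
  have hdiff : DiffContOnCl ℂ K.branch (Metric.ball c K.radius) := by
    refine ⟨?_, ?_⟩
    · intro z hz
      have hs : z / c ∈ Complex.slitPlane := by
        rw [mem_ball_iff_norm] at hz
        exact div_mem_slitPlane (hz.trans K.radius_lt)
      have : DifferentiableWithinAt ℂ (fun z => K.branch c + Complex.log (z / c))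
          (Metric.ball c K.radius) z := by
        refine DifferentiableAt.differentiableWithinAt ?_
        exact ((differentiableAt_id.div_const c).clog hs).const_add _
      exact this.congr (fun y hy => K.branch_eq (Metric.ball_subset_closedBall hy))
        (K.branch_eq (Metric.ball_subset_closedBall hz))
    · rw [closure_ball _ K.radius_pos.ne']
      exact K.continuousOn_branch
  have hp2 : HasFPowerSeriesAt K.branch (cauchyPowerSeries K.branch c K.radius) c :=
    (DiffContOnCl.hasFPowerSeriesOnBall (R := ⟨K.radius, K.radius_pos.le⟩) hdiff
      K.radius_pos).hasFPowerSeriesAt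
  -- The contour integrals are the coefficients of the Cauchy power series, and a function has only
  -- one power series at a point.
  have heq := hp2.eq_formalMultilinearSeries hp1
  have := congrArg (fun p => FormalMultilinearSeries.coeff p n) heq
  simp only [FormalMultilinearSeries.coeff_ofScalars] at this
  refine Eq.trans ?_ this
  simp [cauchyPowerSeries, FormalMultilinearSeries.coeff]

/-- The Neumann series of the resolvent is integrated term by term over the circle; each integral is
a Taylor coefficient of the branch at the centre. -/
theorem LogContour.log_eq_mercator [CompleteSpace E] {T : E →L[ℂ] E} (K : LogContour T) :
    K.log = K.branch K.center • (1 : E →L[ℂ] E) - mercator (1 - K.center⁻¹ • T) := by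
  set c := K.center with hc
  have hc0 : c ≠ 0 := K.center_ne_zero
  set a := T - algebraMap ℂ (E →L[ℂ] E) c with ha
  -- The spectrum is compact in the open disc, so the powers of `T - c` grow at a rate `q` strictly
  -- below the radius; `q / radius` is the ratio of the dominating geometric series.
  obtain ⟨C, q, hq0, hqr, hCq⟩ := exists_norm_pow_le (a := a) K.radius_pos (by
    intro z hz
    rw [ha, ← spectrum.sub_singleton_eq] at hz
    obtain ⟨w, hw, _, rfl, rfl⟩ := hz
    have := K.convexHull_subset (subset_convexHull ℝ _ hw)
    rwa [mem_ball_iff_norm] at this)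
  have hsphere : ∀ θ : ℝ, ‖circleMap c K.radius θ - c‖ = K.radius := fun θ => by
    simp [abs_of_pos K.radius_pos]
  have hbc : Continuous fun θ : ℝ => K.branch (circleMap c K.radius θ) :=
    K.continuousOn_branch.comp_continuous (continuous_circleMap c _)
      fun θ => circleMap_mem_closedBall _ K.radius_pos.le θ
  have hne : ∀ θ : ℝ, circleMap c K.radius θ - c ≠ 0 := fun θ =>
    norm_pos_iff.1 (by rw [hsphere]; exact K.radius_pos)
  have hinv : Continuous fun θ : ℝ => (circleMap c K.radius θ - c)⁻¹ :=
    ((continuous_circleMap c _).sub continuous_const).inv₀ hne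
  have hsum : HasSum (fun n : ℕ => ∮ z in C(c, K.radius),
        ((z - c)⁻¹ ^ n • (z - c)⁻¹ • K.branch z) • a ^ n)
      (∮ z in C(c, K.radius), K.branch z • resolvent T z) := by
    refine intervalIntegral.hasSum_integral_of_dominated_convergence
      (fun n θ => (C * ‖K.branch (circleMap c K.radius θ)‖) * (q / K.radius) ^ n)
      (fun n => ?_) (fun n => ?_) ?_ ?_ ?_
    · refine Continuous.aestronglyMeasurable ?_
      have : Continuous fun θ => deriv (circleMap c K.radius) θ := by
        simp only [deriv_circleMap]
        exact (continuous_circleMap 0 _).mul continuous_const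
      exact this.smul (((hinv.pow n).smul (hinv.smul hbc)).smul continuous_const)
    · refine Filter.Eventually.of_forall fun θ _ => ?_
      have hr := K.radius_pos
      rw [norm_smul, norm_smul, norm_smul, norm_smul, norm_pow, norm_inv, hsphere]
      have hder : ‖deriv (circleMap c K.radius) θ‖ = K.radius := by
        simp [abs_of_pos hr]
      rw [hder]
      calc K.radius * (K.radius⁻¹ ^ n * (K.radius⁻¹ * ‖K.branch (circleMap c K.radius θ)‖)
            * ‖a ^ n‖)
          = ‖K.branch (circleMap c K.radius θ)‖ * K.radius⁻¹ ^ n * ‖a ^ n‖ := by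
            field_simp
        _ ≤ ‖K.branch (circleMap c K.radius θ)‖ * K.radius⁻¹ ^ n * (C * q ^ n) := by
            gcongr
            exact hCq n
        _ = _ := by rw [div_pow, inv_pow]; field_simp
    · refine Filter.Eventually.of_forall fun θ _ => ?_
      exact (summable_geometric_of_lt_one (div_nonneg hq0.le K.radius_pos.le)
        ((div_lt_one K.radius_pos).2 hqr)).mul_left _
    · simp only [tsum_mul_left]
      exact ((continuous_const.mul hbc.norm).mul continuous_const).intervalIntegrable _ _
    · refine Filter.Eventually.of_forall fun θ _ => ?_
      refine HasSum.const_smul _ ?_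
      have := (hasSum_resolvent (T := T) (c := c) (z := circleMap c K.radius θ) hq0.le
        (by rwa [hsphere]) hCq).const_smul (K.branch (circleMap c K.radius θ))
      refine this.congr_fun fun n => ?_
      rw [smul_smul, ← ha]
      refine congrArg (· • a ^ n) ?_
      simp only [smul_eq_mul]
      ring
  have hsum2 := hsum.const_smul (2 * Real.pi * Complex.I : ℂ)⁻¹
  have hx : 1 - c⁻¹ • T = -c⁻¹ • a := by
    rw [ha, Algebra.algebraMap_eq_smul_one, smul_sub, smul_smul, neg_mul, inv_mul_cancel₀ hc0]
    rw [neg_smul, neg_smul, one_smul]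
    abel
  have hxn : ∀ n, (1 - c⁻¹ • T) ^ n = (-c⁻¹) ^ n • a ^ n := fun n => by rw [hx, smul_pow]
  have hr0 := K.radius_pos.trans K.radius_lt
  have hmer := hasSum_mercator (x := 1 - c⁻¹ • T) (C := C) (q := q / ‖c‖) (by positivity)
    ((div_lt_one hr0).2 (hqr.trans K.radius_lt)) (fun n => by
      rw [hxn, norm_smul, norm_pow, norm_neg, norm_inv, div_pow, inv_pow, ← mul_div_assoc,
        div_eq_inv_mul]
      gcongr
      exact hCq n)
  have hres := (hasSum_ite_eq 0 (K.branch c • (1 : E →L[ℂ] E))).sub hmer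
  refine HasSum.unique (f := fun n : ℕ => (if n = 0 then K.branch c • (1 : E →L[ℂ] E) else 0)
    - (n : ℂ)⁻¹ • (1 - c⁻¹ • T) ^ n) ?_ hres
  refine hsum2.congr_fun fun n => ?_
  rw [circleIntegral.integral_smul_const, ← smul_assoc, K.cauchyPowerSeries_coeff, hxn, sub_smul,
    smul_smul]
  congr 1
  rcases n.eq_zero_or_pos with rfl | hn
  · simp [← hc]
  · simp [hn.ne']

/-! ### Moving the base point of the Mercator series -/

theorem HasDerivAt.pow_of_commute {𝕜 R : Type*} [NontriviallyNormedField 𝕜] [NormedRing R]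
    [NormedAlgebra 𝕜 R] {f : 𝕜 → R} {f' : R} {s : 𝕜} (h : HasDerivAt f f' s)
    (hc : Commute (f s) f') (n : ℕ) :
    HasDerivAt (fun t => f t ^ n) (n • (f s ^ (n - 1) * f')) s := by
  induction n with
  | zero => simpa using hasDerivAt_const s (1 : R)
  | succ n ih =>
    simp only [pow_succ]
    refine (ih.fun_mul h).congr_deriv ?_
    rcases n with _ | n
    · simp
    · rw [Nat.add_sub_cancel, Nat.add_sub_cancel, succ_nsmul _ (n + 1), smul_mul_assoc, mul_assoc,
        ← hc.eq, ← mul_assoc, ← pow_succ]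

omit [CompleteSpace A] in
-- Binomial theorem for commuting elements. It extends geometric growth bounds from two points to
-- the line through them, slightly beyond the segment, without any bound on the norms of `x` and `y`
-- themselves.
theorem norm_pow_affine_le {x y : A} {C q : ℝ} (hq : 0 ≤ q)
    (hxy : Commute x y) (hx : ∀ n, ‖x ^ n‖ ≤ C * q ^ n) (hy : ∀ n, ‖y ^ n‖ ≤ C * q ^ n)
    (s t : ℂ) (n : ℕ) : ‖(s • x + t • y) ^ n‖ ≤ C ^ 2 * (q * (‖s‖ + ‖t‖)) ^ n := by
  have hC : 0 ≤ C := by simpa using (norm_nonneg _).trans (hx 0)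
  rw [((hxy.smul_left s).smul_right t).add_pow, mul_pow, add_pow, Finset.mul_sum, Finset.mul_sum]
  refine (norm_sum_le _ _).trans (Finset.sum_le_sum fun k hk => ?_)
  rw [← nsmul_eq_mul', smul_pow, smul_pow, smul_mul_smul_comm]
  refine (norm_nsmul_le).trans ?_
  have hk' : k + (n - k) = n := by
    have := Finset.mem_range.1 hk
    omega
  calc ((n.choose k : ℕ) : ℝ) * ‖(s ^ k * t ^ (n - k)) • (x ^ k * y ^ (n - k))‖
      ≤ n.choose k * (‖s‖ ^ k * ‖t‖ ^ (n - k) * ((C * q ^ k) * (C * q ^ (n - k)))) := by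
        rw [norm_smul, norm_mul, norm_pow, norm_pow]
        gcongr
        exact (norm_mul_le _ _).trans (mul_le_mul (hx _) (hy _) (norm_nonneg _) (by positivity))
    _ = _ := by
        have : q ^ n = q ^ k * q ^ (n - k) := by rw [← pow_add, hk']
        rw [this]
        ring

open Pointwise in
omit [CompleteSpace A] in
theorem norm_lt_one_of_mem_spectrum_one_sub_smul {T : A} {w : ℂ} (hw : w ≠ 0)
    (h : ∀ z ∈ spectrum ℂ T, ‖1 - w * z‖ < 1) :
    ∀ z ∈ spectrum ℂ (1 - w • T), ‖z‖ < 1 := by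
  intro z hz
  have h1 : (1 : A) = algebraMap ℂ A 1 := (map_one _).symm
  rw [h1, ← spectrum.singleton_sub_eq] at hz
  have h2 := spectrum.unit_smul_eq_smul T (Units.mk0 w hw)
  change spectrum ℂ (w • T) = w • spectrum ℂ T at h2
  rw [h2] at hz
  obtain ⟨_, rfl, _, ⟨v, hv, rfl⟩, rfl⟩ := hz
  exact h v hv

/-- Along the segment `γ` from `w₀` to `w₁` the Mercator series of `1 - γ T` has derivative `-(γ' /
γ) • 1`. It is offset by the scalar `log (γ z₀)`, where `z₀` is a point of the spectrum: the
hypotheses at `z₀` keep `γ z₀` near `1`, so the principal logarithm stays differentiable. -/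
theorem mercator_sub_mercator {T : A} (hne : (spectrum ℂ T).Nonempty) {w₀ w₁ : ℂ}
    (h₀ : ∀ z ∈ spectrum ℂ T, ‖1 - w₀ * z‖ < 1) (h₁ : ∀ z ∈ spectrum ℂ T, ‖1 - w₁ * z‖ < 1) :
    ∃ κ : ℂ, Complex.exp κ = w₁ / w₀ ∧
      mercator (1 - w₀ • T) - mercator (1 - w₁ • T) = κ • (1 : A) := by
  obtain ⟨z₀, hz₀⟩ := hne
  have hw₀ : w₀ ≠ 0 := by rintro rfl; simpa using h₀ _ hz₀
  have hw₁ : w₁ ≠ 0 := by rintro rfl; simpa using h₁ _ hz₀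
  obtain ⟨C₀, q₀, hq₀, hq₀', hb₀⟩ := exists_norm_pow_le zero_lt_one
    (norm_lt_one_of_mem_spectrum_one_sub_smul hw₀ h₀)
  obtain ⟨C₁, q₁, hq₁, hq₁', hb₁⟩ := exists_norm_pow_le zero_lt_one
    (norm_lt_one_of_mem_spectrum_one_sub_smul hw₁ h₁)
  set x₀ := 1 - w₀ • T with hx₀
  set x₁ := 1 - w₁ • T with hx₁
  obtain ⟨q, hq, hq1, e₀, e₁, e₂, e₃⟩ : ∃ q : ℝ, 0 < q ∧ q < 1 ∧ q₀ ≤ q ∧ q₁ ≤ q ∧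
      ‖1 - w₀ * z₀‖ ≤ q ∧ ‖1 - w₁ * z₀‖ ≤ q :=
    ⟨max (max q₀ q₁) (max ‖1 - w₀ * z₀‖ ‖1 - w₁ * z₀‖), by simp [hq₀], by
      simp [hq₀', hq₁', h₀ _ hz₀, h₁ _ hz₀], by simp, by simp, by simp, by simp⟩
  set C := max C₀ C₁
  have hC₀ : 0 ≤ C₀ := by simpa using (norm_nonneg _).trans (hb₀ 0)
  have hb₀' : ∀ n, ‖x₀ ^ n‖ ≤ C * q ^ n := fun n => (hb₀ n).trans (by
    gcongr; exact le_max_left _ _)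
  have hb₁' : ∀ n, ‖x₁ ^ n‖ ≤ C * q ^ n := fun n => (hb₁ n).trans (by
    have := hC₀.trans (le_max_left C₀ C₁)
    gcongr
    exact le_max_right _ _)
  obtain ⟨r, hqr, hr1⟩ := exists_between hq1
  have hr0 := hq.trans hqr
  -- Differentiation needs an open interval around `[0, 1]`. On it `|1 - s| + |s|` is at most `1 +
  -- 2ε`, and `ε` is chosen so that the growth rate is still `r < 1`.
  obtain ⟨ε, hε, hεr⟩ : ∃ ε > 0, q * (1 + 2 * ε) = r := ⟨(r / q - 1) / 2, by
    have := (one_lt_div hq).2 hqr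
    constructor
    · linarith
    · field_simp; ring⟩
  set U := Set.Ioo (-ε) (1 + ε) with hU
  have hUnorm : ∀ s ∈ U, ‖((1 - s : ℝ) : ℂ)‖ + ‖((s : ℝ) : ℂ)‖ ≤ 1 + 2 * ε := by
    intro s hs
    rw [Complex.norm_real, Complex.norm_real, Real.norm_eq_abs, Real.norm_eq_abs]
    rcases abs_cases (1 - s) with h | h <;> rcases abs_cases s with h' | h' <;>
      linarith [hs.1, hs.2]
  have hcomm : Commute x₀ x₁ := by
    refine Commute.sub_left (Commute.one_left _) (Commute.sub_right (Commute.one_right _) ?_)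
    exact ((Commute.refl T).smul_left _).smul_right _
  let γ : ℝ → ℂ := fun s => ((1 - s : ℝ) : ℂ) * w₀ + (s : ℂ) * w₁
  let x : ℝ → A := fun s => ((1 - s : ℝ) : ℂ) • x₀ + (s : ℂ) • x₁
  have hxγ : ∀ s, x s = 1 - γ s • T := fun s => by
    simp only [x, γ, hx₀, hx₁, smul_sub, add_smul, mul_smul]
    push_cast
    rw [sub_smul, one_smul, sub_smul]
    abel
  have hxb : ∀ s ∈ U, ∀ n, ‖x s ^ n‖ ≤ C ^ 2 * r ^ n := fun s hs n => by
    refine (norm_pow_affine_le hq.le hcomm hb₀' hb₁' _ _ n).trans ?_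
    have := hUnorm s hs
    rw [← hεr]
    gcongr
  have hγslit : ∀ s ∈ U, γ s * z₀ ∈ Complex.slitPlane := fun s hs => by
    apply Complex.mem_slitPlane_of_norm_lt_one (z := γ s * z₀ - 1) ?_ |> fun h => by simpa using h
    have : γ s * z₀ - 1 =
        -(((1 - s : ℝ) : ℂ) * (1 - w₀ * z₀) + (s : ℂ) * (1 - w₁ * z₀)) := by
      simp only [γ]; push_cast; ring
    rw [this, norm_neg]
    calc _ ≤ ‖((1 - s : ℝ) : ℂ)‖ * q + ‖(s : ℂ)‖ * q := by
            refine (norm_add_le _ _).trans ?_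
            rw [norm_mul, norm_mul]
            gcongr
      _ = q * (‖((1 - s : ℝ) : ℂ)‖ + ‖(s : ℂ)‖) := by ring
      _ ≤ q * (1 + 2 * ε) := mul_le_mul_of_nonneg_left (hUnorm s hs) hq.le
      _ < 1 := by rwa [hεr]
  have hγd : ∀ s, HasDerivAt γ (w₁ - w₀) s := fun s => by
    have h1 : HasDerivAt (fun s : ℝ => ((1 - s : ℝ) : ℂ)) (((-1 : ℝ)) : ℂ) s :=
      ((hasDerivAt_id s).const_sub 1).ofReal_comp
    have h2 : HasDerivAt (fun s : ℝ => (s : ℂ)) ((1 : ℝ) : ℂ) s := (hasDerivAt_id s).ofReal_comp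
    refine ((h1.mul_const w₀).fun_add (h2.mul_const w₁)).congr_deriv ?_
    push_cast; ring
  set x' : A := -((w₁ - w₀) • T) with hx'
  have hxd : ∀ s, HasDerivAt x x' s := fun s => by
    have : HasDerivAt (fun s => 1 - γ s • T) x' s := ((hγd s).smul_const T).const_sub 1
    exact this.congr_of_eventuallyEq (Filter.Eventually.of_forall hxγ)
  have hcx : ∀ s, Commute (x s) x' := fun s => by
    rw [hxγ, hx']
    refine Commute.sub_left (Commute.one_left _) (Commute.neg_right ?_)
    exact ((Commute.refl T).smul_left _).smul_right _
  have hterm : ∀ (n : ℕ) (s : ℝ), HasDerivAt (fun s => (n : ℂ)⁻¹ • x s ^ n)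
      ((n : ℂ)⁻¹ • n • (x s ^ (n - 1) * x')) s := fun n s =>
    (HasDerivAt.pow_of_commute (hxd s) (hcx s) n).fun_const_smul _
  have hcancel : ∀ (n : ℕ) (a : A), ((n + 1 : ℕ) : ℂ)⁻¹ • (n + 1) • a = a := fun n a => by
    rw [← Nat.cast_smul_eq_nsmul ℂ, smul_smul, inv_mul_cancel₀, one_smul]
    exact_mod_cast n.succ_ne_zero
  have hbound : ∀ (n : ℕ) (s : ℝ), s ∈ U →
      ‖(n : ℂ)⁻¹ • n • (x s ^ (n - 1) * x')‖ ≤ C ^ 2 * ‖x'‖ * r ^ (n - 1) := by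
    intro n s hs
    rcases n with _ | n
    · simp only [zero_smul, smul_zero, norm_zero]; positivity
    · rw [hcancel, Nat.add_sub_cancel]
      calc _ ≤ (C ^ 2 * r ^ n) * ‖x'‖ :=
            (norm_mul_le _ _).trans (mul_le_mul_of_nonneg_right (hxb s hs n) (norm_nonneg _))
        _ = _ := by ring
  have hsumb : Summable fun n : ℕ => C ^ 2 * ‖x'‖ * r ^ (n - 1) := by
    refine Summable.mul_left _ ((summable_nat_add_iff 1).1 ?_)
    simpa using summable_geometric_of_lt_one hr0.le hr1
  have hUo : IsOpen U := isOpen_Ioo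
  have hUp : IsPreconnected U := isPreconnected_Ioo
  have h0U : (0 : ℝ) ∈ U := ⟨by linarith, by linarith⟩
  have h1U : (1 : ℝ) ∈ U := ⟨by linarith, by linarith⟩
  have hφ : ∀ s ∈ U, HasDerivAt (fun s => mercator (x s))
      (∑' n : ℕ, (n : ℂ)⁻¹ • n • (x s ^ (n - 1) * x')) s := fun s hs =>
    hasDerivAt_tsum_of_isPreconnected hsumb hUo hUp (fun n s _ => hterm n s) hbound h0U
      (hasSum_mercator hr0.le hr1 (hxb 0 h0U)).summable hs
  have hγ0 : ∀ s ∈ U, γ s ≠ 0 := fun s hs h => by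
    have := hγslit s hs
    rw [h, zero_mul] at this
    exact Complex.zero_notMem_slitPlane this
  have hval : ∀ s ∈ U, ∑' n : ℕ, (n : ℂ)⁻¹ • n • (x s ^ (n - 1) * x') =
      -((w₁ - w₀) / γ s) • (1 : A) := by
    intro s hs
    have hgs : Summable fun n => x s ^ n := Summable.of_norm_bounded
      ((summable_geometric_of_lt_one hr0.le hr1).mul_left (C ^ 2)) (hxb s hs)
    have hall : Summable fun n : ℕ => (n : ℂ)⁻¹ • n • (x s ^ (n - 1) * x') :=
      Summable.of_norm_bounded hsumb (fun n => hbound n s hs)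
    rw [hall.tsum_eq_zero_add]
    simp only [hcancel, Nat.add_sub_cancel, zero_smul, smul_zero, zero_add]
    rw [hgs.tsum_mul_right]
    have h1 := hgs.tsum_pow_mul_one_sub
    -- The derivative is a scalar multiple of `1 - x s`, which cancels against the geometric series;
    -- no inverse of `T` is required.
    have h2 : x' = (-((w₁ - w₀) / γ s)) • (1 - x s) := by
      rw [hxγ, sub_sub_cancel, smul_smul, hx', neg_mul, div_mul_cancel₀ _ (hγ0 s hs), neg_smul]
    rw [h2, mul_smul_comm, h1]
  set ψ : ℝ → A := fun s => mercator (x s) + Complex.log (γ s * z₀) • (1 : A) with hψ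
  have hz₀0 : z₀ ≠ 0 := by
    rintro rfl
    simpa using h₀ _ hz₀
  have hψd : ∀ s ∈ U, HasDerivAt ψ 0 s := fun s hs => by
    have h1 := ((hγd s).mul_const z₀).clog_real (hγslit s hs)
    have h2 := (hφ s hs).add (h1.smul_const (1 : A))
    refine h2.congr_deriv ?_
    rw [hval s hs, ← add_smul, mul_div_mul_right _ _ hz₀0, neg_add_cancel, zero_smul]
  have hconst := hUo.is_const_of_deriv_eq_zero hUp
    (fun s hs => (hψd s hs).differentiableAt.differentiableWithinAt)
    (fun s hs => (hψd s hs).deriv) h0U h1U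
  have hγ0' : γ 0 = w₀ := by simp [γ]
  have hγ1' : γ 1 = w₁ := by simp [γ]
  have hx0' : x 0 = x₀ := by simp [x]
  have hx1' : x 1 = x₁ := by simp [x]
  simp only [hψ, hγ0', hγ1', hx0', hx1'] at hconst
  refine ⟨Complex.log (w₁ * z₀) - Complex.log (w₀ * z₀), ?_, ?_⟩
  · rw [Complex.exp_sub, Complex.exp_log (mul_ne_zero hw₁ hz₀0),
      Complex.exp_log (mul_ne_zero hw₀ hz₀0), mul_div_mul_right _ _ hz₀0]
  · rw [sub_smul, sub_eq_sub_iff_add_eq_add, hconst, add_comm]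

/-- Disc and branch survive only in the scalar `κ`, and only up to `2πi ℤ`. The base point `w⁻¹` is
at the user's disposal: `w = 1` if there are edges, `w = (1 - u²)⁻¹` if there are none. -/
theorem LogContour.exists_log_eq [CompleteSpace E] {T : E →L[ℂ] E} (K : LogContour T) {w : ℂ}
    (hw : w ≠ 0) (h : ∀ z ∈ spectrum ℂ T, ‖1 - w * z‖ < 1) :
    ∃ κ : ℂ, Complex.exp κ = w⁻¹ ∧ K.log = κ • (1 : E →L[ℂ] E) - mercator (1 - w • T) := by
  rcases subsingleton_or_nontrivial E with hE | hE
  · refine ⟨Complex.log w⁻¹, Complex.exp_log (inv_ne_zero hw), ?_⟩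
    ext v
    exact Subsingleton.elim _ _
  have hc0 := K.center_ne_zero
  obtain ⟨κ, hκ, hlog⟩ := mercator_sub_mercator (spectrum.nonempty T) h (w₁ := K.center⁻¹) (by
    intro z hz
    have h1 := K.convexHull_subset (subset_convexHull ℝ _ hz)
    rw [mem_ball_iff_norm] at h1
    have h2 : 1 - K.center⁻¹ * z = -((z - K.center) / K.center) := by field_simp; ring
    rw [h2, norm_neg, norm_div, div_lt_one (norm_pos_iff.2 hc0)]
    exact h1.trans K.radius_lt)
  refine ⟨K.branch K.center + κ, ?_, ?_⟩
  · rw [Complex.exp_add, hκ, K.exp_branch _ (Metric.mem_closedBall_self K.radius_pos.le)]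
    field_simp
  · rw [K.log_eq_mercator, add_smul, ← hlog]
    abel

end FunctionalCalculus

/-! ## Operators on `ℓ²(V)` -/

section HilbertSpace

variable {V : Type*}

theorem norm_boundedOperator_le {L : (V → ℂ) →ₗ[ℂ] (V → ℂ)} {C : ℝ} {hC : 0 ≤ C}
    {h : ∀ (f : ℓ²(V, ℂ)) (s : Finset V), ∑ v ∈ s, ‖L (⇑f) v‖ ^ 2 ≤ (C * ‖f‖) ^ 2} :
    ‖boundedOperator L C hC h‖ ≤ C :=
  LinearMap.mkContinuous_norm_le _ hC _

open Classical in
theorem coe_lp_single (x : V) (c : ℂ) :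
    ⇑(lp.single 2 x c : ℓ²(V, ℂ)) = Pi.single x c := by
  funext y
  exact lp.single_apply (E := fun _ : V => ℂ) 2 x c y

theorem norm_entry_le (T : ℓ²(V, ℂ) →L[ℂ] ℓ²(V, ℂ)) (x y : V) : ‖entry T x y‖ ≤ ‖T‖ := by
  classical
  refine (lp.norm_apply_le_norm (by norm_num) _ x).trans ((T.le_opNorm _).trans ?_)
  rw [lp.norm_single (by norm_num)]
  simp

/-- The trace as a continuous linear functional. -/
noncomputable def traceCLM (F : Finset V) : (ℓ²(V, ℂ) →L[ℂ] ℓ²(V, ℂ)) →L[ℂ] ℂ :=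
  LinearMap.mkContinuous
    { toFun := trace F
      map_add' := fun S T => by
        rw [trace, trace, trace, ← Finset.sum_add_distrib]; rfl
      map_smul' := fun c T => by
        rw [RingHom.id_apply, trace, trace, Finset.smul_sum]; rfl }
    F.card (fun T => (norm_sum_le _ _).trans (by
      refine (Finset.sum_le_sum fun x _ => norm_entry_le T x x).trans ?_
      rw [Finset.sum_const, nsmul_eq_mul]))

theorem traceCLM_apply (F : Finset V) (T : ℓ²(V, ℂ) →L[ℂ] ℓ²(V, ℂ)) :
    traceCLM F T = trace F T := rfl

theorem traceCLM_one (F : Finset V) : traceCLM F 1 = F.card := by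
  classical
  rw [traceCLM_apply, trace, Finset.card_eq_sum_ones, Nat.cast_sum]
  refine Finset.sum_congr rfl fun x _ => ?_
  change (lp.single 2 x (1 : ℂ) : ℓ²(V, ℂ)) x = _
  rw [coe_lp_single]
  simp

/-- Operators that act as matrices have the traces of these matrices. -/
theorem traceCLM_eq_vertexTrace (F : Finset V) {T : ℓ²(V, ℂ) →L[ℂ] ℓ²(V, ℂ)}
    {L : Module.End ℂ (V → ℂ)} (h : ∀ f : ℓ²(V, ℂ), ⇑(T f) = L ⇑f) :
    traceCLM F T = vertexTrace F L := by
  classical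
  refine Finset.sum_congr rfl fun x _ => ?_
  rw [entry, h]
  congr 2

variable {X : SimpleGraph V}

open Classical in
theorem translation_single (γ : X ≃g X) (x : V) :
    translation γ (lp.single 2 x (1 : ℂ)) = lp.single 2 (γ • x) 1 := by
  apply lp.ext
  funext y
  rw [translation_apply, coe_lp_single, coe_lp_single]
  simp only [Pi.single_apply, inv_smul_eq_iff]

theorem entry_smul {Γ : Subgroup (X ≃g X)} {T : ℓ²(V, ℂ) →L[ℂ] ℓ²(V, ℂ)}
    (hT : T ∈ invariantAlgebra Γ) {γ : X ≃g X} (hγ : γ ∈ Γ) (x y : V) :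
    entry T (γ • x) (γ • y) = entry T x y := by
  classical
  have h := DFunLike.congr_fun ((mem_invariantAlgebra_iff Γ T).1 hT γ hγ) (lp.single 2 y (1 : ℂ))
  change translation γ (T _) = T (translation γ _) at h
  rw [translation_single] at h
  have h1 := congrFun (congrArg (fun f : ℓ²(V, ℂ) => ⇑f) h) (γ • x)
  simp only [translation_apply, inv_smul_smul] at h1
  exact h1.symm

variable [X.LocallyFinite] (hd : BddAbove (Set.range fun v => X.degree v))

theorem coe_adjOperator (f : ℓ²(V, ℂ)) : ⇑(adjOperator hd f) = adjLinear X ⇑f := rfl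

theorem coe_degOperator (f : ℓ²(V, ℂ)) : ⇑(degOperator hd f) = degLinear X ⇑f := rfl

theorem adjOperator_mem (Γ : Subgroup (X ≃g X)) : adjOperator hd ∈ invariantAlgebra Γ := by
  rw [mem_invariantAlgebra_iff]
  intro γ _
  refine ContinuousLinearMap.ext fun f => lp.ext (funext fun x => ?_)
  exact (sum_neighborFinset_smul γ⁻¹ x ⇑f).symm

theorem degree_smul (γ : X ≃g X) (x : V) : X.degree (γ • x) = X.degree x := by
  have := sum_neighborFinset_smul γ x (fun _ => (1 : ℂ))
  simp only [Finset.sum_const, SimpleGraph.card_neighborFinset_eq_degree, nsmul_eq_mul,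
    mul_one] at this
  exact_mod_cast this.symm

theorem degOperator_mem (Γ : Subgroup (X ≃g X)) : degOperator hd ∈ invariantAlgebra Γ := by
  rw [mem_invariantAlgebra_iff]
  intro γ _
  refine ContinuousLinearMap.ext fun f => lp.ext (funext fun x => ?_)
  change ((X.degree (γ⁻¹ • x) : ℂ) - 1) * f (γ⁻¹ • x) = ((X.degree x : ℂ) - 1) * f (γ⁻¹ • x)
  rw [degree_smul]

/-- `B(u) = A u - Q u²`, so that `Δ(u) = 1 - B(u)`. -/
noncomputable def perturbation (u : ℂ) : ℓ²(V, ℂ) →L[ℂ] ℓ²(V, ℂ) :=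
  u • adjOperator hd - u ^ 2 • degOperator hd

theorem one_sub_perturbation (u : ℂ) : 1 - perturbation hd u = deformedLaplacian hd u := by
  rw [perturbation, deformedLaplacian]; abel

omit [X.LocallyFinite] in
theorem smul_mem_invariantAlgebra {Γ : Subgroup (X ≃g X)} {T : ℓ²(V, ℂ) →L[ℂ] ℓ²(V, ℂ)}
    (c : ℂ) (hT : T ∈ invariantAlgebra Γ) : c • T ∈ invariantAlgebra Γ := by
  rw [mem_invariantAlgebra_iff] at hT ⊢
  intro γ hγ
  rw [mul_smul_comm, smul_mul_assoc, hT γ hγ]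

theorem perturbation_mem (Γ : Subgroup (X ≃g X)) (u : ℂ) :
    perturbation hd u ∈ invariantAlgebra Γ :=
  sub_mem (smul_mem_invariantAlgebra u (adjOperator_mem hd Γ))
    (smul_mem_invariantAlgebra (u ^ 2) (degOperator_mem hd Γ))

theorem deformedLaplacian_mem (Γ : Subgroup (X ≃g X)) (u : ℂ) :
    deformedLaplacian hd u ∈ invariantAlgebra Γ := by
  rw [← one_sub_perturbation]
  exact sub_mem (one_mem _) (perturbation_mem hd Γ u)

/-! ### Commutation under the trace -/

section

variable {Γ : Subgroup (X ≃g X)} {F : Finset V}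
    (hfree : ∀ γ ∈ Γ, ∀ v : V, γ • v = v → γ = 1)
    (hF : ∀ v : V, ∃! x, x ∈ F ∧ x ∈ MulAction.orbit Γ v)
    {T : ℓ²(V, ℂ) →L[ℂ] ℓ²(V, ℂ)} (hT : T ∈ invariantAlgebra Γ)

include hfree hF hT in
-- The two sides are the sums of `T(y, x)` and of `T(x, y)` over the edges leaving `F`. Commutation
-- with `A` and `Q` suffices throughout, so the trace property on the whole algebra is not needed.
theorem traceCLM_adjOperator_comm :
    traceCLM F (adjOperator hd * T) = traceCLM F (T * adjOperator hd) := by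
  classical
  have h1 : ∀ x : V, adjOperator hd (lp.single 2 x (1 : ℂ)) =
      ∑ y ∈ X.neighborFinset x, lp.single 2 y (1 : ℂ) := fun x => by
    apply lp.ext
    funext z
    rw [coe_adjOperator, coe_lp_single, lp.coeFn_sum, Finset.sum_apply]
    simp only [coe_lp_single]
    change ∑ w ∈ X.neighborFinset z, (Pi.single x (1 : ℂ) : V → ℂ) w = _
    simp only [Pi.single_apply, Finset.sum_ite_eq, Finset.sum_ite_eq',
      SimpleGraph.mem_neighborFinset, X.adj_comm]
  refine Eq.trans ?_ ((sum_edges_flip hfree hF (fun γ hγ x y => entry_smul hT hγ x y)).symm.trans ?_)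
  · rfl
  · refine Finset.sum_congr rfl fun x _ => ?_
    rw [entry, mul_apply_eq_comp, h1, map_sum, lp.coeFn_sum, Finset.sum_apply]
    rfl

theorem traceCLM_degOperator_comm (T : ℓ²(V, ℂ) →L[ℂ] ℓ²(V, ℂ)) :
    traceCLM F (degOperator hd * T) = traceCLM F (T * degOperator hd) := by
  classical
  refine Finset.sum_congr rfl fun x _ => ?_
  have h1 : degOperator hd (lp.single 2 x (1 : ℂ)) =
      ((X.degree x : ℂ) - 1) • lp.single 2 x (1 : ℂ) := by
    apply lp.ext
    funext z
    rw [coe_degOperator, lp.coeFn_smul, coe_lp_single, Pi.smul_apply, smul_eq_mul]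
    change ((X.degree z : ℂ) - 1) * _ = _
    rcases eq_or_ne z x with rfl | h
    · rfl
    · rw [Pi.single_eq_of_ne h, mul_zero, mul_zero]
  rw [entry, entry, mul_apply_eq_comp, mul_apply_eq_comp, h1, map_smul,
    lp.coeFn_smul]
  rfl

include hfree hF hT in
theorem traceCLM_perturbation_comm (u : ℂ) :
    traceCLM F (perturbation hd u * T) = traceCLM F (T * perturbation hd u) := by
  rw [perturbation, sub_mul, mul_sub, map_sub, map_sub, smul_mul_assoc, smul_mul_assoc,
    mul_smul_comm, mul_smul_comm, map_smul, map_smul, map_smul, map_smul,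
    traceCLM_adjOperator_comm hd hfree hF hT, traceCLM_degOperator_comm]

end

/-! ### Walks without backtracking -/

/-- The operator that counts walks of length `k + 1` without backtracking. -/
noncomputable def nbOperator : ℕ → (ℓ²(V, ℂ) →L[ℂ] ℓ²(V, ℂ))
  | 0 => adjOperator hd
  | 1 => adjOperator hd * adjOperator hd - (degOperator hd + 1)
  | k + 2 => adjOperator hd * nbOperator (k + 1) - degOperator hd * nbOperator k

theorem nbOperator_add_two (k : ℕ) : nbOperator hd (k + 2) =
    adjOperator hd * nbOperator hd (k + 1) - degOperator hd * nbOperator hd k := by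
  rw [nbOperator]

/-- The recurrence makes the operators bounded by construction, while the matrices carry the count
of walks; both obey the same recurrence. -/
theorem coe_nbOperator (k : ℕ) (f : ℓ²(V, ℂ)) : ⇑(nbOperator hd k f) = nbMatrix X k ⇑f := by
  induction k using Nat.twoStepInduction with
  | zero => rfl
  | one => rw [nbMatrix_one]; rfl
  | more k ih ih' =>
    rw [nbMatrix_add_two, nbOperator_add_two]
    change adjLinear X ⇑(nbOperator hd (k + 1) f) - degLinear X ⇑(nbOperator hd k f) = _
    rw [ih, ih']
    rfl

section

variable {Γ : Subgroup (X ≃g X)} {F : Finset V}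
    (hfree : ∀ γ ∈ Γ, ∀ v : V, γ • v = v → γ = 1)
    (hF : ∀ v : V, ∃! x, x ∈ F ∧ x ∈ MulAction.orbit Γ v)

include hfree hF in
/-- The numbers of reduced closed paths in terms of traces on vertices. -/
theorem card_closedWalks_recurrence :
    ((closedWalks X F 1).card : ℂ) = traceCLM F (nbOperator hd 0) ∧
    ((closedWalks X F 2).card : ℂ) = traceCLM F (nbOperator hd 1) ∧
    ∀ k, ((closedWalks X F (k + 3)).card : ℂ) = traceCLM F (nbOperator hd (k + 2)) -
      traceCLM F (degOperator hd * nbOperator hd k) + (closedWalks X F (k + 1)).card := by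
  have h : ∀ k, traceCLM F (nbOperator hd k) = vertexTrace F (nbMatrix X k) := fun k =>
    traceCLM_eq_vertexTrace F (coe_nbOperator hd k)
  have h' : ∀ k, traceCLM F (degOperator hd * nbOperator hd k) =
      vertexTrace F (degLinear X * nbMatrix X k) := fun k =>
    traceCLM_eq_vertexTrace F fun f => by
      rw [mul_apply_eq_comp, coe_degOperator, coe_nbOperator]; rfl
  simp only [← edgeTrace_nbTransfer_pow, h, h']
  exact ⟨edgeTrace_nbTransfer_one, edgeTrace_nbTransfer_two hfree hF,
    edgeTrace_nbTransfer_add_three hfree hF⟩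

end

theorem traceCLM_degOperator (F : Finset V) :
    traceCLM F (degOperator hd) = ∑ x ∈ F, (X.degree x : ℂ) - F.card := by
  classical
  rw [Finset.card_eq_sum_ones, Nat.cast_sum, ← Finset.sum_sub_distrib, traceCLM_apply, trace]
  refine Finset.sum_congr rfl fun x _ => ?_
  rw [entry, coe_degOperator, coe_lp_single]
  change ((X.degree x : ℂ) - 1) * (Pi.single x (1 : ℂ) : V → ℂ) x = _
  simp

/-! ### Norms -/

theorem norm_adjOperator_le : ‖adjOperator hd‖ ≤ supDegree X := norm_boundedOperator_le

omit [X.LocallyFinite] in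
theorem opNorm_le_of_pointwise {T : ℓ²(V, ℂ) →L[ℂ] ℓ²(V, ℂ)} {C : ℝ} (hC : 0 ≤ C)
    (h : ∀ f v, ‖T f v‖ ≤ C * ‖f v‖) : ‖T‖ ≤ C := by
  refine ContinuousLinearMap.opNorm_le_bound _ hC fun f => ?_
  refine lp.norm_le_of_forall_sum_le (by norm_num) (by positivity) fun s => ?_
  have h2 : ∑ v ∈ s, ‖T f v‖ ^ 2 ≤ (C * ‖f‖) ^ 2 := by
    calc ∑ v ∈ s, ‖T f v‖ ^ 2 ≤ ∑ v ∈ s, C ^ 2 * ‖f v‖ ^ 2 := by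
          refine Finset.sum_le_sum fun v _ => ?_
          rw [← mul_pow]
          gcongr
          exact h f v
      _ ≤ _ := by
          rw [← Finset.mul_sum, mul_pow]
          gcongr
          exact sum_sq_le f s
  simpa using h2

/-- An isolated vertex contributes the entry `-1`, of modulus `1`; this is where `1 ≤ supDegree X`
enters. -/
theorem norm_degOperator_le (h1 : 1 ≤ supDegree X) : ‖degOperator hd‖ ≤ supDegree X := by
  refine opNorm_le_of_pointwise (by positivity) fun f v => ?_
  rw [coe_degOperator]
  change ‖((X.degree v : ℂ) - 1) * f v‖ ≤ _
  rw [norm_mul]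
  gcongr
  have h3 : ((X.degree v : ℂ) - 1) = (((X.degree v : ℝ) - 1 : ℝ) : ℂ) := by push_cast; rfl
  rw [h3, Complex.norm_real, Real.norm_eq_abs, abs_le]
  have h4 : (X.degree v : ℝ) ≤ supDegree X := by exact_mod_cast degree_le_supDegree hd v
  have h5 : (1 : ℝ) ≤ supDegree X := by exact_mod_cast h1
  have h6 : (0 : ℝ) ≤ X.degree v := by positivity
  constructor <;> linarith

theorem norm_degOperator_add_one_le : ‖degOperator hd + 1‖ ≤ supDegree X := by
  refine opNorm_le_of_pointwise (by positivity) fun f v => ?_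
  have h : (degOperator hd + 1) f v = X.degree v * f v := by
    change ((X.degree v : ℂ) - 1) * f v + f v = _
    ring
  rw [h, norm_mul, Complex.norm_natCast]
  gcongr
  exact degree_le_supDegree hd v

/-- This quadratic equation is the only property of the closed formula that the estimates use, apart
from `d ≤ α`. -/
theorem alpha_sq : alpha X ^ 2 = supDegree X * alpha X + supDegree X := by
  have h := Real.sq_sqrt (show (0 : ℝ) ≤ (supDegree X : ℝ) ^ 2 + 4 * supDegree X by positivity)
  rw [alpha]
  linear_combination h / 4

theorem supDegree_le_alpha : (supDegree X : ℝ) ≤ alpha X := by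
  have h : (supDegree X : ℝ) ≤ √((supDegree X : ℝ) ^ 2 + 4 * supDegree X) :=
    Real.le_sqrt_of_sq_le (by have : (0 : ℝ) ≤ supDegree X := by positivity
                              linarith)
  rw [alpha]
  linarith

/-- The norms satisfy the recurrence with coefficients `d` and `d`, whose characteristic equation is
`x² = d x + d`. -/
theorem norm_nbOperator_le (h1 : 1 ≤ supDegree X) (k : ℕ) :
    ‖nbOperator hd k‖ ≤ alpha X ^ (k + 1) := by
  have hA := norm_adjOperator_le hd
  have hQ := norm_degOperator_le hd h1
  have hα := supDegree_le_alpha (X := X)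
  have hα2 := alpha_sq (X := X)
  have hd0 : (1 : ℝ) ≤ supDegree X := by exact_mod_cast h1
  induction k using Nat.twoStepInduction with
  | zero => rw [zero_add, pow_one]; exact hA.trans hα
  | one =>
    have h2 : nbOperator hd 1 = adjOperator hd * adjOperator hd - (degOperator hd + 1) := rfl
    rw [h2]
    calc _ ≤ ‖adjOperator hd‖ * ‖adjOperator hd‖ + ‖degOperator hd + 1‖ :=
          (norm_sub_le _ _).trans (add_le_add (norm_mul_le _ _) le_rfl)
      _ ≤ supDegree X * alpha X + supDegree X := by
          gcongr
          · exact hA.trans hα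
          · exact norm_degOperator_add_one_le hd
      _ = _ := by rw [← hα2]
  | more k ih ih' =>
    rw [nbOperator_add_two]
    calc _ ≤ ‖adjOperator hd‖ * ‖nbOperator hd (k + 1)‖ + ‖degOperator hd‖ * ‖nbOperator hd k‖ :=
          (norm_sub_le _ _).trans (add_le_add (norm_mul_le _ _) (norm_mul_le _ _))
      _ ≤ supDegree X * alpha X ^ (k + 1 + 1) + supDegree X * alpha X ^ (k + 1) := by
          gcongr
      _ = alpha X ^ (k + 1) * (supDegree X * alpha X + supDegree X) := by ring
      _ = alpha X ^ (k + 2 + 1) := by rw [← hα2]; ring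

end HilbertSpace

/-! ## The logarithm of the determinant as a generating function -/

section Analytic

theorem hasDerivAt_tsum_pow_div {N : ℕ → ℂ} {M r : ℝ} {u : ℂ} (hr : 0 ≤ r) (hu : r * ‖u‖ < 1)
    (hN : ∀ m, ‖N m‖ ≤ M * r ^ m) :
    (Summable fun k : ℕ => N (k + 1) * u ^ k) ∧
    HasDerivAt (fun u : ℂ => ∑' m : ℕ, N m * (u ^ m / m)) (∑' k : ℕ, N (k + 1) * u ^ k) u := by
  obtain ⟨ρ, hρu, hρ⟩ : ∃ ρ, ‖u‖ < ρ ∧ r * ρ < 1 := by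
    rcases hr.eq_or_lt with rfl | h
    · exact ⟨‖u‖ + 1, by simp, by simp⟩
    · obtain ⟨ρ, h1, h2⟩ := exists_between ((lt_div_iff₀' h).2 hu)
      exact ⟨ρ, h1, (lt_div_iff₀' h).1 h2⟩
  have hρ0 : 0 ≤ ρ := (norm_nonneg _).trans hρu.le
  have hpow : ∀ v ∈ Metric.ball (0 : ℂ) ρ, ∀ k : ℕ, ‖N (k + 1) * v ^ k‖ ≤ M * r * (r * ρ) ^ k := by
    intro v hv k
    have hv' := (mem_ball_zero_iff.1 hv).le
    rw [norm_mul, norm_pow]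
    calc _ ≤ (M * r ^ (k + 1)) * ρ ^ k := by
          gcongr
          · exact (norm_nonneg _).trans (hN (k + 1))
          · exact hN (k + 1)
      _ = _ := by ring
  have hsum := (summable_geometric_of_lt_one (by positivity) hρ).mul_left (M * r)
  have huU : u ∈ Metric.ball (0 : ℂ) ρ := mem_ball_zero_iff.2 hρu
  refine ⟨Summable.of_norm_bounded hsum (hpow u huU), ?_⟩
  have hterm : ∀ (k : ℕ) (v : ℂ), HasDerivAt (fun v : ℂ => N (k + 1) * (v ^ (k + 1) / (k + 1 : ℕ)))
      (N (k + 1) * v ^ k) v := by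
    intro k v
    have hk : ((k + 1 : ℕ) : ℂ) ≠ 0 := by exact_mod_cast k.succ_ne_zero
    refine (((hasDerivAt_pow (k + 1) v).div_const _).const_mul _).congr_deriv ?_
    rw [Nat.add_sub_cancel, mul_div_cancel_left₀ _ hk]
  have h0 : (0 : ℂ) ∈ Metric.ball (0 : ℂ) ρ :=
    Metric.mem_ball_self ((norm_nonneg _).trans_lt hρu)
  have h0s : Summable fun k : ℕ => N (k + 1) * ((0 : ℂ) ^ (k + 1) / (k + 1 : ℕ)) := by simp
  have hpre := (convex_ball (0 : ℂ) ρ).isPreconnected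
  have hmain : HasDerivAt (fun v : ℂ => ∑' k : ℕ, N (k + 1) * (v ^ (k + 1) / (k + 1 : ℕ)))
      (∑' k : ℕ, N (k + 1) * u ^ k) u :=
    hasDerivAt_tsum_of_isPreconnected (g' := fun k v => N (k + 1) * v ^ k) hsum Metric.isOpen_ball
      hpre (fun k v _ => hterm k v) (fun k v hv => hpow v hv k) h0 h0s huU
  have hsumm : ∀ v ∈ Metric.ball (0 : ℂ) ρ,
      Summable fun k : ℕ => N (k + 1) * (v ^ (k + 1) / (k + 1 : ℕ)) := fun v hv => by
    refine Summable.of_norm_bounded (hsum.mul_left ‖v‖) fun k => ?_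
    have h1 : N (k + 1) * (v ^ (k + 1) / (k + 1 : ℕ)) =
        v * (N (k + 1) * v ^ k) * ((k + 1 : ℕ) : ℂ)⁻¹ := by rw [pow_succ]; ring
    rw [h1, norm_mul, norm_mul, norm_inv, Complex.norm_natCast]
    refine (mul_le_of_le_one_right (by positivity) (inv_le_one_of_one_le₀ ?_)).trans ?_
    · exact_mod_cast Nat.succ_pos k
    · exact mul_le_mul_of_nonneg_left (hpow v hv k) (norm_nonneg _)
  refine hmain.congr_of_eventuallyEq ?_
  filter_upwards [Metric.isOpen_ball.mem_nhds huU] with v hv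
  -- The term `m = 0` is divided by `0`, hence zero, so the series agrees with its shift.
  have hs : Summable fun m : ℕ => N m * (v ^ m / m) := (summable_nat_add_iff 1).1 (hsumm v hv)
  rw [hs.tsum_eq_zero_add]
  simp

/-- The factor `1 - u²` implements the difference `N (k + 3) - N (k + 1)`. The initial values `r1`
and `r2` are such that no boundary terms are left over. -/
theorem tsum_mul_one_sub_sq_of_recurrence {b c N : ℕ → ℂ} {u : ℂ}
    (hb : Summable fun k => u ^ (k + 1) * b k) (hc : Summable fun k => u ^ (k + 1) * c k)
    (hN : Summable fun k => N (k + 1) * u ^ k) (r1 : N 1 = b 0) (r2 : N 2 = b 1)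
    (r3 : ∀ k, N (k + 3) = b (k + 2) - c k + N (k + 1)) :
    u * (∑' k, N (k + 1) * u ^ k) * (1 - u ^ 2) =
      ∑' k, u ^ (k + 1) * b k - u ^ 2 * ∑' k, u ^ (k + 1) * c k := by
  have e1 : ∑' k, u ^ (k + 1) * b k =
      u * b 0 + (u ^ 2 * b 1 + ∑' k, u ^ (k + 3) * b (k + 2)) := by
    rw [hb.tsum_eq_zero_add, ((summable_nat_add_iff 1).2 hb).tsum_eq_zero_add]
    norm_num
  have e2 : ∑' k, N (k + 1) * u ^ k =
      N 1 + (N 2 * u + ∑' k, N (k + 3) * u ^ (k + 2)) := by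
    rw [hN.tsum_eq_zero_add, ((summable_nat_add_iff 1).2 hN).tsum_eq_zero_add]
    norm_num
  have e3 : u * ∑' k, N (k + 3) * u ^ (k + 2) = ∑' k, u ^ (k + 3) * b (k + 2) -
      u ^ 2 * ∑' k, u ^ (k + 1) * c k + u ^ 3 * ∑' k, N (k + 1) * u ^ k := by
    have hb2 : Summable fun k => u ^ (k + 3) * b (k + 2) := (summable_nat_add_iff 2).2 hb
    rw [← tsum_mul_left, ← tsum_mul_left, ← tsum_mul_left,
      ← hb2.tsum_sub (hc.mul_left _),
      ← (hb2.sub (hc.mul_left _)).tsum_add (hN.mul_left _)]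
    refine tsum_congr fun k => ?_
    rw [r3 k]
    ring
  rw [r1, r2] at e2
  linear_combination u * e2 + e3 - e1

/-! ### Bounds for `A u - Q u²` and the derivative of the trace of its logarithm series -/

variable {V : Type*} {X : SimpleGraph V} [X.LocallyFinite]
    (hd : BddAbove (Set.range fun v => X.degree v))

omit [X.LocallyFinite] in
theorem norm_pow_clm_le {T : ℓ²(V, ℂ) →L[ℂ] ℓ²(V, ℂ)} {q : ℝ} (h : ‖T‖ ≤ q) (n : ℕ) :
    ‖T ^ n‖ ≤ q ^ n := by
  induction n with
  | zero => exact ContinuousLinearMap.norm_id_le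
  | succ n ih =>
    rw [pow_succ, pow_succ]
    exact (norm_mul_le _ _).trans (mul_le_mul ih h (norm_nonneg _)
      ((norm_nonneg _).trans ih))

theorem norm_perturbation_le (h1 : 1 ≤ supDegree X) {u : ℂ} {ρ : ℝ} (hu : ‖u‖ ≤ ρ) :
    ‖perturbation hd u‖ ≤ supDegree X * ρ + supDegree X * ρ ^ 2 := by
  have hρ : 0 ≤ ρ := (norm_nonneg _).trans hu
  calc ‖perturbation hd u‖ ≤ ‖u‖ * ‖adjOperator hd‖ + ‖u‖ ^ 2 * ‖degOperator hd‖ := by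
        refine (norm_sub_le _ _).trans ?_
        rw [norm_smul, norm_smul, norm_pow]
    _ ≤ ρ * supDegree X + ρ ^ 2 * supDegree X := by
        gcongr
        · exact norm_adjOperator_le hd
        · exact norm_degOperator_le hd h1
    _ = _ := by ring

theorem alpha_pos (h1 : 1 ≤ supDegree X) : 0 < alpha X :=
  lt_of_lt_of_le (by exact_mod_cast h1) supDegree_le_alpha

/-- At `ρ = 1 / α` the left side would equal `(d α + d) / α² = 1`. -/
theorem perturbation_bound_lt_one (h1 : 1 ≤ supDegree X) {ρ : ℝ} (hρ : 0 ≤ ρ)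
    (h : alpha X * ρ < 1) : supDegree X * ρ + supDegree X * ρ ^ 2 < 1 := by
  have hα := alpha_pos h1
  have h2 := alpha_sq (X := X)
  have hd0 : (0 : ℝ) < supDegree X := by exact_mod_cast h1
  have h3 : alpha X ^ 2 * (supDegree X * ρ + supDegree X * ρ ^ 2) =
      supDegree X * alpha X * (alpha X * ρ) + supDegree X * (alpha X * ρ) ^ 2 := by ring
  have h4 : (alpha X * ρ) ^ 2 < 1 := by
    have : 0 ≤ alpha X * ρ := by positivity
    nlinarith
  have h5 : alpha X ^ 2 * (supDegree X * ρ + supDegree X * ρ ^ 2) < alpha X ^ 2 * 1 := by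
    rw [h3, mul_one, h2]
    have : supDegree X * alpha X * (alpha X * ρ) < supDegree X * alpha X :=
      mul_lt_of_lt_one_right (by positivity) h
    have : supDegree X * (alpha X * ρ) ^ 2 < (supDegree X : ℝ) :=
      mul_lt_of_lt_one_right hd0 h4
    linarith
  exact lt_of_mul_lt_mul_left h5 (by positivity)

/-- The derivative of `u ↦ A u - Q u²`. -/
noncomputable def perturbationDeriv (u : ℂ) : ℓ²(V, ℂ) →L[ℂ] ℓ²(V, ℂ) :=
  adjOperator hd - (2 * u) • degOperator hd

theorem hasDerivAt_perturbation (u : ℂ) :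
    HasDerivAt (perturbation hd) (perturbationDeriv hd u) u := by
  have h1 := (hasDerivAt_id u).smul_const (adjOperator hd)
  have h2 := ((hasDerivAt_id u).pow 2).smul_const (degOperator hd)
  refine (h1.sub h2).congr_deriv ?_
  simp [perturbationDeriv]

theorem perturbationDeriv_mem (Γ : Subgroup (X ≃g X)) (u : ℂ) :
    perturbationDeriv hd u ∈ invariantAlgebra Γ :=
  sub_mem (adjOperator_mem hd Γ) (smul_mem_invariantAlgebra _ (degOperator_mem hd Γ))

theorem norm_perturbationDeriv_le {u : ℂ} {ρ : ℝ} (hu : ‖u‖ ≤ ρ) :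
    ‖perturbationDeriv hd u‖ ≤ ‖adjOperator hd‖ + 2 * ρ * ‖degOperator hd‖ := by
  refine (norm_sub_le _ _).trans ?_
  rw [norm_smul, norm_mul, Complex.norm_ofNat]
  gcongr

section Trace

variable {Γ : Subgroup (X ≃g X)} {F : Finset V}
    (hfree : ∀ γ ∈ Γ, ∀ v : V, γ • v = v → γ = 1)
    (hF : ∀ v : V, ∃! x, x ∈ F ∧ x ∈ MulAction.orbit Γ v)

include hfree hF in
-- As `A` and `Q` need not commute, the rule `n B^(n-1) B'` holds only under the trace. The extra
-- factor `B^j` makes the induction work, and `D` must be invariant so that `B` can be moved around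
-- it.
theorem exists_hasDerivAt_perturbation_pow (n : ℕ) (u : ℂ) :
    ∃ D ∈ invariantAlgebra Γ, HasDerivAt (fun u => perturbation hd u ^ n) D u ∧
      ∀ j, traceCLM F (perturbation hd u ^ j * D) =
        n * traceCLM F (perturbation hd u ^ (j + n - 1) * perturbationDeriv hd u) := by
  induction n with
  | zero => exact ⟨0, zero_mem _, by simpa using hasDerivAt_const u _, by simp⟩
  | succ n ih =>
    obtain ⟨D, hD, hderiv, htr⟩ := ih
    have hB := perturbation_mem hd Γ u
    refine ⟨D * perturbation hd u + perturbation hd u ^ n * perturbationDeriv hd u,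
      add_mem (mul_mem hD hB) (mul_mem (pow_mem hB n) (perturbationDeriv_mem hd Γ u)), ?_,
      fun j => ?_⟩
    · simp only [pow_succ]
      exact hderiv.fun_mul (hasDerivAt_perturbation hd u)
    · have h1 := traceCLM_perturbation_comm hd hfree hF (mul_mem (pow_mem hB j) hD) u
      rw [mul_add, map_add, ← mul_assoc, ← h1, ← mul_assoc, ← mul_assoc, ← pow_succ', ← pow_add, htr,
        show j + 1 + n - 1 = j + n by omega, show j + (n + 1) - 1 = j + n by omega]
      push_cast
      ring

include hfree hF in
-- Jacobi's formula, obtained by differentiating term by term on a disc of radius `ρ < 1 / α`, where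
-- the powers of `B` decay uniformly.
theorem hasDerivAt_trace_mercator (h1 : 1 ≤ supDegree X) {u : ℂ} (hu : alpha X * ‖u‖ < 1) :
    HasDerivAt (fun u => traceCLM F (mercator (perturbation hd u)))
      (traceCLM F ((∑' n : ℕ, perturbation hd u ^ n) * perturbationDeriv hd u)) u := by
  have hα := alpha_pos h1
  obtain ⟨ρ, hρu, hρ⟩ := exists_between ((lt_div_iff₀' hα).2 hu)
  have hρ' : alpha X * ρ < 1 := (lt_div_iff₀' hα).1 hρ
  have hρ0 : 0 ≤ ρ := (norm_nonneg _).trans hρu.le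
  set q := supDegree X * ρ + supDegree X * ρ ^ 2 with hq
  have hq1 : q < 1 := perturbation_bound_lt_one h1 hρ0 hρ'
  have hq0 : 0 ≤ q := by positivity
  set M := ‖adjOperator hd‖ + 2 * ρ * ‖degOperator hd‖ with hM
  have hM0 : 0 ≤ M := by positivity
  have hpow : ∀ v ∈ Metric.ball (0 : ℂ) ρ, ∀ n, ‖perturbation hd v ^ n‖ ≤ 1 * q ^ n := by
    intro v hv n
    rw [one_mul]
    exact norm_pow_clm_le (norm_perturbation_le hd h1 (mem_ball_zero_iff.1 hv).le) n
  have hterm : ∀ (n : ℕ) (v : ℂ), HasDerivAt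
      (fun v => (n : ℂ)⁻¹ * traceCLM F (perturbation hd v ^ n))
      ((n : ℂ)⁻¹ * (n * traceCLM F (perturbation hd v ^ (n - 1) * perturbationDeriv hd v))) v := by
    intro n v
    obtain ⟨D, -, hderiv, htr⟩ := exists_hasDerivAt_perturbation_pow hd hfree hF n v
    have := htr 0
    rw [pow_zero, one_mul, zero_add] at this
    rw [← this]
    exact ((traceCLM F).hasFDerivAt.comp_hasDerivAt v hderiv).const_mul _
  have hcancel : ∀ (n : ℕ) (z : ℂ), ((n + 1 : ℕ) : ℂ)⁻¹ * ((n + 1 : ℕ) * z) = z := fun n z =>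
    inv_mul_cancel_left₀ (by exact_mod_cast n.succ_ne_zero) z
  have hbound : ∀ (n : ℕ) (v : ℂ), v ∈ Metric.ball (0 : ℂ) ρ →
      ‖(n : ℂ)⁻¹ * (n * traceCLM F (perturbation hd v ^ (n - 1) * perturbationDeriv hd v))‖ ≤
        ‖traceCLM F‖ * M * q ^ (n - 1) := by
    intro n v hv
    rcases n with _ | n
    · simp only [Nat.cast_zero, inv_zero, zero_mul, norm_zero]; positivity
    · rw [hcancel, Nat.add_sub_cancel]
      calc _ ≤ ‖traceCLM F‖ * ((1 * q ^ n) * M) := by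
            refine ((traceCLM F).le_opNorm _).trans ?_
            gcongr
            exact (norm_mul_le _ _).trans (mul_le_mul (hpow v hv n)
              (norm_perturbationDeriv_le hd (mem_ball_zero_iff.1 hv).le) (norm_nonneg _)
              (by positivity))
        _ = _ := by ring
  have hsumb : Summable fun n : ℕ => ‖traceCLM F‖ * M * q ^ (n - 1) := by
    refine Summable.mul_left _ ((summable_nat_add_iff 1).1 ?_)
    simpa using summable_geometric_of_lt_one hq0 hq1
  have hmer : ∀ v ∈ Metric.ball (0 : ℂ) ρ,
      HasSum (fun n : ℕ => (n : ℂ)⁻¹ * traceCLM F (perturbation hd v ^ n))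
        (traceCLM F (mercator (perturbation hd v))) := fun v hv => by
    have := (hasSum_mercator hq0 hq1 (hpow v hv)).mapL (traceCLM F)
    simpa only [map_smul, smul_eq_mul] using this
  have huU : u ∈ Metric.ball (0 : ℂ) ρ := mem_ball_zero_iff.2 hρu
  have hmain := hasDerivAt_tsum_of_isPreconnected hsumb Metric.isOpen_ball
    (convex_ball (0 : ℂ) ρ).isPreconnected (fun n v _ => hterm n v) hbound huU
    (hmer u huU).summable huU
  have hval : ∑' n : ℕ, (n : ℂ)⁻¹ *
      (n * traceCLM F (perturbation hd u ^ (n - 1) * perturbationDeriv hd u)) =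
      traceCLM F ((∑' n : ℕ, perturbation hd u ^ n) * perturbationDeriv hd u) := by
    have hgs : Summable fun n => perturbation hd u ^ n := Summable.of_norm_bounded
      ((summable_geometric_of_lt_one hq0 hq1).mul_left 1) (hpow u huU)
    have hall := Summable.of_norm_bounded hsumb (fun n => hbound n u huU)
    rw [hall.tsum_eq_zero_add]
    simp only [hcancel, Nat.add_sub_cancel, Nat.cast_zero, zero_mul, mul_zero, zero_add]
    exact ((hgs.hasSum.mul_right _).mapL (traceCLM F)).tsum_eq
  rw [hval] at hmain
  refine hmain.congr_of_eventuallyEq ?_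
  filter_upwards [Metric.isOpen_ball.mem_nhds huU] with v hv
  exact (hmer v hv).tsum_eq.symm

end Trace

/-! ### The resolvent as a generating function of walks without backtracking -/

theorem summable_nbOperator (h1 : 1 ≤ supDegree X) {u : ℂ} (hu : alpha X * ‖u‖ < 1) :
    Summable fun k : ℕ => u ^ (k + 1) • nbOperator hd k := by
  have hα := alpha_pos h1
  refine Summable.of_norm_bounded
    ((summable_geometric_of_lt_one (by positivity) hu).mul_left (alpha X * ‖u‖)) fun k => ?_
  rw [norm_smul, norm_pow, ← pow_succ', mul_pow, mul_comm]
  gcongr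
  exact norm_nbOperator_le hd h1 k

/-- `W(u) = 1 + ∑ u^(k+1) A_(k+1)`. -/
noncomputable def nbSeries (u : ℂ) : ℓ²(V, ℂ) →L[ℂ] ℓ²(V, ℂ) :=
  1 + ∑' k : ℕ, u ^ (k + 1) • nbOperator hd k

/-- The recurrence cancels all coefficients of order at least 3. In order 2 what remains is `A₂ - A²
+ Q = -1`, since `A₂` involves `Q + 1`. -/
theorem deformedLaplacian_mul_nbSeries (h1 : 1 ≤ supDegree X) {u : ℂ} (hu : alpha X * ‖u‖ < 1) :
    deformedLaplacian hd u * nbSeries hd u = (1 - u ^ 2) • 1 := by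
  have hs := summable_nbOperator hd h1 hu
  have hs1 := (summable_nat_add_iff 1).2 hs
  set A := adjOperator hd
  set Q := degOperator hd
  set S := ∑' k : ℕ, u ^ (k + 1) • nbOperator hd k with hS
  have e1 : S = u • A + ∑' k : ℕ, u ^ (k + 1 + 1) • nbOperator hd (k + 1) := by
    rw [hS, hs.tsum_eq_zero_add]
    simp only [zero_add, pow_one]
    rfl
  have e2 : ∑' k : ℕ, u ^ (k + 1 + 1) • nbOperator hd (k + 1) = u ^ 2 • (A * A - (Q + 1)) +
      (u • (A * ∑' k : ℕ, u ^ (k + 1 + 1) • nbOperator hd (k + 1)) - u ^ 2 • (Q * S)) := by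
    conv_lhs => rw [hs1.tsum_eq_zero_add]
    congr 1
    rw [← hs1.tsum_mul_left, ← hs.tsum_mul_left, ← (hs1.mul_left A).tsum_const_smul,
      ← (hs.mul_left Q).tsum_const_smul,
      ← ((hs1.mul_left A).const_smul u).tsum_sub ((hs.mul_left Q).const_smul (u ^ 2))]
    refine tsum_congr fun k => ?_
    rw [nbOperator_add_two, mul_smul_comm, mul_smul_comm, smul_smul, smul_smul, smul_sub]
    congr 2 <;> ring
  set R := ∑' k : ℕ, u ^ (k + 1 + 1) • nbOperator hd (k + 1)
  have e3 : A * S = u • (A * A) + A * R := by rw [e1, mul_add, mul_smul_comm]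
  have e4 : deformedLaplacian hd u * nbSeries hd u =
      1 + S - u • A - u • (A * S) + u ^ 2 • Q + u ^ 2 • (Q * S) := by
    rw [deformedLaplacian, nbSeries, add_mul, sub_mul, one_mul, mul_add, mul_add, mul_one, mul_one,
      smul_mul_assoc, smul_mul_assoc]
    abel
  rw [e4, e3]
  have e5 := e1
  rw [e2] at e5
  clear_value S R
  clear e1 e2 e3 e4 hS
  -- With the products made opaque the claim is linear in the remaining operators.
  generalize A * R = P at e5 ⊢
  generalize Q * S = P' at e5 ⊢
  rw [e5]
  module

/-! ### Comparison of the derivatives -/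

section Trace

variable {Γ : Subgroup (X ≃g X)} {F : Finset V}
    (hfree : ∀ γ ∈ Γ, ∀ v : V, γ • v = v → γ = 1)
    (hF : ∀ v : V, ∃! x, x ∈ F ∧ x ∈ MulAction.orbit Γ v)

include hd in
theorem norm_closedWalks_le (F : Finset V) (m : ℕ) :
    ‖((closedWalks X F m).card : ℂ)‖ ≤ F.card * supDegree X * (supDegree X : ℝ) ^ m := by
  rw [Complex.norm_natCast]
  exact_mod_cast card_closedWalks_le X (degree_le_supDegree hd) F m

include hd in
theorem hasDerivAt_closedWalks {u : ℂ} (hu : supDegree X * ‖u‖ < 1) (F : Finset V) :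
    (Summable fun k : ℕ => ((closedWalks X F (k + 1)).card : ℂ) * u ^ k) ∧
    HasDerivAt (fun u : ℂ => ∑' m : ℕ, ((closedWalks X F m).card : ℂ) * (u ^ m / m))
      (∑' k : ℕ, ((closedWalks X F (k + 1)).card : ℂ) * u ^ k) u :=
  hasDerivAt_tsum_pow_div (N := fun m => ((closedWalks X F m).card : ℂ)) (Nat.cast_nonneg _) hu
    (norm_closedWalks_le hd F)

include hfree hF in
-- The recurrence is summed; the last two terms compensate for the summand `1` of `nbSeries`.
theorem closedWalks_series_eq (h1 : 1 ≤ supDegree X) {u : ℂ} (hu : alpha X * ‖u‖ < 1) :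
    u * (∑' k : ℕ, ((closedWalks X F (k + 1)).card : ℂ) * u ^ k) * (1 - u ^ 2) =
      traceCLM F (nbSeries hd u) - u ^ 2 * traceCLM F (degOperator hd * nbSeries hd u) -
        F.card + u ^ 2 * traceCLM F (degOperator hd) := by
  obtain ⟨r1, r2, r3⟩ := card_closedWalks_recurrence hd hfree hF
  have hs := summable_nbOperator hd h1 hu
  have hsb : HasSum (fun k => u ^ (k + 1) * traceCLM F (nbOperator hd k))
      (traceCLM F (∑' k : ℕ, u ^ (k + 1) • nbOperator hd k)) := by
    simpa only [map_smul, smul_eq_mul] using hs.hasSum.mapL (traceCLM F)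
  have hsc : HasSum (fun k => u ^ (k + 1) * traceCLM F (degOperator hd * nbOperator hd k))
      (traceCLM F (degOperator hd * ∑' k : ℕ, u ^ (k + 1) • nbOperator hd k)) := by
    simpa only [mul_smul_comm, map_smul, smul_eq_mul] using
      (hs.hasSum.mul_left (degOperator hd)).mapL (traceCLM F)
  have hsN := (hasDerivAt_closedWalks hd ((mul_le_mul_of_nonneg_right supDegree_le_alpha
      (norm_nonneg u)).trans_lt hu) F).1
  have key := tsum_mul_one_sub_sq_of_recurrence
    (N := fun m => ((closedWalks X F m).card : ℂ)) hsb.summable hsc.summable hsN r1 r2 r3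
  rw [hsb.tsum_eq, hsc.tsum_eq] at key
  rw [key, nbSeries, mul_add, mul_one, map_add, map_add, traceCLM_one]
  ring

include hfree hF in
/-- The logarithmic form of the determinant formula. -/
theorem closedWalks_tsum_eq (h1 : 1 ≤ supDegree X) {u : ℂ} (hu : alpha X * ‖u‖ < 1) :
    ∑' m : ℕ, ((closedWalks X F m).card : ℂ) * (u ^ m / m) =
      traceCLM F (mercator (perturbation hd u)) +
        (F.card - (∑ x ∈ F, (X.degree x : ℂ)) / 2) * Complex.log (1 - u ^ 2) := by
  have hα := alpha_pos h1
  have hα1 : 1 < alpha X := by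
    have := alpha_sq (X := X)
    have h2 : (1 : ℝ) ≤ supDegree X := by exact_mod_cast h1
    nlinarith
  set χ : ℂ := F.card - (∑ x ∈ F, (X.degree x : ℂ)) / 2 with hχ
  have hball : ∀ v ∈ Metric.ball (0 : ℂ) (1 / alpha X), alpha X * ‖v‖ < 1 := fun v hv =>
    (lt_div_iff₀' hα).1 (mem_ball_zero_iff.1 hv)
  have hv2 : ∀ v ∈ Metric.ball (0 : ℂ) (1 / alpha X), ‖v ^ 2‖ < 1 := fun v hv => by
    have h2 := hball v hv
    have h3 : ‖v‖ < 1 := by nlinarith [norm_nonneg v]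
    rw [norm_pow]
    exact pow_lt_one₀ (norm_nonneg _) h3 two_ne_zero
  have hderiv : ∀ v ∈ Metric.ball (0 : ℂ) (1 / alpha X), HasDerivAt
      (fun u : ℂ => ∑' m : ℕ, ((closedWalks X F m).card : ℂ) * (u ^ m / m) -
        (traceCLM F (mercator (perturbation hd u)) + χ * Complex.log (1 - u ^ 2))) 0 v := by
    intro v hv
    have hv1 := hball v hv
    have hd1 : supDegree X * ‖v‖ < 1 := (mul_le_mul_of_nonneg_right supDegree_le_alpha
      (norm_nonneg v)).trans_lt hv1
    have hslit : 1 - v ^ 2 ∈ Complex.slitPlane := by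
      have := Complex.mem_slitPlane_of_norm_lt_one (z := -v ^ 2) (by rw [norm_neg]; exact hv2 v hv)
      rwa [← sub_eq_add_neg] at this
    have hne : 1 - v ^ 2 ≠ 0 := Complex.slitPlane_ne_zero hslit
    have hlog : HasDerivAt (fun u : ℂ => Complex.log (1 - u ^ 2)) (-(2 * v) / (1 - v ^ 2)) v := by
      have : HasDerivAt (fun u : ℂ => 1 - u ^ 2) (-(2 * v)) v := by
        simpa using (hasDerivAt_pow 2 v).const_sub 1
      exact this.clog hslit
    have hg := (hasDerivAt_closedWalks hd hd1 F).2
    have hh := hasDerivAt_trace_mercator hd hfree hF h1 hv1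
    refine (hg.sub (hh.add (hlog.const_mul χ))).congr_deriv ?_
    have hB : ‖perturbation hd v‖ < 1 := (norm_perturbation_le hd h1 le_rfl).trans_lt
      (perturbation_bound_lt_one h1 (norm_nonneg _) hv1)
    set G := ∑' n : ℕ, perturbation hd v ^ n with hG
    have hGΔ : G * deformedLaplacian hd v = 1 := by
      rw [← one_sub_perturbation]
      exact geom_series_mul_neg _ hB
    -- The series is only known to be a right inverse of `Δ` up to the factor `1 - v²`; the left
    -- inverse `G` of `Δ` identifies it.
    have hW : nbSeries hd v = (1 - v ^ 2) • G := by
      have := congrArg (G * ·) (deformedLaplacian_mul_nbSeries hd h1 hv1)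
      simp only [← mul_assoc, hGΔ, one_mul, mul_smul_comm, mul_one] at this
      exact this
    have hser := closedWalks_series_eq hd hfree hF h1 hv1
    rw [hW, mul_smul_comm, map_smul, map_smul, smul_eq_mul, smul_eq_mul,
      traceCLM_degOperator_comm] at hser
    -- The comparison is carried out after multiplication by `v`, so `v = 0` is separate; there it
    -- says that closed walks of length `1` are counted by the trace of `A`.
    rcases eq_or_ne v 0 with rfl | hv0
    · have hB0 : perturbation hd 0 = 0 := by simp [perturbation]
      have hG1 : G = 1 := by
        rw [deformedLaplacian] at hGΔ
        simpa using hGΔ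
      have hN1 : ∑' k : ℕ, ((closedWalks X F (k + 1)).card : ℂ) * 0 ^ k =
          (closedWalks X F 1).card := by
        rw [tsum_eq_single 0 (fun k hk => by simp [hk])]
        simp
      rw [hN1, hG1, (card_closedWalks_recurrence hd hfree hF).1]
      simp [perturbationDeriv, nbOperator]
    · have hGB : v * traceCLM F (G * perturbationDeriv hd v) =
          traceCLM F G - F.card - v ^ 2 * traceCLM F (G * degOperator hd) := by
        -- This uses `v B' = 1 - Δ - v² Q` and `G Δ = 1`.
        have : v • (G * perturbationDeriv hd v) = G - 1 - v ^ 2 • (G * degOperator hd) := by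
          rw [← hGΔ, deformedLaplacian, perturbationDeriv, mul_sub, mul_add, mul_sub, mul_one,
            mul_smul_comm, mul_smul_comm, mul_smul_comm]
          module
        rw [← smul_eq_mul, ← map_smul, this, map_sub, map_sub, map_smul, traceCLM_one, smul_eq_mul]
      rw [traceCLM_degOperator] at hser
      refine mul_left_cancel₀ (mul_ne_zero hv0 hne) ?_
      rw [mul_zero, mul_sub, mul_add]
      have h3 : v * (1 - v ^ 2) * (χ * (-(2 * v) / (1 - v ^ 2))) = -(2 * v ^ 2 * χ) := by
        field_simp
      rw [h3, hχ]
      -- The operator traces cancel and leave `v² (∑ deg - 2 |F|) = -2 v² χ`, the contribution of `χ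
      -- log (1 - v²)`.
      linear_combination hser - (1 - v ^ 2) * hGB
  have h0 : (0 : ℂ) ∈ Metric.ball (0 : ℂ) (1 / alpha X) := Metric.mem_ball_self (by positivity)
  have huU : u ∈ Metric.ball (0 : ℂ) (1 / alpha X) :=
    mem_ball_zero_iff.2 ((lt_div_iff₀' hα).2 hu)
  have hconst := Metric.isOpen_ball.is_const_of_deriv_eq_zero
    (convex_ball (0 : ℂ) (1 / alpha X)).isPreconnected
    (fun v hv => (hderiv v hv).differentiableAt.differentiableWithinAt)
    (fun v hv => (hderiv v hv).deriv) huU h0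
  have hzero : (∑' m : ℕ, ((closedWalks X F m).card : ℂ) * ((0 : ℂ) ^ m / m) -
        (traceCLM F (mercator (perturbation hd 0)) + χ * Complex.log (1 - 0 ^ 2))) = 0 := by
    have hB0 : perturbation hd 0 = 0 := by simp [perturbation]
    have h2 : ∀ m : ℕ, ((closedWalks X F m).card : ℂ) * ((0 : ℂ) ^ m / m) = 0 := fun m => by
      rcases m with _ | m <;> simp
    simp [h2, hB0, mercator_zero]
  rw [hzero] at hconst
  exact sub_eq_zero.1 hconst

end Trace

end Analytic

/-! ## The determinant formula -/

section Main

variable {V : Type*} {X : SimpleGraph V} {Γ : Subgroup (X ≃g X)} {F : Finset V}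

theorem card_orbits (hF : ∀ v : V, ∃! x, x ∈ F ∧ x ∈ MulAction.orbit Γ v) :
    Nat.card (MulAction.orbitRel.Quotient Γ V) = F.card := by
  let f : F → MulAction.orbitRel.Quotient Γ V := fun x =>
    Quotient.mk (MulAction.orbitRel Γ V) x.1
  have hf : Function.Bijective f := by
    constructor
    · rintro ⟨x, hx⟩ ⟨y, hy⟩ h
      have h1 : x ∈ MulAction.orbit Γ y := Quotient.exact h
      exact Subtype.ext ((hF y).unique ⟨hx, h1⟩ ⟨hy, MulAction.mem_orbit_self _⟩)
    · intro q
      induction q using Quotient.inductionOn with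
      | _ v =>
        obtain ⟨x, ⟨hx, hxv⟩, -⟩ := hF v
        exact ⟨⟨x, hx⟩, Quotient.sound (s := MulAction.orbitRel Γ V) hxv⟩
  rw [← Nat.card_eq_of_bijective f hf, Nat.card_eq_fintype_card, Fintype.card_coe]

variable [X.LocallyFinite]

/-- By freeness every orbit of oriented edges has exactly one member whose origin lies in `F`; this
holds also for inverted edges. -/
theorem card_dart_orbits (hfree : ∀ γ ∈ Γ, ∀ v : V, γ • v = v → γ = 1)
    (hF : ∀ v : V, ∃! x, x ∈ F ∧ x ∈ MulAction.orbit Γ v) :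
    Nat.card (MulAction.orbitRel.Quotient Γ X.Dart) = ∑ x ∈ F, X.degree x := by
  let f : F.sigma (fun x => X.neighborFinset x) → MulAction.orbitRel.Quotient Γ X.Dart := fun p =>
    Quotient.mk (MulAction.orbitRel Γ X.Dart)
      ⟨(p.1.1, p.1.2), (X.mem_neighborFinset _ _).1 (Finset.mem_sigma.1 p.2).2⟩
  have hf : Function.Bijective f := by
    constructor
    · rintro ⟨⟨x, y⟩, hp⟩ ⟨⟨x', y'⟩, hp'⟩ h
      obtain ⟨γ, hγ⟩ := Quotient.exact h
      have h1 : γ • x' = x := congrArg (fun e : X.Dart => e.fst) hγ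
      have h2 : γ • y' = y := congrArg (fun e : X.Dart => e.snd) hγ
      have h3 : x = x' := (hF x').unique ⟨(Finset.mem_sigma.1 hp).1, ⟨γ, h1⟩⟩
        ⟨(Finset.mem_sigma.1 hp').1, MulAction.mem_orbit_self _⟩
      subst h3
      have h4 : γ = 1 := Subtype.ext (hfree γ γ.2 _ h1)
      rw [h4, one_smul] at h2
      subst h2
      rfl
    · intro q
      induction q using Quotient.inductionOn with
      | _ e =>
        obtain ⟨x, ⟨hx, γ, hγ⟩, -⟩ := hF e.fst
        have hadj : X.Adj (γ • e.fst) (γ • e.snd) := (γ : X ≃g X).map_adj_iff.2 e.adj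
        refine ⟨⟨⟨γ • e.fst, γ • e.snd⟩, ?_⟩, Quotient.sound (s := MulAction.orbitRel Γ X.Dart)
          ⟨γ, rfl⟩⟩
        rw [Finset.mem_sigma, SimpleGraph.mem_neighborFinset]
        refine ⟨?_, hadj⟩
        change γ • e.fst = x at hγ
        rwa [hγ]
  rw [← Nat.card_eq_of_bijective f hf, Nat.card_eq_fintype_card, Fintype.card_coe,
    Finset.card_sigma]
  rfl

theorem quotientEulerChar_eq_sum (hfree : ∀ γ ∈ Γ, ∀ v : V, γ • v = v → γ = 1)
    (hF : ∀ v : V, ∃! x, x ∈ F ∧ x ∈ MulAction.orbit Γ v) :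
    (quotientEulerChar Γ : ℂ) = F.card - (∑ x ∈ F, (X.degree x : ℂ)) / 2 := by
  rw [quotientEulerChar, card_orbits hF, card_dart_orbits hfree hF]
  push_cast
  rfl

/-! ### Evaluation of the determinant and the final comparison -/

variable (hd : BddAbove (Set.range fun v => X.degree v))

omit [X.LocallyFinite] in
-- The identity has trace `|F|`, an integer, so only `exp κ = w⁻¹` matters and the choice of `K`
-- drops out.
theorem analyticDet_eq {T : ℓ²(V, ℂ) →L[ℂ] ℓ²(V, ℂ)} (K : LogContour T) {w : ℂ}
    (hw : w ≠ 0) (h : ∀ z ∈ spectrum ℂ T, ‖1 - w * z‖ < 1) :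
    analyticDet F K = w⁻¹ ^ F.card * Complex.exp (-traceCLM F (mercator (1 - w • T))) := by
  obtain ⟨κ, hκ, hlog⟩ := K.exists_log_eq hw h
  rw [analyticDet, ← traceCLM_apply, hlog, map_sub, map_smul, traceCLM_one, smul_eq_mul,
    sub_eq_add_neg, Complex.exp_add, mul_comm κ, Complex.exp_nat_mul, hκ]

theorem norm_one_sub_lt_one_of_mem_spectrum (h1 : 1 ≤ supDegree X) {u : ℂ}
    (hu : alpha X * ‖u‖ < 1) : ∀ z ∈ spectrum ℂ (deformedLaplacian hd u), ‖1 - z‖ < 1 := by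
  intro z hz
  have hB : ‖perturbation hd u‖ < 1 := (norm_perturbation_le hd h1 le_rfl).trans_lt
    (perturbation_bound_lt_one h1 (norm_nonneg _) hu)
  have h2 : 1 - z ∈ spectrum ℂ (perturbation hd u) := by
    have h3 : perturbation hd u = algebraMap ℂ _ 1 - deformedLaplacian hd u := by
      rw [map_one, ← one_sub_perturbation, sub_sub_cancel]
    rw [h3, ← spectrum.singleton_sub_eq]
    exact ⟨1, rfl, z, hz, rfl⟩
  have h4 := spectrum.norm_le_norm_mul_of_mem h2
  -- Only an inequality, because `V` may be empty.
  have h5 : ‖(1 : ℓ²(V, ℂ) →L[ℂ] ℓ²(V, ℂ))‖ ≤ 1 := ContinuousLinearMap.norm_id_le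
  nlinarith [norm_nonneg (perturbation hd u)]

theorem determinant_formula_of_one_le (hfree : ∀ γ ∈ Γ, ∀ v : V, γ • v = v → γ = 1)
    (hF : ∀ v : V, ∃! x, x ∈ F ∧ x ∈ MulAction.orbit Γ v) (h1 : 1 ≤ supDegree X) {u : ℂ}
    (hu : alpha X * ‖u‖ < 1) (hu1 : u ^ 2 ≠ 1) :
    (0 : ℂ) ∉ convexHull ℝ (spectrum ℂ (deformedLaplacian hd u)) ∧
    Multipliable (eulerFactor Γ u) ∧
    ∀ K : LogContour (deformedLaplacian hd u),
      1 / zeta Γ u = (1 - u ^ 2) ^ (-(quotientEulerChar Γ : ℂ)) * analyticDet F K := by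
  have hspec := norm_one_sub_lt_one_of_mem_spectrum hd h1 hu
  have hdu : supDegree X * ‖u‖ < 1 := (mul_le_mul_of_nonneg_right supDegree_le_alpha
    (norm_nonneg u)).trans_lt hu
  have hd1 : (1 : ℝ) ≤ supDegree X := by exact_mod_cast h1
  have hu' : ‖u‖ < 1 := by nlinarith [norm_nonneg u]
  obtain ⟨hs, hsum⟩ := hasSum_reducedPath X (degree_le_supDegree hd) F hdu
  have hprod := hasProd_eulerFactor hfree hF hu' hs
  refine ⟨fun h0 => ?_, hprod.multipliable, fun K => ?_⟩
  · have hsub : convexHull ℝ (spectrum ℂ (deformedLaplacian hd u)) ⊆ Metric.ball 1 1 :=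
      convexHull_min (fun z hz => by
        rw [mem_ball_iff_norm, norm_sub_rev]
        exact hspec z hz) (convex_ball _ _)
    simpa using hsub h0
  · have hne : 1 - u ^ 2 ≠ 0 := sub_ne_zero.2 hu1.symm
    rw [zeta, hprod.tprod_eq, ← hsum.tsum_eq, closedWalks_tsum_eq hd hfree hF h1 hu,
      ← quotientEulerChar_eq_sum hfree hF,
      analyticDet_eq K one_ne_zero (by simpa only [one_mul] using hspec),
      one_smul, ← one_sub_perturbation, sub_sub_cancel, inv_one, one_pow, one_mul,
      Complex.cpow_def_of_ne_zero hne, ← Complex.exp_add, one_div, ← Complex.exp_neg]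
    congr 1
    ring

/-- Without edges `Q = -1`, so `Δ` is the scalar `1 - u²`, there are no cycles, and `χ = |F|`. Here
`α = 0` puts no bound on `u`, so `Δ` may be far from `1` and the base point `1 - u²` is used; the
Mercator series is then zero. -/
theorem determinant_formula_of_eq_zero (hfree : ∀ γ ∈ Γ, ∀ v : V, γ • v = v → γ = 1)
    (hF : ∀ v : V, ∃! x, x ∈ F ∧ x ∈ MulAction.orbit Γ v) (h0 : supDegree X = 0) {u : ℂ}
    (hu1 : u ^ 2 ≠ 1) :
    (0 : ℂ) ∉ convexHull ℝ (spectrum ℂ (deformedLaplacian hd u)) ∧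
    Multipliable (eulerFactor Γ u) ∧
    ∀ K : LogContour (deformedLaplacian hd u),
      1 / zeta Γ u = (1 - u ^ 2) ^ (-(quotientEulerChar Γ : ℂ)) * analyticDet F K := by
  have hdeg : ∀ v, X.degree v = 0 := fun v => by
    have := degree_le_supDegree hd v
    omega
  have hne : 1 - u ^ 2 ≠ 0 := sub_ne_zero.2 hu1.symm
  have hempty : IsEmpty (PrimeClass Γ) := ⟨fun q => by
    obtain ⟨c, ⟨C, -⟩, -⟩ := q.2
    have h1 : C.vert (0 + 1) ∈ X.neighborFinset (C.vert 0) :=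
      (X.mem_neighborFinset _ _).2 (C.adj 0)
    rw [Finset.card_eq_zero.1 ((X.card_neighborFinset_eq_degree _).trans (hdeg _))] at h1
    exact Finset.notMem_empty _ h1⟩
  have hΔ : deformedLaplacian hd u = algebraMap ℂ _ (1 - u ^ 2) := by
    have hA : adjOperator hd = 0 := by
      have := norm_adjOperator_le hd
      rw [h0, Nat.cast_zero] at this
      exact norm_le_zero_iff.1 this
    have hQ : degOperator hd + 1 = 0 := by
      have := norm_degOperator_add_one_le hd
      rw [h0, Nat.cast_zero] at this
      exact norm_le_zero_iff.1 this
    rw [deformedLaplacian, hA, eq_neg_of_add_eq_zero_left hQ, Algebra.algebraMap_eq_smul_one]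
    module
  have hspec : spectrum ℂ (deformedLaplacian hd u) ⊆ {1 - u ^ 2} := by
    rw [hΔ]
    rcases subsingleton_or_nontrivial (ℓ²(V, ℂ) →L[ℂ] ℓ²(V, ℂ)) with h | h
    · rw [spectrum.of_subsingleton]; exact Set.empty_subset _
    · rw [spectrum.scalar_eq]
  refine ⟨fun h => ?_, ?_, fun K => ?_⟩
  · have := convexHull_min hspec (convex_singleton _) h
    exact hne this.symm
  · exact multipliable_of_hasFiniteMulSupport (Set.toFinite _)
  · have hprod : zeta Γ u = 1 := tprod_empty
    have hχ : (quotientEulerChar Γ : ℂ) = F.card := by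
      rw [quotientEulerChar_eq_sum hfree hF]
      simp [hdeg]
    have h1 : (1 : ℓ²(V, ℂ) →L[ℂ] ℓ²(V, ℂ)) - (1 - u ^ 2)⁻¹ • deformedLaplacian hd u = 0 := by
      rw [hΔ, Algebra.algebraMap_eq_smul_one, smul_smul, inv_mul_cancel₀ hne, one_smul, sub_self]
    rw [hprod, hχ, analyticDet_eq K (inv_ne_zero hne) (fun z hz => by
      rw [hspec hz, inv_mul_cancel₀ hne, sub_self, norm_zero]
      exact one_pos), h1, mercator_zero, map_zero, neg_zero, Complex.exp_zero, mul_one, inv_inv,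
      Complex.cpow_neg, Complex.cpow_natCast, inv_mul_cancel₀ (pow_ne_zero _ hne), one_div, inv_one]

end Main

end IharaZeta

open IharaZeta in
theorem mainTheorem1 {V : Type*} [Countable V] (X : SimpleGraph V) [X.LocallyFinite]
    (hd : BddAbove (Set.range fun v => X.degree v))
    (Γ : Subgroup (X ≃g X)) [Countable Γ]
    (hfree : ∀ γ ∈ Γ, ∀ v : V, γ • v = v → γ = 1)
    [Finite (MulAction.orbitRel.Quotient Γ V)]
    (F : Finset V) (hF : ∀ v : V, ∃! x, x ∈ F ∧ x ∈ MulAction.orbit Γ v)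
    (u : ℂ) (hu : alpha X * ‖u‖ < 1)
    -- automatic if `X` has an edge, because then `1 < alpha X`
    (hu1 : u ^ 2 ≠ 1) :
    deformedLaplacian hd u ∈ invariantAlgebra Γ ∧
    (0 : ℂ) ∉ convexHull ℝ (spectrum ℂ (deformedLaplacian hd u)) ∧
    Multipliable (eulerFactor Γ u) ∧
    ∀ K : LogContour (deformedLaplacian hd u),
      1 / zeta Γ u = (1 - u ^ 2) ^ (-(quotientEulerChar Γ : ℂ)) * analyticDet F K := by
  refine ⟨deformedLaplacian_mem hd Γ u, ?_⟩
  rcases (supDegree X).eq_zero_or_pos with h | h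
  · exact determinant_formula_of_eq_zero hd hfree hF h hu1
  · exact determinant_formula_of_one_le hd hfree hF h hu hu1
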